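/- Let $k$ be a field, $Q=(Q_0,Q_1)$ a finite quiver, and $A=kQ/I$ a monomial algebra, i.e. $I$ is an admissible ideal of the path algebra $kQ$ generated by some paths of length $\ge 2$. A cycle in $Q$ is a sequence of arrows $a_1\cdots a_n$ ($n\ge 1$) such that each $a_i$ ends where $a_{i+1}$ starts and $a_n$ ends where $a_1$ starts; it is proper if it is not a power $X^m$, $m\ge 2$, of a cycle $X$. Two proper cycles lie in one orbit if one is a cyclic rotation of the other. For a cycle $Y=a_1\cdots a_n$ let $C$ be the quiver that is a basic cycle with $n$ vertices and $n$ arrows, with its natural quiver morphism $C\to Q$ sending the $i$-th arrow to $a_i$; the cycle algebra overlying $A$ constructed from $Y$ is $Z=kC/J$, where $J$ is generated by the paths of $C$ whose image in $Q$ lies in $I$. The minimal cycle algebras overlying $A$ are those constructed from proper cycles, one for each orbit of proper cycles. Let $HH_n$ denote Hochschild homology (the homology of the Hochschild complex $(A^{\otimes_k (n+1)},b)$) and $HC_n$ cyclic homology (the homology of the total complex of the cyclic bicomplex). For a two-sided ideal $J$ of an algebra $B$, let $HH_n(B,J)$ and $HC_n(B,J)$ be the relative groups, i.e. the homology of the kernel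 of the map from the Hochschild complex (respectively the total cyclic complex) of $B$ to that of $B/J$. Write $\operatorname{rad} Z$ for the Jacobson radical of $Z$. Then, as $k$-vector spaces, with $Z$ running over the minimal cycle algebras overlying $A$ (one for each orbit of proper cycles in $Q$, with an arbitrary choice of representatives), $$HH_n(A)\cong\bigoplus_Z HH_n(Z)\quad (n\ge 1),\qquad HH_0(A)\cong k^{Q_0}\oplus\bigoplus_Z HH_0(Z,\operatorname{rad} Z),$$ $$HC_n(A)\cong\bigoplus_Z HC_n(Z)\quad (n \text{ odd}),\qquad HC_n(A)\cong k^{Q_0}\oplus\bigoplus_Z HC_n(Z,\operatorname{rad} Z)\quad (n\ge 0 \text{ even}).$$ -/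

import Mathlib

open scoped DirectSum

namespace MonomialHH

/-! ### Chain-level homology over a field -/

section Homology

variable {k : Type*} [Field k] {C : ℕ → Type*} [∀ n, AddCommGroup (C n)] [∀ n, Module k (C n)]

/-- The `n`-cycles of a sequence `⋯ → C 2 → C 1 → C 0 → 0`. -/
def cycles (d : ∀ n, C (n + 1) →ₗ[k] C n) : ∀ n, Submodule k (C n)
  | 0 => ⊤
  | n + 1 => LinearMap.ker (d n)

/-- The homology `H_n = ker / im` of the complex `⋯ → C 2 → C 1 → C 0 → 0`. -/
abbrev Homology (d : ∀ n, C (n + 1) →ₗ[k] C n) (n : ℕ) : Type _ :=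
  ↥(cycles d n) ⧸ (LinearMap.range (d n)).submoduleOf (cycles d n)

/-- The homology of the subcomplex `K` of the complex `⋯ → C 2 → C 1 → C 0 → 0`. -/
abbrev SubHomology (d : ∀ n, C (n + 1) →ₗ[k] C n) (K : ∀ n, Submodule k (C n)) (n : ℕ) : Type _ :=
  ↥(K n ⊓ cycles d n) ⧸ ((K (n + 1)).map (d n)).submoduleOf (K n ⊓ cycles d n)

end Homology

/-! ### Hochschild and cyclic homology of an associative unital algebra -/

section Hochschild

variable (k : Type*) [Field k] (A : Type*) [Ring A] [Algebra k A]

/-- The chains `A^{⊗ (n+1)}`, tensor product over `k`. -/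
abbrev Chain (n : ℕ) : Type _ := PiTensorProduct k (fun _ : Fin (n + 1) => A)

variable {k A} in
theorem contractNth_update {n : ℕ} (i : Fin (n + 1)) (a : Fin (n + 2) → A) (j : Fin (n + 2)) :
    ∃ (l : Fin (n + 1)) (L : A →ₗ[k] A), ∀ z : A,
      Fin.contractNth i.castSucc (· * ·) (Function.update a j z) =
        Function.update (Fin.contractNth i.castSucc (· * ·) a) l (L z) := by
  rcases lt_trichotomy (j : ℕ) i with h | h | h
  · refine ⟨⟨j, by omega⟩, LinearMap.id, fun z => funext fun m => ?_⟩
    simp only [Fin.contractNth, Function.update_apply, Fin.ext_iff, Fin.val_castSucc, Fin.val_succ,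
      LinearMap.id_apply]
    split_ifs <;> first | rfl | (exfalso; omega)
  · refine ⟨i, LinearMap.mulRight k (a i.succ), fun z => funext fun m => ?_⟩
    simp only [Fin.contractNth, Function.update_apply, Fin.ext_iff, Fin.val_castSucc, Fin.val_succ,
      LinearMap.mulRight_apply]
    split_ifs with h1 h2 h3 h4 h5 <;> first | rfl | (exfalso; omega) | skip
    have : m = i := Fin.ext (by omega)
    subst this; rfl
  · by_cases h' : (j : ℕ) = i + 1
    · refine ⟨i, LinearMap.mulLeft k (a i.castSucc), fun z => funext fun m => ?_⟩
      simp only [Fin.contractNth, Function.update_apply, Fin.ext_iff, Fin.val_castSucc,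
        Fin.val_succ, LinearMap.mulLeft_apply]
      split_ifs with h1 h2 h3 h4 h5 <;> first | rfl | (exfalso; omega) | skip
      have : m = i := Fin.ext (by omega)
      subst this; rfl
    · refine ⟨⟨j - 1, by omega⟩, LinearMap.id, fun z => funext fun m => ?_⟩
      simp only [Fin.contractNth, Function.update_apply, Fin.ext_iff, Fin.val_castSucc,
        Fin.val_succ, LinearMap.id_apply]
      split_ifs <;> first | rfl | (exfalso; omega)

/-- The multilinear map `(a₀, …, a_{n+1}) ↦ a₀ ⊗ ⋯ ⊗ a_i a_{i+1} ⊗ ⋯ ⊗ a_{n+1}`, `0 ≤ i ≤ n`. -/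
noncomputable def faceMultilinear (n : ℕ) (i : Fin (n + 1)) :
    MultilinearMap k (fun _ : Fin (n + 2) => A) (Chain k A n) :=
  MultilinearMap.mk'
    (fun a => PiTensorProduct.tprod k (Fin.contractNth i.castSucc (· * ·) a))
    (fun a j x y => by
      obtain ⟨l, L, h⟩ := contractNth_update (k := k) i a j
      simp only [h, map_add, MultilinearMap.map_update_add])
    (fun a j c x => by
      obtain ⟨l, L, h⟩ := contractNth_update (k := k) i a j
      simp only [h, map_smul, MultilinearMap.map_update_smul])

/-- The face `a₀ ⊗ ⋯ ⊗ a_{n+1} ↦ a₀ ⊗ ⋯ ⊗ a_i a_{i+1} ⊗ ⋯ ⊗ a_{n+1}`, `0 ≤ i ≤ n`. -/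
noncomputable def face (n : ℕ) (i : Fin (n + 1)) : Chain k A (n + 1) →ₗ[k] Chain k A n :=
  PiTensorProduct.lift (faceMultilinear k A n i)

theorem face_tprod (n : ℕ) (i : Fin (n + 1)) (a : Fin (n + 2) → A) :
    face k A n i (PiTensorProduct.tprod k a) =
      PiTensorProduct.tprod k (Fin.contractNth i.castSucc (· * ·) a) := by
  simp [face, faceMultilinear]

/-- The rotation `a₀ ⊗ ⋯ ⊗ a_n ↦ a_n ⊗ a₀ ⊗ ⋯ ⊗ a_{n-1}`, without sign. -/
noncomputable def rot (n : ℕ) : Chain k A n →ₗ[k] Chain k A n :=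
  (PiTensorProduct.reindex k (fun _ : Fin (n + 1) => A) (finRotate (n + 1))).toLinearMap

theorem rot_tprod (n : ℕ) (a : Fin (n + 1) → A) :
    rot k A n (PiTensorProduct.tprod k a) =
      PiTensorProduct.tprod k (fun i => a ((finRotate (n + 1)).symm i)) := by
  simp [rot, PiTensorProduct.reindex_tprod]

/-- The differential `b'` of the bar complex,
`b'(a₀,…,a_{n+1}) = ∑_{i=0}^{n} (-1)^i (a₀,…,a_i a_{i+1},…,a_{n+1})`. -/
noncomputable def barDiff (n : ℕ) : Chain k A (n + 1) →ₗ[k] Chain k A n :=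
  ∑ i : Fin (n + 1), (-1 : k) ^ (i : ℕ) • face k A n i

/-- The Hochschild differential
`b(a₀,…,a_{n+1}) = ∑_{i=0}^{n} (-1)^i (a₀,…,a_i a_{i+1},…,a_{n+1})
  + (-1)^{n+1} (a_{n+1} a₀, a₁,…,a_n)`. -/
noncomputable def hochDiff (n : ℕ) : Chain k A (n + 1) →ₗ[k] Chain k A n :=
  barDiff k A n + (-1 : k) ^ (n + 1) • (face k A n 0 ∘ₗ rot k A (n + 1))

/-- Hochschild homology `HH_n(A)`. -/
abbrev HH (n : ℕ) : Type _ := Homology (hochDiff k A) n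

/-- The signed cyclic operator `t(a₀,…,a_n) = (-1)^n (a_n,a₀,…,a_{n-1})`. -/
noncomputable def cycOp (n : ℕ) : Chain k A n →ₗ[k] Chain k A n :=
  (-1 : k) ^ n • rot k A n

/-- The norm operator `N = 1 + t + ⋯ + t^n` on `A^{⊗ (n+1)}`. -/
noncomputable def normOp (n : ℕ) : Chain k A n →ₗ[k] Chain k A n :=
  ∑ i ∈ Finset.range (n + 1), cycOp k A n ^ i

/-- Degree `n` of the total complex of the cyclic bicomplex `CC(A)`, whose entry in bidegree
`(p, q)` (column `p ≥ 0`, row `q ≥ 0`) is `A^{⊗ (q+1)}`. The component with index `q ≤ n` is the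
entry in bidegree `(n - q, q)`. -/
abbrev Tot (n : ℕ) : Type _ := ∀ q : Fin (n + 1), Chain k A q

/-- The differential of the total complex of the cyclic bicomplex. The vertical differential is `b`
in the even columns and `-b'` in the odd ones; the horizontal differential is `1 - t` from the odd
columns to the even ones and `N` from the even columns (other than column `0`) to the odd ones.
The entry of the target in bidegree `(n - q, q)` receives the vertical differential from
bidegree `(n - q, q + 1)` and the horizontal one from bidegree `(n - q + 1, q)`. -/
noncomputable def totDiff (n : ℕ) : Tot k A (n + 1) →ₗ[k] Tot k A n :=
  LinearMap.pi fun q =>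
    if Even (n - (q : ℕ)) then
      hochDiff k A q ∘ₗ LinearMap.proj (φ := fun j : Fin (n + 2) => Chain k A j) q.succ +
        (LinearMap.id - cycOp k A q) ∘ₗ
          LinearMap.proj (φ := fun j : Fin (n + 2) => Chain k A j) q.castSucc
    else
      -(barDiff k A q ∘ₗ LinearMap.proj (φ := fun j : Fin (n + 2) => Chain k A j) q.succ) +
        normOp k A q ∘ₗ LinearMap.proj (φ := fun j : Fin (n + 2) => Chain k A j) q.castSucc

/-- Cyclic homology `HC_n(A)`: the homology of the total complex of the cyclic bicomplex. -/
abbrev HC (n : ℕ) : Type _ := Homology (totDiff k A) n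

variable (I : Ideal A) [I.IsTwoSided]

/-- The kernel of `A^{⊗ (n+1)} → (A/I)^{⊗ (n+1)}`. -/
noncomputable def relChain (n : ℕ) : Submodule k (Chain k A n) :=
  LinearMap.ker (PiTensorProduct.map fun _ : Fin (n + 1) => (Ideal.Quotient.mkₐ k I).toLinearMap)

/-- The relative Hochschild homology `HH_n(A, I)`: the homology of the kernel of the map from the
Hochschild complex of `A` to that of `A/I`. -/
abbrev RelHH (n : ℕ) : Type _ := SubHomology (hochDiff k A) (relChain k A I) n

/-- The relative cyclic homology `HC_n(A, I)`: the homology of the kernel of the map from the total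
cyclic complex of `A` to that of `A/I`. -/
abbrev RelHC (n : ℕ) : Type _ :=
  SubHomology (totDiff k A) (fun n => Submodule.pi Set.univ fun q : Fin (n + 1) => relChain k A I q)
    n

end Hochschild

/-! ### Quivers, paths, path algebras -/

/-- A quiver with vertex set `V` and arrow set `E`; `s` and `e` give the starting point and the
ending point of an arrow. -/
structure Quiv (V E : Type*) where
  s : E → V
  e : E → V

section Paths

variable {V E : Type*} (Q : Quiv V E)

/-- `l = a₁⋯a_n` is a walk from `u` to `w`: the arrows are consecutive (`e(a_i) = s(a_{i+1})`),
the first one starts at `u` and the last one ends at `w`. The empty walk goes from `u` to `u`. -/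
def IsWalk : V → List E → V → Prop
  | u, [], w => u = w
  | u, a :: l, w => Q.s a = u ∧ IsWalk (Q.e a) l w

theorem IsWalk.append {Q : Quiv V E} {u v w : V} {l m : List E} (h : IsWalk Q u l v)
    (h' : IsWalk Q v m w) : IsWalk Q u (l ++ m) w := by
  induction l generalizing u with
  | nil => cases h; exact h'
  | cons a l ih => exact ⟨h.1, ih h.2⟩

/-- The paths of the quiver, including the trivial path at each vertex. -/
@[ext]
structure QPath where
  src : V
  tgt : V
  arrows : List E
  isWalk : IsWalk Q src arrows tgt

variable {Q}

/-- The trivial path at `v`. -/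
def QPath.triv (v : V) : QPath Q := ⟨v, v, [], rfl⟩

/-- The composite path `pq` (first `p`, then `q`). -/
def QPath.comp (p q : QPath Q) (h : p.tgt = q.src) : QPath Q :=
  ⟨p.src, q.tgt, p.arrows ++ q.arrows, p.isWalk.append (h ▸ q.isWalk)⟩

/-- The length of a path. -/
def QPath.length (p : QPath Q) : ℕ := p.arrows.length

end Paths

section PathAlgebra

/-- The path algebra `kQ`: the `k`-vector space with the paths of `Q` as a basis. -/
def PathAlg (k : Type*) [Field k] {V E : Type*} (Q : Quiv V E) : Type _ := QPath Q →₀ k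

variable (k : Type*) [Field k] {V E : Type*} (Q : Quiv V E)

noncomputable instance : AddCommGroup (PathAlg k Q) := inferInstanceAs (AddCommGroup (QPath Q →₀ k))

noncomputable instance : Module k (PathAlg k Q) := inferInstanceAs (Module k (QPath Q →₀ k))

variable {Q}

/-- The basis element of `kQ` given by a path. -/
noncomputable def ofPath (p : QPath Q) : PathAlg k Q := Finsupp.single p 1

open Classical in
/-- The product of two paths: their composite, or `0` if they do not compose. -/
noncomputable def pathMul (p q : QPath Q) : PathAlg k Q :=
  if h : p.tgt = q.src then ofPath k (p.comp q h) else 0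

/-- The bilinear extension of the product of paths. -/
noncomputable def mulL : PathAlg k Q →ₗ[k] PathAlg k Q →ₗ[k] PathAlg k Q :=
  Finsupp.linearCombination k fun p => Finsupp.linearCombination k fun q => pathMul k p q

noncomputable instance : Mul (PathAlg k Q) := ⟨fun x y => mulL k x y⟩

theorem mul_def (x y : PathAlg k Q) : x * y = mulL k x y := rfl

theorem ofPath_mul_ofPath (p q : QPath Q) : ofPath k p * ofPath k q = pathMul k p q := by
  rw [mul_def]
  simp only [mulL, ofPath]
  erw [Finsupp.linearCombination_single, one_smul, Finsupp.linearCombination_single, one_smul]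

theorem hom_ext {M : Type*} [AddCommGroup M] [Module k M] {f g : PathAlg k Q →ₗ[k] M}
    (h : ∀ p, f (ofPath k p) = g (ofPath k p)) : f = g :=
  Finsupp.lhom_ext' fun p => LinearMap.ext_ring (h p)

theorem pathMul_assoc (p q r : QPath Q) :
    pathMul k p q * ofPath k r = ofPath k p * pathMul k q r := by
  unfold pathMul
  by_cases h : p.tgt = q.src <;> by_cases h' : q.tgt = r.src
  · have h1 : (p.comp q h).tgt = r.src := h'
    have h2 : p.tgt = (q.comp r h').src := h
    rw [dif_pos h, dif_pos h', ofPath_mul_ofPath, ofPath_mul_ofPath, pathMul, pathMul, dif_pos h1,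
      dif_pos h2]
    congr 1
    exact QPath.ext rfl rfl (List.append_assoc _ _ _)
  · have h1 : ¬ (p.comp q h).tgt = r.src := h'
    rw [dif_pos h, dif_neg h', ofPath_mul_ofPath, pathMul, dif_neg h1, mul_def, map_zero]
  · have h2 : ¬ p.tgt = (q.comp r h').src := h
    rw [dif_neg h, dif_pos h', ofPath_mul_ofPath, pathMul, dif_neg h2, mul_def, map_zero,
      LinearMap.zero_apply]
  · rw [dif_neg h, dif_neg h', mul_def, mul_def, map_zero, map_zero, LinearMap.zero_apply]

theorem pa_mul_assoc (x y z : PathAlg k Q) : x * y * z = x * (y * z) := by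
  have h1 : ∀ (p q : QPath Q), mulL k (mulL k (ofPath k p) (ofPath k q)) =
      mulL k (ofPath k p) ∘ₗ mulL k (ofPath k q) := fun p q => hom_ext k fun r => by
    have := pathMul_assoc k p q r
    rw [← ofPath_mul_ofPath, ← ofPath_mul_ofPath] at this
    exact this
  have h2 : ∀ (p : QPath Q), mulL k ∘ₗ mulL k (ofPath k p) =
      (LinearMap.llcomp k _ _ _ (mulL k (ofPath k p))) ∘ₗ mulL k := fun p => hom_ext k fun q => h1 p q
  have h3 : ∀ y z : PathAlg k Q, (mulL k).flip z ∘ₗ (mulL k).flip y =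
      (mulL k).flip (mulL k y z) := fun y z => hom_ext k fun p =>
    LinearMap.congr_fun (LinearMap.congr_fun (h2 p) y) z
  exact LinearMap.congr_fun (h3 y z) x

variable [Fintype V]

noncomputable instance : One (PathAlg k Q) := ⟨∑ v : V, ofPath k (QPath.triv v)⟩

theorem one_def : (1 : PathAlg k Q) = ∑ v : V, ofPath k (QPath.triv v) := rfl

theorem pa_one_mul (x : PathAlg k Q) : 1 * x = x := by
  have : mulL k (1 : PathAlg k Q) = LinearMap.id := hom_ext k fun p => by
    rw [one_def, map_sum, LinearMap.sum_apply, Finset.sum_eq_single p.src]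
    · rw [← mul_def, ofPath_mul_ofPath]; exact dif_pos (show (QPath.triv p.src).tgt = p.src from rfl)
    · intro v _ hv
      rw [← mul_def, ofPath_mul_ofPath]; exact dif_neg hv
    · intro h; exact absurd (Finset.mem_univ _) h
  exact LinearMap.congr_fun this x

theorem pa_mul_one (x : PathAlg k Q) : x * 1 = x := by
  have : (mulL k).flip (1 : PathAlg k Q) = LinearMap.id := hom_ext k fun p => by
    rw [one_def, map_sum, LinearMap.sum_apply, Finset.sum_eq_single p.tgt]
    · rw [LinearMap.flip_apply, ← mul_def, ofPath_mul_ofPath]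
      refine (dif_pos (show p.tgt = (QPath.triv p.tgt).src from rfl)).trans ?_
      exact congrArg (ofPath k) (QPath.ext rfl rfl (List.append_nil _))
    · intro v _ hv
      rw [LinearMap.flip_apply, ← mul_def, ofPath_mul_ofPath]; exact dif_neg (Ne.symm hv)
    · intro h; exact absurd (Finset.mem_univ _) h
  exact LinearMap.congr_fun this x

noncomputable instance : Ring (PathAlg k Q) where
  __ := (inferInstance : AddCommGroup (PathAlg k Q))
  left_distrib x y z := (mulL k x).map_add y z
  right_distrib x y z := LinearMap.map_add₂ (mulL k) x y z
  zero_mul x := LinearMap.map_zero₂ (mulL k) x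
  mul_zero x := (mulL k x).map_zero
  mul_assoc := pa_mul_assoc k
  one_mul := pa_one_mul k
  mul_one := pa_mul_one k

noncomputable instance : Algebra k (PathAlg k Q) :=
  Algebra.ofModule (fun c x y => LinearMap.map_smul₂ (mulL k) c x y)
    (fun c x y => (mulL k x).map_smul c y)

/-- The ideal `k^nQ` of `kQ` generated by all paths of length `≥ n`. -/
noncomputable def pathIdeal (Q : Quiv V E) (n : ℕ) : TwoSidedIdeal (PathAlg k Q) :=
  TwoSidedIdeal.span (ofPath k '' {p : QPath Q | n ≤ p.length})

variable {k}

/-- Admissible ideals: `k^NQ ⊆ I ⊆ k^2Q` for some `N ≥ 2`. -/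
def IsAdmissible (I : TwoSidedIdeal (PathAlg k Q)) : Prop :=
  (∃ N : ℕ, 2 ≤ N ∧ pathIdeal k Q N ≤ I) ∧ I ≤ pathIdeal k Q 2

/-- The ideal `I` is generated by some paths of length `≥ 2`. -/
def IsMonomial (I : TwoSidedIdeal (PathAlg k Q)) : Prop :=
  ∃ S : Set (QPath Q), (∀ p ∈ S, 2 ≤ p.length) ∧ I = TwoSidedIdeal.span (ofPath k '' S)

/-- The algebra `kQ/I`. -/
abbrev QuotAlg (I : TwoSidedIdeal (PathAlg k Q)) : Type _ := I.ringCon.Quotient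

end PathAlgebra

/-! ### Cycles and the cycle algebras overlying a monomial algebra -/

section Cycles

/-- A cycle `a₁⋯a_n`, `n ≥ 1`: `e(a_i) = s(a_{i+1})` for all `i`, the indices taken modulo `n`.
(`finRotate n` is the cyclic permutation `i ↦ i + 1` of `Fin n`.) -/
structure QCycle {V E : Type*} (Q : Quiv V E) where
  len : ℕ
  pos : 0 < len
  arr : Fin len → E
  closed : ∀ i, Q.e (arr i) = Q.s (arr (finRotate len i))

variable {V E : Type*} {Q : Quiv V E}

/-- The sequence of arrows `a₁⋯a_n` of the cycle. -/
def QCycle.word (Y : QCycle Q) : List E := List.ofFn Y.arr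

/-- A cycle is proper if it is not a power `X^m`, `m ≥ 2`, of any cycle `X`. -/
def QCycle.IsProper (Y : QCycle Q) : Prop :=
  ¬ ∃ (X : QCycle Q) (m : ℕ), 2 ≤ m ∧ Y.word = (List.replicate m X.word).flatten

/-- The proper cycles of a quiver. -/
abbrev ProperCycle (Q : Quiv V E) : Type _ := {Y : QCycle Q // Y.IsProper}

/-- Two proper cycles are equivalent if one is a rotation of the other, that is, if they lie in one
orbit of the action of the cyclic group. -/
instance rotSetoid (Q : Quiv V E) : Setoid (ProperCycle Q) :=
  (List.IsRotated.setoid E).comap fun Y => Y.1.word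

/-- The set of orbits of proper cycles. -/
abbrev ProperOrbit (Q : Quiv V E) : Type _ := Quotient (rotSetoid Q)

/-- The basic cycle with `n` vertices `0, …, n-1` and `n` arrows `i : i → i + 1 mod n`. -/
def basicCycle (n : ℕ) : Quiv (Fin n) (Fin n) where
  s i := i
  e i := finRotate n i

theorem IsWalk.map_cycle (Y : QCycle Q) {i j : Fin Y.len} {l : List (Fin Y.len)}
    (h : IsWalk (basicCycle Y.len) i l j) :
    IsWalk Q (Q.s (Y.arr i)) (l.map Y.arr) (Q.s (Y.arr j)) := by
  induction l generalizing i with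
  | nil => cases h; rfl
  | cons a l ih =>
    obtain ⟨h1, h2⟩ := h
    cases h1
    exact ⟨rfl, (Y.closed a).symm ▸ ih h2⟩

/-- The action on paths of the quiver morphism `C → Q` that the cycle `a₁⋯a_n` defines on the basic
cycle `C` with `n` vertices: it sends the `i`-th arrow to `a_i` and the `i`-th vertex to `s(a_i)`. -/
def QCycle.mapPath (Y : QCycle Q) (c : QPath (basicCycle Y.len)) : QPath Q :=
  ⟨Q.s (Y.arr c.src), Q.s (Y.arr c.tgt), c.arrows.map Y.arr, c.isWalk.map_cycle Y⟩

variable {k : Type*} [Field k] [Fintype V]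

/-- The ideal of the path algebra of the basic cycle `C` obtained by pulling back the relations: it
is generated by the paths of `C` whose image in `Q` is a relation, that is, lies in `I`. -/
noncomputable def cycleIdeal (I : TwoSidedIdeal (PathAlg k Q)) (Y : QCycle Q) :
    TwoSidedIdeal (PathAlg k (basicCycle Y.len)) :=
  TwoSidedIdeal.span (ofPath k '' {c | ofPath k (Y.mapPath c) ∈ I})

/-- The cycle algebra overlying `A = kQ/I` that is constructed from the cycle `Y`. -/
abbrev CycleAlg (I : TwoSidedIdeal (PathAlg k Q)) (Y : QCycle Q) : Type _ :=
  QuotAlg (cycleIdeal I Y)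

end Cycles

end MonomialHH

/-! The paths outside $I$ form a basis of $A$ in which a product of two basis elements is a basis
element or zero. Hence $A^{\otimes(n+1)}$ has the $(n+1)$-tuples of nonzero paths as a basis,
rotations permute these tuples, and a face sends a tuple to a tuple or to zero. Any condition on
tuples that rotations and nonzero faces both preserve and reflect therefore splits off a direct
summand of the Hochschild complex and of the cyclic bicomplex at once (`homology_directSum`).

Two such conditions matter: being cyclically composable (`Comp`), and consisting of trivial paths
only (`Triv`). The tuples that are not composable contribute nothing: inserting a trivial path at
the first break contracts the $b$-complex (`hochOp_isAcyclic`), inserting one in front contracts the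
$b'$-complex (`barOp_isAcyclic`), and a bicomplex with acyclic columns has acyclic total complex
(`totOp_isAcyclic`). The composable tuples of trivial paths are the constant ones (`comp_triv_iff`).
They form a constant cyclic object on $Q_0$, which gives $k^{Q_0}$ in degree $0$ of $HH$ and in the
even degrees of $HC$, and zero elsewhere.

There remain the composable tuples that are not all trivial, `pos`. Concatenating such a tuple gives
a nonempty closed walk in $Q$. The walk is a power of a proper cycle, unique up to rotation, so the
tuple lifts to the basic cycle of exactly one representative, and in exactly one way. Relations on a
basic cycle are pulled back from $Q$, so the lift respects faces. Thus `pos` of $A$ is the disjoint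
union of the `pos` of the minimal cycle algebras (`cycleEmb_bijective`).

Each cycle algebra $Z$ is again a path algebra modulo an ideal of the same kind, so the same
analysis applies to it. Where the constant tuples have no homology, `pos` computes the absolute
groups of $Z$. In the other degrees the vertices of $Z$ must be discarded, and the relative groups
do this: $\operatorname{rad} Z$ is spanned by the paths of positive length (`mem_jacobson_quotAlg`),
so the relative chains are spanned by the tuples that are not all trivial (`range_nontrivChain`),
and these have the homology of `pos` (`HH_nontriv`, `HC_nontriv`). -/

namespace MonomialHH

/-! ### Homology of complexes of vector spaces and direct sum decompositions -/

section HomologyMaps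

variable {k : Type*} [Field k] {C : ℕ → Type*} [∀ n, AddCommGroup (C n)] [∀ n, Module k (C n)]
  {C' : ℕ → Type*} [∀ n, AddCommGroup (C' n)] [∀ n, Module k (C' n)]

theorem map_mem_cycles {d : ∀ n, C (n + 1) →ₗ[k] C n} {d' : ∀ n, C' (n + 1) →ₗ[k] C' n}
    (φ : ∀ n, C n →ₗ[k] C' n) (h : ∀ n x, φ n (d n x) = d' n (φ (n + 1) x)) (n : ℕ) (x : C n)
    (hx : x ∈ cycles d n) : φ n x ∈ cycles d' n := by
  cases n with
  | zero => trivial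
  | succ n =>
    have hx' : d n x = 0 := hx
    show d' n (φ (n + 1) x) = 0
    rw [← h, hx', map_zero]

/-- The class in homology of a cycle. -/
def homologyMk (d : ∀ n, C (n + 1) →ₗ[k] C n) (n : ℕ) : cycles d n →ₗ[k] Homology d n :=
  Submodule.mkQ _

theorem homologyMk_surjective (d : ∀ n, C (n + 1) →ₗ[k] C n) (n : ℕ) :
    Function.Surjective (homologyMk d n) := Submodule.mkQ_surjective _

theorem homologyMk_eq_zero {d : ∀ n, C (n + 1) →ₗ[k] C n} {n : ℕ} {x : cycles d n} :
    homologyMk d n x = 0 ↔ ∃ y, d n y = x := by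
  exact Submodule.Quotient.mk_eq_zero _

/-- The map induced in homology by a chain map. -/
def homologyMap {d : ∀ n, C (n + 1) →ₗ[k] C n} {d' : ∀ n, C' (n + 1) →ₗ[k] C' n}
    (φ : ∀ n, C n →ₗ[k] C' n) (h : ∀ n x, φ n (d n x) = d' n (φ (n + 1) x)) (n : ℕ) :
    Homology d n →ₗ[k] Homology d' n :=
  Submodule.mapQ _ _ ((φ n).restrict (map_mem_cycles φ h n)) (by
    rintro ⟨x, hx⟩ ⟨y, rfl⟩
    exact ⟨φ (n + 1) y, (h n y).symm⟩)

theorem homologyMap_mk {d : ∀ n, C (n + 1) →ₗ[k] C n} {d' : ∀ n, C' (n + 1) →ₗ[k] C' n}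
    (φ : ∀ n, C n →ₗ[k] C' n) (h : ∀ n x, φ n (d n x) = d' n (φ (n + 1) x)) (n : ℕ)
    (x : cycles d n) :
    homologyMap φ h n (homologyMk d n x) =
      homologyMk d' n ⟨φ n x, map_mem_cycles φ h n x x.2⟩ := rfl

/-- Homology computed through a surjection from the cycles. -/
noncomputable def homologyEquivOfSurjective {W : Type*} [AddCommGroup W] [Module k W]
    (d : ∀ n, C (n + 1) →ₗ[k] C n) (n : ℕ) (g : cycles d n →ₗ[k] W)
    (hg : Function.Surjective g) (hker : ∀ x, g x = 0 ↔ ∃ y, d n y = x) : Homology d n ≃ₗ[k] W :=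
  (Submodule.quotEquivOfEq _ _ (by
    ext x
    simp [hker, Submodule.submoduleOf, Submodule.mem_comap])).trans (g.quotKerEquivOfSurjective hg)

/-- An injective chain map with image `K` identifies its source with the subcomplex `K`. This form
lets the relative groups be computed on a complex with an explicit basis. -/
theorem subHomology_nonempty_equiv (d : ∀ n, C (n + 1) →ₗ[k] C n) (d' : ∀ n, C' (n + 1) →ₗ[k] C' n)
    (K : ∀ n, Submodule k (C n)) (φ : ∀ n, C' n →ₗ[k] C n)
    (h : ∀ n x, φ n (d' n x) = d n (φ (n + 1) x)) (hinj : ∀ n, Function.Injective (φ n))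
    (hK : ∀ n, LinearMap.range (φ n) = K n) (n : ℕ) :
    Nonempty (SubHomology d K n ≃ₗ[k] Homology d' n) := by
  have hmem : ∀ x ∈ cycles d' n, φ n x ∈ K n ⊓ cycles d n := fun x hx =>
    ⟨hK n ▸ ⟨x, rfl⟩, map_mem_cycles φ h n x hx⟩
  let g : cycles d' n →ₗ[k] SubHomology d K n :=
    (Submodule.mkQ _).comp ((φ n).restrict hmem)
  refine ⟨(homologyEquivOfSurjective d' n g ?_ ?_).symm⟩
  · refine (Submodule.mkQ_surjective _).comp ?_
    rintro ⟨x, hx1, hx2⟩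
    rw [SetLike.mem_coe, ← hK] at hx1
    obtain ⟨y, rfl⟩ := hx1
    refine ⟨⟨y, ?_⟩, rfl⟩
    cases n with
    | zero => trivial
    | succ n =>
      have hx' : d n (φ (n + 1) y) = 0 := hx2
      rw [← h] at hx'
      exact hinj n (hx'.trans (map_zero _).symm)
  · rintro ⟨x, hx⟩
    have : g ⟨x, hx⟩ = 0 ↔ φ n x ∈ (K (n + 1)).map (d n) := by
      exact Submodule.Quotient.mk_eq_zero _
    rw [this, ← hK]
    constructor
    · rintro ⟨_, ⟨y, rfl⟩, hy⟩
      exact ⟨y, hinj n ((h n y).trans hy)⟩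
    · rintro ⟨y, hy⟩
      exact ⟨φ (n + 1) y, ⟨y, rfl⟩, by rw [← h, hy]⟩

theorem homology_nonempty_equiv {d : ∀ n, C (n + 1) →ₗ[k] C n} {d' : ∀ n, C' (n + 1) →ₗ[k] C' n}
    (φ : ∀ n, C n ≃ₗ[k] C' n) (h : ∀ n x, φ n (d n x) = d' n (φ (n + 1) x)) (n : ℕ) :
    Nonempty (Homology d n ≃ₗ[k] Homology d' n) := by
  have h' : ∀ n x, (φ n).symm (d' n x) = d n ((φ (n + 1)).symm x) := fun n x => by
    rw [LinearEquiv.symm_apply_eq, h, LinearEquiv.apply_symm_apply]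
  refine ⟨LinearEquiv.ofLinearMap (homologyMap (fun n => (φ n).toLinearMap) h n)
    (homologyMap (fun n => (φ n).symm.toLinearMap) h' n) ?_ ?_⟩
  all_goals
    refine LinearMap.ext fun x => ?_
    obtain ⟨x, rfl⟩ := homologyMk_surjective _ _ x
    simp [homologyMap_mk]

/-- The complex is exact in every degree, including the lowest one. -/
def IsAcyclic (d : ∀ n, C (n + 1) →ₗ[k] C n) : Prop :=
  ∀ n, ∀ x ∈ cycles d n, ∃ y, d n y = x

theorem IsAcyclic.subsingleton {d : ∀ n, C (n + 1) →ₗ[k] C n} (h : IsAcyclic d) (n : ℕ) :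
    Subsingleton (Homology d n) := by
  refine subsingleton_of_forall_eq 0 fun x => ?_
  obtain ⟨x, rfl⟩ := homologyMk_surjective _ _ x
  exact homologyMk_eq_zero.2 (h n x x.2)

theorem IsAcyclic.of_homotopy {d : ∀ n, C (n + 1) →ₗ[k] C n} (s : ∀ n, C n →ₗ[k] C (n + 1))
    (h0 : ∀ x, d 0 (s 0 x) = x) (h : ∀ n x, d (n + 1) (s (n + 1) x) + s n (d n x) = x) :
    IsAcyclic d := by
  intro n x hx
  cases n with
  | zero => exact ⟨_, h0 x⟩
  | succ n =>
    have hx' : d n x = 0 := hx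
    refine ⟨_, (?_ : d (n + 1) (s (n + 1) x) = x)⟩
    simpa [hx'] using h n x

section DirectSumDecomposition

variable {Λ : Type*} {D : Λ → ℕ → Type*} [∀ l n, AddCommGroup (D l n)] [∀ l n, Module k (D l n)]

/-- The hypotheses say that `C` is the direct sum of the complexes `D l`: the inclusions and
projections are orthogonal, each chain has finitely many nonzero components, and these components
determine it. The projections then invert the map assembled from the inclusions. -/
theorem homology_directSum {d : ∀ n, C (n + 1) →ₗ[k] C n} {e : ∀ l n, D l (n + 1) →ₗ[k] D l n}
    (ι : ∀ l n, D l n →ₗ[k] C n) (π : ∀ l n, C n →ₗ[k] D l n)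
    (hι : ∀ l n x, ι l n (e l n x) = d n (ι l (n + 1) x))
    (hπ : ∀ l n x, π l n (d n x) = e l n (π l (n + 1) x))
    (hself : ∀ l n x, π l n (ι l n x) = x)
    (hne : ∀ l m n x, l ≠ m → π l n (ι m n x) = 0)
    (hfin : ∀ n x, {l | π l n x ≠ 0}.Finite)
    (hinj : ∀ n x, (∀ l, π l n x = 0) → x = 0) (n : ℕ) :
    Nonempty (Homology d n ≃ₗ[k] ⨁ l, Homology (e l) n) := by
  classical
  -- The difference of the two sides is killed by every projection.
  have hsum : ∀ x : C n, x = ∑ l ∈ (hfin n x).toFinset, ι l n (π l n x) := fun x => by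
    rw [← sub_eq_zero]
    refine hinj n _ fun l => ?_
    rw [map_sub, map_sum, sub_eq_zero]
    by_cases hl : π l n x = 0
    · rw [hl, Finset.sum_eq_zero]
      intro m _
      by_cases hm : l = m
      · subst hm; rw [hself, hl]
      · exact hne _ _ _ _ hm
    · rw [Finset.sum_eq_single l, hself]
      · intro m _ hm
        exact hne _ _ _ _ (Ne.symm hm)
      · intro h; exact absurd ((hfin n x).mem_toFinset.2 hl) h
  let G : (⨁ l, Homology (e l) n) →ₗ[k] Homology d n :=
    DirectSum.toModule k Λ _ fun l => homologyMap (ι l) (hι l) n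
  have hG : ∀ (y : ⨁ l, Homology (e l) n) l, homologyMap (π l) (hπ l) n (G y) = y l := fun y l => by
    have : (homologyMap (π l) (hπ l) n).comp G = DirectSum.component k Λ _ l := by
      refine DirectSum.linearMap_ext k fun m => LinearMap.ext fun x => ?_
      obtain ⟨x, rfl⟩ := homologyMk_surjective _ _ x
      simp only [LinearMap.comp_apply, G, DirectSum.toModule_lof, homologyMap_mk]
      by_cases hm : l = m
      · subst hm
        simp only [hself, DirectSum.component.lof_self, Subtype.coe_eta]
      · rw [DirectSum.component.of, dif_neg (Ne.symm hm)]
        refine homologyMk_eq_zero.2 ⟨0, ?_⟩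
        simp [hne _ _ _ _ hm]
    exact LinearMap.congr_fun this y
  refine ⟨(LinearEquiv.ofBijective G ⟨?_, ?_⟩).symm⟩
  · rw [injective_iff_map_eq_zero]
    intro y hy
    refine DFinsupp.ext fun l => ?_
    have := hG y l
    rw [hy, map_zero] at this
    exact this.symm
  · intro x
    obtain ⟨x, rfl⟩ := homologyMk_surjective _ _ x
    refine ⟨∑ l ∈ (hfin n x).toFinset, DirectSum.lof k Λ (fun l => Homology (e l) n) l
      (homologyMap (π l) (hπ l) n (homologyMk d n x)), ?_⟩
    simp only [map_sum, G, DirectSum.toModule_lof, homologyMap_mk]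
    rw [← map_sum]
    congr 1
    ext
    simpa using (hsum x).symm

end DirectSumDecomposition

end HomologyMaps

/-! ### Faces, rotations and the cyclic bicomplex -/

section CyclicOperators

variable {k : Type*} [Field k] {M : ℕ → Type*} [∀ n, AddCommGroup (M n)] [∀ n, Module k (M n)]
  {M' : ℕ → Type*} [∀ n, AddCommGroup (M' n)] [∀ n, Module k (M' n)]
  (F : ∀ n, Fin (n + 1) → M (n + 1) →ₗ[k] M n) (R : ∀ n, M n →ₗ[k] M n)
  (F' : ∀ n, Fin (n + 1) → M' (n + 1) →ₗ[k] M' n) (R' : ∀ n, M' n →ₗ[k] M' n)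

/-- The differential `b'` of a module with faces `F`. -/
def barOp (n : ℕ) : M (n + 1) →ₗ[k] M n := ∑ i : Fin (n + 1), (-1 : k) ^ (i : ℕ) • F n i

/-- The differential `b` of a module with faces `F` and rotations `R`. -/
def hochOp (n : ℕ) : M (n + 1) →ₗ[k] M n :=
  barOp F n + (-1 : k) ^ (n + 1) • (F n 0 ∘ₗ R (n + 1))

/-- The signed rotation. -/
def tOp (n : ℕ) : M n →ₗ[k] M n := (-1 : k) ^ n • R n

/-- The norm of the signed rotation. -/
def nOp (n : ℕ) : M n →ₗ[k] M n := ∑ i ∈ Finset.range (n + 1), tOp R n ^ i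

/-- The vertical differential in column `p`. -/
def colV (p q : ℕ) : M (q + 1) →ₗ[k] M q := if Even p then hochOp F R q else -barOp F q

/-- The horizontal differential from column `p + 1` to column `p`. -/
def colH (p q : ℕ) : M q →ₗ[k] M q := if Even p then LinearMap.id - tOp R q else nOp R q

/-- The differential of the total complex of the cyclic bicomplex. -/
def totOp (n : ℕ) : (∀ q : Fin (n + 1 + 1), M q) →ₗ[k] (∀ q : Fin (n + 1), M q) :=
  LinearMap.pi fun q =>
    colV F R (n - (q : ℕ)) q ∘ₗ LinearMap.proj (φ := fun j : Fin (n + 1 + 1) => M j) q.succ +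
      colH R (n - (q : ℕ)) q ∘ₗ LinearMap.proj (φ := fun j : Fin (n + 1 + 1) => M j) q.castSucc

theorem totOp_apply (n : ℕ) (z : ∀ q : Fin (n + 1 + 1), M q) (q : Fin (n + 1)) :
    totOp F R n z q =
      colV F R (n - (q : ℕ)) q (z q.succ) + colH R (n - (q : ℕ)) q (z q.castSucc) := rfl

theorem totDiff_eq (A : Type*) [Ring A] [Algebra k A] :
    totDiff k A = totOp (M := Chain k A) (face k A) (rot k A) := by
  funext n
  refine LinearMap.ext fun x => funext fun q => ?_
  rw [totOp_apply]
  simp only [totDiff, LinearMap.pi_apply, colV, colH]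
  split_ifs <;> rfl

section Naturality

variable {F R F' R'} (φ : ∀ n, M n →ₗ[k] M' n) (hF : ∀ n i x, φ n (F n i x) = F' n i (φ (n + 1) x))
  (hR : ∀ n x, φ n (R n x) = R' n (φ n x))
include hF

theorem barOp_natural (n : ℕ) (x : M (n + 1)) : φ n (barOp F n x) = barOp F' n (φ (n + 1) x) := by
  simp [barOp, hF]

include hR

theorem hochOp_natural (n : ℕ) (x : M (n + 1)) :
    φ n (hochOp F R n x) = hochOp F' R' n (φ (n + 1) x) := by
  simp [hochOp, hF, hR, barOp_natural φ hF]

omit hF in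
theorem tOp_natural (n : ℕ) (x : M n) : φ n (tOp R n x) = tOp R' n (φ n x) := by
  simp [tOp, hR]

omit hF in
theorem nOp_natural (n : ℕ) (x : M n) : φ n (nOp R n x) = nOp R' n (φ n x) := by
  have : ∀ i x, φ n ((tOp R n ^ i) x) = (tOp R' n ^ i) (φ n x) := fun i => by
    induction i with
    | zero => simp
    | succ i ih => intro x; simp only [pow_succ, Module.End.mul_apply, ih, tOp_natural φ hR]
  simp [nOp, this]

theorem totOp_natural (n : ℕ) (x : ∀ q : Fin (n + 1 + 1), M q) :
    (fun q : Fin (n + 1) => φ q (totOp F R n x q)) =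
      totOp F' R' n (fun q : Fin (n + 1 + 1) => φ q (x q)) := by
  funext q
  rw [totOp_apply, totOp_apply]
  simp only [colV, colH]
  split_ifs
  · simp [hochOp_natural φ hF hR, tOp_natural φ hR]
  · simp [barOp_natural φ hF, nOp_natural φ hR]

end Naturality

section Identities

variable {F R} (hFR : ∀ n (i : Fin n) x, F n i.succ (R (n + 1) x) = R n (F n i.castSucc x))
  (hR : ∀ n x, (R n ^ (n + 1)) x = x)

include hR in
theorem tOp_pow (n : ℕ) : tOp R n ^ (n + 1) = 1 := by
  ext x
  rw [tOp, smul_pow, LinearMap.smul_apply, hR, ← pow_mul, Even.neg_one_pow (Nat.even_mul_succ_self n)]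
  simp

include hR in
theorem tOp_nOp (n : ℕ) : tOp R n * nOp R n = nOp R n := by
  rw [nOp, Finset.mul_sum, Finset.sum_range_succ, Finset.sum_range_succ', ← pow_succ', tOp_pow hR,
    pow_zero]
  simp only [pow_succ']

include hR in
theorem nOp_tOp (n : ℕ) : nOp R n * tOp R n = nOp R n := by
  rw [nOp, Finset.sum_mul, Finset.sum_range_succ, Finset.sum_range_succ', ← pow_succ, tOp_pow hR,
    pow_zero]
  simp only [pow_succ]

include hR in
theorem tOp_pow_nOp (n i : ℕ) : tOp R n ^ i * nOp R n = nOp R n := by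
  induction i with
  | zero => simp
  | succ i ih => rw [pow_succ, mul_assoc, tOp_nOp hR, ih]

include hR in
theorem nOp_tOp_pow (n i : ℕ) : nOp R n * tOp R n ^ i = nOp R n := by
  induction i with
  | zero => simp
  | succ i ih => rw [pow_succ', ← mul_assoc, nOp_tOp hR, ih]

include hFR

theorem face_succ_tOp (n : ℕ) (i : Fin n) (x : M (n + 1)) :
    (-1 : k) ^ (i.succ : ℕ) • F n i.succ (tOp R (n + 1) x) =
      tOp R n ((-1 : k) ^ (i.castSucc : ℕ) • F n i.castSucc x) := by
  simp only [tOp, LinearMap.smul_apply, map_smul, hFR, smul_smul]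
  congr 1
  simp only [Fin.val_succ, Fin.val_castSucc]
  ring

theorem face_tOp_pow (n i : ℕ) (hi : i < n + 1) (x : M (n + 1)) :
    (-1 : k) ^ i • F n ⟨i, hi⟩ ((tOp R (n + 1) ^ i) x) = (tOp R n ^ i) (F n 0 x) := by
  induction i generalizing x with
  | zero => simp
  | succ i ih =>
    have := face_succ_tOp hFR n ⟨i, by omega⟩ ((tOp R (n + 1) ^ i) x)
    rw [pow_succ' (tOp R (n + 1)), pow_succ' (tOp R n), Module.End.mul_apply, Module.End.mul_apply,
      ← ih (by omega)]
    exact this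

include hR

/-- With signs included, the `i`-th face is $t^i F_0 t^{-i}$. Since $t^{n+2}=1$ on the source,
$t^{-i}$ is written with the natural exponent `n + 2 - i`. -/
theorem face_eq (n i : ℕ) (hi : i < n + 1) (x : M (n + 1)) :
    (-1 : k) ^ i • F n ⟨i, hi⟩ x = (tOp R n ^ i) (F n 0 ((tOp R (n + 1) ^ (n + 2 - i)) x)) := by
  rw [← face_tOp_pow hFR n i hi, ← Module.End.mul_apply, ← pow_add,
    show i + (n + 2 - i) = n + 1 + 1 by omega, tOp_pow hR, Module.End.one_apply]

/-- This and `nOp_hochOp` together give $b'N = Nb$: both sides equal $N F_0 N$. -/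
theorem barOp_nOp (n : ℕ) (x : M (n + 1)) :
    barOp F n (nOp R (n + 1) x) = nOp R n (F n 0 (nOp R (n + 1) x)) := by
  set y := nOp R (n + 1) x with hy
  have h : ∀ i : ℕ, (tOp R (n + 1) ^ i) y = y := fun i => by
    rw [hy, ← Module.End.mul_apply, tOp_pow_nOp hR]
  rw [barOp, nOp, LinearMap.sum_apply, LinearMap.sum_apply, Finset.sum_range]
  refine Finset.sum_congr rfl fun i _ => ?_
  rw [← face_tOp_pow hFR n i i.2, h]
  rfl

theorem nOp_hochOp (n : ℕ) (x : M (n + 1)) :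
    nOp R n (hochOp F R n x) = nOp R n (F n 0 (nOp R (n + 1) x)) := by
  have h1 : ∀ i : Fin (n + 1), nOp R n ((-1 : k) ^ (i : ℕ) • F n i x) =
      nOp R n (F n 0 ((tOp R (n + 1) ^ (n + 2 - i)) x)) := fun i => by
    have := face_eq hFR hR n i i.2 x
    rw [Fin.eta] at this
    rw [this, ← Module.End.mul_apply, nOp_tOp_pow hR]
  have h2 : (-1 : k) ^ (n + 1) • F n 0 (R (n + 1) x) = F n 0 (tOp R (n + 1) x) := by
    simp [tOp]
  have h3 : nOp R (n + 1) x =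
      (∑ i ∈ Finset.range (n + 1), (tOp R (n + 1) ^ (n + 2 - i)) x) + tOp R (n + 1) x := by
    rw [← nOp_tOp hR, Module.End.mul_apply, nOp, LinearMap.sum_apply, ← Finset.sum_range_reflect,
      Finset.sum_range_succ]
    congr 1
    · refine Finset.sum_congr rfl fun i hi => ?_
      rw [← Module.End.mul_apply, ← pow_succ]
      congr 2
      have := Finset.mem_range.1 hi
      omega
    · simp
  rw [h3, hochOp, barOp, LinearMap.add_apply, LinearMap.sum_apply, LinearMap.smul_apply,
    LinearMap.comp_apply, h2, map_add, map_add, map_add, map_sum, map_sum, map_sum, Finset.sum_range]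
  congr 1
  exact Finset.sum_congr rfl fun i _ => h1 i

/-- Rotation shifts each face but the last to the next one. The two leftover terms cancel, because
the wrap-around face of $x$ is the face $F_0$ of $tx$, and $t$ applied to the signed last face of
$x$ is $F_0t^2x$. -/
theorem hochOp_one_sub (n : ℕ) (x : M (n + 1)) :
    hochOp F R n (x - tOp R (n + 1) x) = barOp F n x - tOp R n (barOp F n x) := by
  have h2 : ∀ x, (-1 : k) ^ (n + 1) • F n 0 (R (n + 1) x) = F n 0 (tOp R (n + 1) x) := by
    simp [tOp]
  have h3 : tOp R n ((-1 : k) ^ n • F n (Fin.last n) x) =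
      F n 0 (tOp R (n + 1) (tOp R (n + 1) x)) := by
    have := face_eq hFR hR n n (by omega) x
    rw [show (⟨n, by omega⟩ : Fin (n + 1)) = Fin.last n from rfl] at this
    rw [this, ← Module.End.mul_apply, ← pow_succ', tOp_pow hR, show n + 2 - n = 2 by omega, pow_two]
    rfl
  have h4 : barOp F n (tOp R (n + 1) x) = F n 0 (tOp R (n + 1) x) +
      (tOp R n (barOp F n x) - tOp R n ((-1 : k) ^ n • F n (Fin.last n) x)) := by
    rw [barOp, LinearMap.sum_apply, LinearMap.sum_apply, Fin.sum_univ_succ, Fin.sum_univ_castSucc]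
    simp only [LinearMap.smul_apply, face_succ_tOp hFR]
    simp
  rw [map_sub, hochOp, LinearMap.add_apply, LinearMap.add_apply, LinearMap.smul_apply,
    LinearMap.smul_apply, LinearMap.comp_apply, LinearMap.comp_apply, h2, h2, h4, h3]
  abel

omit hFR in
theorem colH_colH (p q : ℕ) (x : M q) : colH R p q (colH R (p + 1) q x) = 0 := by
  have h1 := LinearMap.congr_fun (tOp_nOp hR q) x
  have h2 := LinearMap.congr_fun (nOp_tOp hR q) x
  rw [Module.End.mul_apply] at h1 h2
  simp only [colH, Nat.even_add_one]
  split_ifs with h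
  · simp [h1]
  · simp [h2]

theorem colV_colH (p q : ℕ) (x : M (q + 1)) :
    colV F R p q (colH R p (q + 1) x) = -colH R p q (colV F R (p + 1) q x) := by
  simp only [colV, colH, Nat.even_add_one]
  split_ifs with h
  · simpa [neg_add_eq_sub] using hochOp_one_sub hFR hR q x
  · simp [barOp_nOp hFR hR, nOp_hochOp hFR hR]

/-- Only exactness of the columns is used. A primitive of a total cycle is built row by row from the
bottom, and each row is solved within its own column. -/
theorem totOp_isAcyclic (hb : IsAcyclic (hochOp F R)) (hb' : IsAcyclic (barOp F)) :
    IsAcyclic (C := fun n => ∀ q : Fin (n + 1), M q) (totOp F R) := by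
  intro n z hz
  have hcol : ∀ p, IsAcyclic (colV F R p) := fun p => by
    unfold colV
    split_ifs
    · exact hb
    · intro m x hx
      obtain ⟨y, hy⟩ := hb' m x (by
        cases m with
        | zero => trivial
        | succ m =>
          have hx' : (-barOp F m) x = 0 := hx
          exact neg_eq_zero.1 hx')
      exact ⟨-y, by simp [hy]⟩
  have hz' : ∀ q (h : q + 1 < n + 1), colV F R (n - (q + 1)) q (z ⟨q + 1, h⟩) +
      colH R (n - (q + 1)) q (z ⟨q, by omega⟩) = 0 := by
    intro q h
    cases n with
    | zero => omega
    | succ n =>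
      have h0 : totOp F R n z = 0 := hz
      have := congrFun h0 ⟨q, by omega⟩
      rw [totOp_apply] at this
      rw [show n + 1 - (q + 1) = n - q by omega]
      exact this
  -- The equation in row `q` involves only `w q` and `w (q + 1)`, so it can be solved for `w (q +
  -- 1)`. The entry `w 0` is free and is taken to be zero.
  have key : ∀ m ≤ n + 1, ∃ w : ∀ q, M q, ∀ q (h : q < n + 1), q < m →
      colV F R (n - q) q (w (q + 1)) + colH R (n - q) q (w q) = z ⟨q, h⟩ := by
    intro m
    induction m with
    | zero => exact fun _ => ⟨fun _ => 0, fun q _ h => absurd h (by omega)⟩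
    | succ m ih =>
      intro hm
      obtain ⟨w, hw⟩ := ih (by omega)
      -- The remaining error is a vertical cycle: the squares anticommute, two successive horizontal
      -- maps compose to zero, and `z` is a total cycle.
      have hy : z ⟨m, by omega⟩ - colH R (n - m) m (w m) ∈ cycles (colV F R (n - m)) m := by
        cases m with
        | zero => trivial
        | succ m =>
          show colV F R (n - (m + 1)) m _ = 0
          rw [map_sub, colV_colH hFR hR, sub_neg_eq_add, show n - (m + 1) + 1 = n - m by omega,
            ← hz' m (by omega), ← hw m (by omega) (by omega)]
          have := colH_colH hR (n - (m + 1)) m (w m)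
          rw [show n - (m + 1) + 1 = n - m by omega] at this
          rw [map_add, this, add_zero]
      obtain ⟨x, hx⟩ := hcol (n - m) m _ hy
      refine ⟨Function.update w (m + 1) x, fun q h hq => ?_⟩
      rcases Nat.lt_succ_iff_lt_or_eq.1 hq with hq | rfl
      · rw [Function.update_of_ne (by omega), Function.update_of_ne (by omega)]
        exact hw q h hq
      · rw [Function.update_self, Function.update_of_ne (by omega), hx, sub_add_cancel]
  obtain ⟨w, hw⟩ := key (n + 1) le_rfl
  refine ⟨fun q => w q, funext fun q => ?_⟩
  rw [totOp_apply]
  exact hw q q.2 q.2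

end Identities

end CyclicOperators

/-! ### Homology of the constant cyclic object -/

section Constant

variable {k : Type*} [Field k] {W : Type*} [AddCommGroup W] [Module k W]
  {F : ∀ _ : ℕ, ∀ _ : Fin _, W →ₗ[k] W} {R : ℕ → W →ₗ[k] W}

theorem barOp_const (hF : ∀ n i, F n i = LinearMap.id) (n : ℕ) :
    barOp (M := fun _ => W) F n = if Even n then LinearMap.id else 0 := by
  have := Fin.sum_neg_one_pow k (n + 1)
  simp only [barOp, hF, ← Finset.sum_smul, this, Nat.even_add_one]
  split_ifs <;> simp_all

theorem hochOp_const (hF : ∀ n i, F n i = LinearMap.id) (hR : ∀ n, R n = LinearMap.id) (n : ℕ) :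
    hochOp (M := fun _ => W) F R n = if Even n then 0 else LinearMap.id := by
  rw [hochOp, barOp_const hF, hF, hR]
  split_ifs with h
  · rw [Odd.neg_one_pow h.add_one]; ext; simp
  · rw [Even.neg_one_pow (Nat.even_add_one.2 h)]; ext; simp

theorem hoch_const_zero (hF : ∀ n i, F n i = LinearMap.id) (hR : ∀ n, R n = LinearMap.id) :
    Nonempty (Homology (C := fun _ => W) (hochOp (M := fun _ => W) F R) 0 ≃ₗ[k] W) := by
  refine ⟨homologyEquivOfSurjective _ 0 (Submodule.subtype _) (fun x => ⟨⟨x, trivial⟩, rfl⟩) ?_⟩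
  intro x
  simp [hochOp_const hF hR, eq_comm]

theorem hoch_const_succ (hF : ∀ n i, F n i = LinearMap.id) (hR : ∀ n, R n = LinearMap.id) (n : ℕ) :
    Subsingleton (Homology (C := fun _ => W) (hochOp (M := fun _ => W) F R) (n + 1)) := by
  refine subsingleton_of_forall_eq 0 fun x => ?_
  obtain ⟨⟨x, hx⟩, rfl⟩ := homologyMk_surjective _ _ x
  refine homologyMk_eq_zero.2 ?_
  have hx' : hochOp (M := fun _ => W) F R n x = 0 := hx
  rw [hochOp_const hF hR] at hx' ⊢
  by_cases h : Even n
  · exact ⟨x, by simp [Nat.even_add_one, h]⟩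
  · exact ⟨0, by simpa [h] using hx'.symm⟩

/-- Here the column `n - q` and the row `q` have the same parity. For `q` even both $b$ and $1-t$
vanish; for `q` odd both $b'$ and $N$ are alternating sums with an even number of terms. -/
theorem totOp_const_even (hF : ∀ n i, F n i = LinearMap.id) (hR : ∀ n, R n = LinearMap.id) {n : ℕ}
    (hn : Even n) (z : Fin (n + 1 + 1) → W) : totOp (M := fun _ => W) F R n z = 0 := by
  funext q
  rw [totOp_apply]
  have hpq : Even (n - (q : ℕ)) ↔ Even (q : ℕ) := by
    rw [Nat.even_sub (by omega)]; simp [hn]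
  simp only [colV, colH, hpq]
  split_ifs with h
  · simp [hochOp_const hF hR, h, tOp, hR, h.neg_one_pow]
  · have h' := Nat.not_even_iff_odd.1 h
    have hN : nOp (M := fun _ => W) R q = 0 := by
      have h1 : ∀ i, tOp (M := fun _ => W) R q ^ i = (-1 : k) ^ i • LinearMap.id := fun i => by
        rw [tOp, hR, smul_pow, h'.neg_one_pow]
        congr 1
        exact one_pow i
      have h2 := Fin.sum_neg_one_pow k (q + 1)
      rw [if_pos h'.add_one, ← Finset.sum_range (fun i => (-1 : k) ^ i)] at h2
      simp only [nOp, h1, ← Finset.sum_smul, h2, zero_smul]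
    simp [barOp_const hF, h, hN]

/-- In odd total degree every vertical map is the identity up to the sign $(-1)^p$. The total
differential can therefore be solved recursively along the rows. -/
theorem colV_const (hF : ∀ n i, F n i = LinearMap.id) (hR : ∀ n, R n = LinearMap.id) {p q : ℕ}
    (h : Odd (p + q)) (x : W) : colV (M := fun _ => W) F R p q ((-1 : k) ^ p • x) = x := by
  rw [Nat.odd_add] at h
  simp only [colV]
  split_ifs with hp
  · have hq : ¬ Even q := fun hq => Nat.not_even_iff_odd.2 (h.2 hq) hp
    simp [hochOp_const hF hR, hq, hp.neg_one_pow]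
  · simp [barOp_const hF, h.1 (Nat.not_even_iff_odd.1 hp), (Nat.not_even_iff_odd.1 hp).neg_one_pow]

theorem totOp_const_surjective (hF : ∀ n i, F n i = LinearMap.id) (hR : ∀ n, R n = LinearMap.id)
    {n : ℕ} (hn : Odd n) (x : W) (z : Fin (n + 1) → W) :
    ∃ w, w 0 = x ∧ totOp (M := fun _ => W) F R n w = z := by
  have key : ∀ m ≤ n + 1, ∃ w : ℕ → W, w 0 = x ∧ ∀ q (h : q < n + 1), q < m →
      colV (M := fun _ => W) F R (n - q) q (w (q + 1)) +
        colH (M := fun _ => W) R (n - q) q (w q) = z ⟨q, h⟩ := by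
    intro m
    induction m with
    | zero => exact fun _ => ⟨fun _ => x, rfl, fun q _ h => absurd h (by omega)⟩
    | succ m ih =>
      intro hm
      obtain ⟨w, hw0, hw⟩ := ih (by omega)
      refine ⟨Function.update w (m + 1) ((-1 : k) ^ (n - m) • (z ⟨m, by omega⟩ -
        colH (M := fun _ => W) R (n - m) m (w m))), ?_, fun q h hq => ?_⟩
      · rwa [Function.update_of_ne (by omega)]
      · rcases Nat.lt_succ_iff_lt_or_eq.1 hq with hq | rfl
        · rw [Function.update_of_ne (by omega), Function.update_of_ne (by omega)]
          exact hw q h hq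
        · rw [Function.update_self, Function.update_of_ne (by omega), colV_const hF hR,
            sub_add_cancel]
          rwa [Nat.sub_add_cancel (by omega)]
  obtain ⟨w, hw0, hw⟩ := key (n + 1) le_rfl
  refine ⟨fun q => w q, hw0, funext fun q => ?_⟩
  rw [totOp_apply]
  exact hw q q.2 q.2

theorem totOp_const_eq_zero (hF : ∀ n i, F n i = LinearMap.id) (hR : ∀ n, R n = LinearMap.id)
    {n : ℕ} (hn : Odd n) (w : Fin (n + 1 + 1) → W) (h0 : w 0 = 0)
    (hw : totOp (M := fun _ => W) F R n w = 0) : w = 0 := by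
  have key : ∀ m (h : m < n + 1 + 1), w ⟨m, h⟩ = 0 := by
    intro m
    induction m with
    | zero => exact fun _ => h0
    | succ m ih =>
      intro h
      have h1 := congrFun hw ⟨m, by omega⟩
      have h2 : colV (M := fun _ => W) F R (n - m) m (w ⟨m + 1, h⟩) = 0 := by
        rw [totOp_apply] at h1
        have h3 : w (Fin.castSucc ⟨m, by omega⟩) = 0 := ih (by omega)
        rw [h3, map_zero, add_zero] at h1
        exact h1
      have h3 := colV_const hF hR (p := n - m) (q := m)
        (by rwa [Nat.sub_add_cancel (by omega)]) (w ⟨m + 1, h⟩)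
      rw [map_smul, h2, smul_zero] at h3
      exact h3.symm
  exact funext fun q => key q q.2

theorem tot_const_odd (hF : ∀ n i, F n i = LinearMap.id) (hR : ∀ n, R n = LinearMap.id) {n : ℕ}
    (hn : Odd n) :
    Subsingleton (Homology (C := fun n => Fin (n + 1) → W) (totOp (M := fun _ => W) F R) n) := by
  refine subsingleton_of_forall_eq 0 fun x => ?_
  obtain ⟨⟨x, hx⟩, rfl⟩ := homologyMk_surjective _ _ x
  obtain ⟨w, -, hw⟩ := totOp_const_surjective hF hR hn 0 x
  exact homologyMk_eq_zero.2 ⟨w, hw⟩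

/-- In even degree there are no nonzero boundaries. The row-`0` entry of a cycle can be prescribed
freely and determines the others, by the two preceding lemmas on odd `n` applied one degree below.
-/
theorem tot_const_even (hF : ∀ n i, F n i = LinearMap.id) (hR : ∀ n, R n = LinearMap.id) {n : ℕ}
    (hn : Even n) :
    Nonempty (Homology (C := fun n => Fin (n + 1) → W) (totOp (M := fun _ => W) F R) n ≃ₗ[k] W) := by
  refine ⟨homologyEquivOfSurjective _ n (LinearMap.proj (φ := fun _ : Fin (n + 1) => W) 0 ∘ₗ
    Submodule.subtype _) (fun x => ?_) ?_⟩
  · cases n with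
    | zero => exact ⟨⟨fun _ => x, trivial⟩, rfl⟩
    | succ n =>
      obtain ⟨w, hw0, hw⟩ := totOp_const_surjective (F := F) (R := R) hF hR (n := n)
        (by simpa [Nat.even_add_one] using hn) x 0
      exact ⟨⟨w, hw⟩, hw0⟩
  · rintro ⟨x, hx⟩
    simp only [totOp_const_even hF hR hn, LinearMap.comp_apply, Submodule.subtype_apply,
      LinearMap.proj_apply, exists_const]
    constructor
    · intro h
      cases n with
      | zero =>
        refine (funext fun q => ?_ : x = 0).symm
        rw [Fin.fin_one_eq_zero q]; exact h
      | succ n =>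
        exact (totOp_const_eq_zero hF hR (by simpa [Nat.even_add_one] using hn) x h hx).symm
    · intro h
      rw [← h]; rfl

end Constant

/-! ### Partially defined cyclic sets and their linearizations -/

/-- A sequence of sets with rotations and partially defined faces; its linearization carries the
operators of a cyclic module in which a face of a basis element is a basis element or zero. -/
structure PCyc where
  X : ℕ → Type*
  f : ∀ n, Fin (n + 1) → X (n + 1) → Option (X n)
  r : ∀ n, X n → X n

namespace PCyc

/-- An injective morphism. -/
structure Emb (S T : PCyc) where
  g : ∀ n, S.X n → T.X n
  inj : ∀ n, Function.Injective (g n)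
  f_g : ∀ n i x, T.f n i (g (n + 1) x) = (S.f n i x).map (g n)
  r_g : ∀ n x, T.r n (g n x) = g n (S.r n x)

/-- A family of subsets stable under faces and rotations. -/
structure Stable (T : PCyc) (P : ∀ n, T.X n → Prop) : Prop where
  f : ∀ n i x y, P (n + 1) x → T.f n i x = some y → P n y
  r : ∀ n x, P n x → P n (T.r n x)

/-- The restriction to a stable family of subsets. -/
def sub (T : PCyc) (P : ∀ n, T.X n → Prop) (h : T.Stable P) : PCyc where
  X n := {x : T.X n // P n x}
  f n i x := (T.f n i x.1).pmap Subtype.mk fun y hy => h.f n i x.1 y x.2 hy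
  r n x := ⟨T.r n x.1, h.r n x.1 x.2⟩

/-- The inclusion of a stable family of subsets. -/
def subEmb (T : PCyc) (P : ∀ n, T.X n → Prop) (h : T.Stable P) : Emb (T.sub P h) T where
  g n := Subtype.val
  inj n := Subtype.val_injective
  f_g n i x := by
    simp [sub, Option.map_pmap]
  r_g n x := rfl

/-- A morphism with values in a stable family of subsets. -/
def Emb.codRestrict {S T : PCyc} (g : Emb S T) (P : ∀ n, T.X n → Prop) (h : T.Stable P)
    (hg : ∀ n x, P n (g.g n x)) : Emb S (T.sub P h) where
  g n x := ⟨g.g n x, hg n x⟩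
  inj n x y hxy := g.inj n (congrArg Subtype.val hxy)
  f_g n i x := by
    apply Option.map_injective Subtype.val_injective
    refine ((T.subEmb P h).f_g n i ⟨g.g (n + 1) x, hg _ x⟩).symm.trans ?_
    refine (g.f_g n i x).trans ?_
    cases S.f n i x <;> rfl
  r_g n x := Subtype.ext (g.r_g n x)

section Linearization

variable (k : Type*) [Field k] (S T : PCyc)

/-- The basis vector of a defined element, and zero if undefined. -/
noncomputable def optSingle {α : Type*} (o : Option α) : α →₀ k :=
  o.elim 0 fun x => Finsupp.single x 1

theorem mapDomain_optSingle {α β : Type*} (g : α → β) (o : Option α) :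
    Finsupp.mapDomain g (optSingle k o) = optSingle k (o.map g) := by
  cases o <;> simp [optSingle]

/-- The faces of the linearization. -/
noncomputable def linF (n : ℕ) (i : Fin (n + 1)) : (S.X (n + 1) →₀ k) →ₗ[k] (S.X n →₀ k) :=
  Finsupp.linearCombination k fun x => optSingle k (S.f n i x)

/-- The rotations of the linearization. -/
noncomputable def linR (n : ℕ) : (S.X n →₀ k) →ₗ[k] (S.X n →₀ k) :=
  Finsupp.lmapDomain k k (S.r n)

theorem linF_single (n : ℕ) (i : Fin (n + 1)) (x : S.X (n + 1)) :
    S.linF k n i (Finsupp.single x 1) = optSingle k (S.f n i x) := by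
  simp [linF]

theorem linR_single (n : ℕ) (x : S.X n) :
    S.linR k n (Finsupp.single x 1) = Finsupp.single (S.r n x) 1 := by
  simp [linR]

/-- The Hochschild homology of the linearization. -/
abbrev HH (n : ℕ) : Type _ := Homology (hochOp (S.linF k) (S.linR k)) n

/-- The cyclic homology of the linearization. -/
abbrev HC (n : ℕ) : Type _ :=
  Homology (C := fun n => ∀ q : Fin (n + 1), S.X q →₀ k) (totOp (S.linF k) (S.linR k)) n

/-- The complex of the linearization with the differential `b'` is acyclic. -/
def BarAcyclic : Prop :=
  IsAcyclic (C := fun n => S.X n →₀ k) (barOp (M := fun n => S.X n →₀ k) (S.linF k))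

/-- The Hochschild complex of the linearization is acyclic. -/
def HochAcyclic : Prop :=
  IsAcyclic (C := fun n => S.X n →₀ k) (hochOp (M := fun n => S.X n →₀ k) (S.linF k) (S.linR k))

variable {S T}

/-- The map of linearizations induced by a morphism. -/
noncomputable def Emb.lin (g : Emb S T) (n : ℕ) : (S.X n →₀ k) →ₗ[k] (T.X n →₀ k) :=
  Finsupp.lmapDomain k k (g.g n)

/-- The restriction of a chain to the image of a morphism. -/
noncomputable def Emb.proj (g : Emb S T) (n : ℕ) : (T.X n →₀ k) →ₗ[k] (S.X n →₀ k) :=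
  Finsupp.lcomapDomain (g.g n) (g.inj n)

theorem Emb.lin_injective (g : Emb S T) (n : ℕ) : Function.Injective (g.lin k n) :=
  Finsupp.mapDomain_injective (g.inj n)

theorem Emb.proj_apply (g : Emb S T) (n : ℕ) (z : T.X n →₀ k) (x : S.X n) :
    g.proj k n z x = z (g.g n x) := rfl

theorem Emb.lin_linF (g : Emb S T) (n : ℕ) (i : Fin (n + 1)) (x : S.X (n + 1) →₀ k) :
    g.lin k n (S.linF k n i x) = T.linF k n i (g.lin k (n + 1) x) := by
  have : g.lin k n ∘ₗ S.linF k n i = T.linF k n i ∘ₗ g.lin k (n + 1) := by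
    refine Finsupp.lhom_ext' fun x => LinearMap.ext_ring ?_
    simp only [LinearMap.comp_apply, Finsupp.lsingle_apply, linF_single, lin,
      Finsupp.lmapDomain_apply, Finsupp.mapDomain_single, g.f_g, mapDomain_optSingle]
  exact LinearMap.congr_fun this x

theorem Emb.lin_linR (g : Emb S T) (n : ℕ) (x : S.X n →₀ k) :
    g.lin k n (S.linR k n x) = T.linR k n (g.lin k n x) := by
  have : g.lin k n ∘ₗ S.linR k n = T.linR k n ∘ₗ g.lin k n := by
    refine Finsupp.lhom_ext' fun x => LinearMap.ext_ring ?_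
    simp only [LinearMap.comp_apply, Finsupp.lsingle_apply, linR_single, lin,
      Finsupp.lmapDomain_apply, Finsupp.mapDomain_single, g.r_g]
  exact LinearMap.congr_fun this x

theorem Emb.proj_lin (g : Emb S T) (n : ℕ) (x : S.X n →₀ k) : g.proj k n (g.lin k n x) = x :=
  Finsupp.comapDomain_mapDomain _ (g.inj n) x

section Decomposition

variable {Λ : Type*} {D : Λ → PCyc} (g : ∀ l, Emb (D l) T)
  (hg : ∀ n, Function.Bijective fun p : Σ l, (D l).X n => (g p.1).g n p.2)
include hg

theorem proj_lin_of_ne {l m : Λ} (h : l ≠ m) (n : ℕ) (x : (D m).X n →₀ k) :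
    (g l).proj k n ((g m).lin k n x) = 0 := by
  ext y
  rw [Emb.proj_apply]
  refine Finsupp.mapDomain_of_notMem_range _ _ ?_
  rintro ⟨z, hz⟩
  exact h (congrArg Sigma.fst ((hg n).1 (a₁ := ⟨l, y⟩) (a₂ := ⟨m, z⟩) hz.symm))

theorem chain_induction {n : ℕ} {p : (T.X n →₀ k) → Prop} (h0 : p 0)
    (hadd : ∀ x y, p x → p y → p (x + y)) (h : ∀ l x, p ((g l).lin k n x)) (z : T.X n →₀ k) :
    p z := by
  induction z using Finsupp.induction_linear with
  | zero => exact h0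
  | add x y hx hy => exact hadd x y hx hy
  | single y c =>
    obtain ⟨⟨l, x⟩, rfl⟩ := (hg n).2 y
    simpa [Emb.lin] using h l (Finsupp.single x c)

/-- An `Emb` sends an undefined face to an undefined face, so the span of each image is a
subcomplex. As the images partition the basis of `T`, each projection is also compatible with the
faces; it suffices to test this on chains lying in one image. -/
theorem proj_linF (l : Λ) (n : ℕ) (i : Fin (n + 1)) (z : T.X (n + 1) →₀ k) :
    (g l).proj k n (T.linF k n i z) = (D l).linF k n i ((g l).proj k (n + 1) z) := by
  refine chain_induction k g hg (p := fun z => (g l).proj k n (T.linF k n i z) =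
    (D l).linF k n i ((g l).proj k (n + 1) z)) (by simp)
    (fun x y hx hy => by simp only [map_add, hx, hy]) (fun m x => ?_) z
  rw [← Emb.lin_linF]
  by_cases h : l = m
  · subst h; simp [Emb.proj_lin]
  · simp [proj_lin_of_ne k g hg h]

theorem proj_linR (l : Λ) (n : ℕ) (z : T.X n →₀ k) :
    (g l).proj k n (T.linR k n z) = (D l).linR k n ((g l).proj k n z) := by
  refine chain_induction k g hg (p := fun z => (g l).proj k n (T.linR k n z) =
    (D l).linR k n ((g l).proj k n z)) (by simp)
    (fun x y hx hy => by simp only [map_add, hx, hy]) (fun m x => ?_) z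
  rw [← Emb.lin_linR]
  by_cases h : l = m
  · subst h; simp [Emb.proj_lin]
  · simp [proj_lin_of_ne k g hg h]

theorem proj_finite (n : ℕ) (z : T.X n →₀ k) : {l | (g l).proj k n z ≠ 0}.Finite := by
  refine chain_induction k g hg (p := fun z => {l | (g l).proj k n z ≠ 0}.Finite) (by simp)
    (fun x y hx hy => ?_) (fun m x => ?_) z
  · refine (hx.union hy).subset fun l hl => ?_
    by_contra h
    simp only [Set.mem_union, Set.mem_ofPred_eq, not_or, not_not] at h
    exact hl (by rw [map_add, h.1, h.2, add_zero])
  · refine (Set.finite_singleton m).subset fun l hl => ?_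
    by_contra h
    exact hl (proj_lin_of_ne k g hg h n x)

theorem eq_zero_of_proj (n : ℕ) (z : T.X n →₀ k) (h : ∀ l, (g l).proj k n z = 0) : z = 0 := by
  ext y
  obtain ⟨⟨l, x⟩, rfl⟩ := (hg n).2 y
  exact DFunLike.congr_fun (h l) x

/-- A partition of the basis into sub-objects is a direct sum decomposition of complexes. -/
theorem HH_directSum (n : ℕ) : Nonempty (T.HH k n ≃ₗ[k] ⨁ l, (D l).HH k n) :=
  homology_directSum (fun l => (g l).lin k) (fun l => (g l).proj k)
    (fun l => hochOp_natural _ ((g l).lin_linF k) ((g l).lin_linR k))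
    (fun l => hochOp_natural _ (proj_linF k g hg l) (proj_linR k g hg l))
    (fun l => (g l).proj_lin k) (fun _ _ n x h => proj_lin_of_ne k g hg h n x) (proj_finite k g hg)
    (eq_zero_of_proj k g hg) n

/-- The map of total complexes given by maps of chains. -/
def totMap {M M' : ℕ → Type*} [∀ n, AddCommGroup (M n)] [∀ n, Module k (M n)]
    [∀ n, AddCommGroup (M' n)] [∀ n, Module k (M' n)] (φ : ∀ n, M n →ₗ[k] M' n) (n : ℕ) :
    (∀ q : Fin (n + 1), M q) →ₗ[k] (∀ q : Fin (n + 1), M' q) :=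
  LinearMap.pi fun q => φ q ∘ₗ LinearMap.proj q

theorem HC_directSum (n : ℕ) : Nonempty (T.HC k n ≃ₗ[k] ⨁ l, (D l).HC k n) := by
  have h1 : ∀ l n (x : ∀ q : Fin (n + 1 + 1), (D l).X q →₀ k),
      totMap k ((g l).lin k) n (totOp ((D l).linF k) ((D l).linR k) n x) =
      totOp (T.linF k) (T.linR k) n (totMap k ((g l).lin k) (n + 1) x) := fun l =>
    totOp_natural _ ((g l).lin_linF k) ((g l).lin_linR k)
  have h2 : ∀ l n (x : ∀ q : Fin (n + 1 + 1), T.X q →₀ k),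
      totMap k ((g l).proj k) n (totOp (T.linF k) (T.linR k) n x) =
      totOp ((D l).linF k) ((D l).linR k) n (totMap k ((g l).proj k) (n + 1) x) := fun l =>
    totOp_natural _ (proj_linF k g hg l) (proj_linR k g hg l)
  refine homology_directSum (C := fun n => ∀ q : Fin (n + 1), T.X q →₀ k)
    (D := fun l n => ∀ q : Fin (n + 1), (D l).X q →₀ k)
    (fun l => totMap k ((g l).lin k)) (fun l => totMap k ((g l).proj k)) h1 h2
    (fun l n x => funext fun q => (g l).proj_lin k q (x q))
    (fun _ _ n x h => funext fun q => proj_lin_of_ne k g hg h q (x q)) (fun n x => ?_)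
    (fun n x h => funext fun q => eq_zero_of_proj k g hg q (x q) fun l => congrFun (h l) q) n
  refine (Set.finite_iUnion fun q : Fin (n + 1) => proj_finite k g hg q (x q)).subset fun l hl => ?_
  obtain ⟨q, hq⟩ := Function.ne_iff.1 hl
  exact Set.mem_iUnion.2 ⟨q, hq⟩

end Decomposition

section Binary

universe u

variable {S₁ S₂ : PCyc.{u}} (g₁ : Emb S₁ T) (g₂ : Emb S₂ T)

/-- The index type `Option Unit` makes two complementary sub-objects an instance of the general
decomposition, and direct sums over it are products. -/
theorem bijective_of_binary (hg : ∀ n x, (∃ y, g₁.g n y = x) ↔ ¬ ∃ y, g₂.g n y = x) (n : ℕ) :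
    Function.Bijective fun p : Σ l : Option Unit, (l.elim S₁ fun _ => S₂).X n =>
      (Option.rec (motive := fun l => Emb (l.elim S₁ fun _ => S₂) T) g₁ (fun _ => g₂) p.1).g n
        p.2 := by
  constructor
  · rintro ⟨_ | _, x⟩ ⟨_ | _, y⟩ h
    · exact congrArg (Sigma.mk none) (g₁.inj n h)
    · exact absurd ⟨y, rfl⟩ ((hg n _).1 ⟨x, h⟩)
    · exact absurd ⟨x, rfl⟩ ((hg n _).1 ⟨y, h.symm⟩)
    · exact congrArg (Sigma.mk (some ())) (g₂.inj n h)
  · intro x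
    by_cases h : ∃ y, g₁.g n y = x
    · exact ⟨⟨none, h.choose⟩, h.choose_spec⟩
    · rw [hg, not_not] at h
      exact ⟨⟨some (), h.choose⟩, h.choose_spec⟩

theorem HH_prod (hg : ∀ n x, (∃ y, g₁.g n y = x) ↔ ¬ ∃ y, g₂.g n y = x) (n : ℕ) :
    Nonempty (T.HH k n ≃ₗ[k] S₁.HH k n × S₂.HH k n) := by
  obtain ⟨e⟩ := HH_directSum k _ (bijective_of_binary g₁ g₂ hg) n
  exact ⟨e.trans ((DirectSum.lequivProdDirectSum k).trans
    (LinearEquiv.prodCongr (LinearEquiv.refl k _) (DirectSum.lid k (S₂.HH k n) Unit)))⟩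

theorem HC_prod (hg : ∀ n x, (∃ y, g₁.g n y = x) ↔ ¬ ∃ y, g₂.g n y = x) (n : ℕ) :
    Nonempty (T.HC k n ≃ₗ[k] S₁.HC k n × S₂.HC k n) := by
  obtain ⟨e⟩ := HC_directSum k _ (bijective_of_binary g₁ g₂ hg) n
  exact ⟨e.trans ((DirectSum.lequivProdDirectSum k).trans
    (LinearEquiv.prodCongr (LinearEquiv.refl k _) (DirectSum.lid k (S₂.HC k n) Unit)))⟩

end Binary

end Linearization

/-- The constant object. -/
def const (V : Type*) : PCyc where
  X _ := V
  f _ _ := some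
  r _ := id

theorem const_linF (k : Type*) [Field k] (V : Type*) (n : ℕ) (i : Fin (n + 1)) :
    (const V).linF k n i = (LinearMap.id : (V →₀ k) →ₗ[k] (V →₀ k)) :=
  Finsupp.lhom_ext' fun x => LinearMap.ext_ring ((const V).linF_single k n i x)

theorem const_linR (k : Type*) [Field k] (V : Type*) (n : ℕ) :
    (const V).linR k n = (LinearMap.id : (V →₀ k) →ₗ[k] (V →₀ k)) :=
  Finsupp.lhom_ext' fun x => LinearMap.ext_ring ((const V).linR_single k n x)

end PCyc

namespace PCyc

theorem sub_f_eq_some {T : PCyc} {P : ∀ n, T.X n → Prop} {h : T.Stable P} {n : ℕ} {i : Fin (n + 1)}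
    {x : (T.sub P h).X (n + 1)} {y : (T.sub P h).X n} (hxy : T.f n i x.1 = some y.1) :
    (T.sub P h).f n i x = some y := by
  apply Option.map_injective Subtype.val_injective
  exact ((T.subEmb P h).f_g n i x).symm.trans hxy

theorem sub_f_eq_none {T : PCyc} {P : ∀ n, T.X n → Prop} {h : T.Stable P} {n : ℕ} {i : Fin (n + 1)}
    {x : (T.sub P h).X (n + 1)} (hx : T.f n i x.1 = none) : (T.sub P h).f n i x = none := by
  apply Option.map_injective Subtype.val_injective
  exact ((T.subEmb P h).f_g n i x).symm.trans hx

end PCyc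

/-! ### Tuples of nonzero paths and the conditions stable under faces -/

/-- The nonzero paths of a quiver with monomial relations, with their partially defined product. -/
structure PathSys (V : Type*) where
  B : Type*
  src : B → V
  tgt : B → V
  len : B → ℕ
  mul : B → B → Option B
  e : V → B
  mul_some : ∀ p q c, mul p q = some c →
    tgt p = src q ∧ src c = src p ∧ tgt c = tgt q ∧ len c = len p + len q
  src_e : ∀ v, src (e v) = v
  tgt_e : ∀ v, tgt (e v) = v
  e_mul : ∀ p, mul (e (src p)) p = some p
  mul_e : ∀ p, mul p (e (tgt p)) = some p
  len_eq_zero : ∀ p, len p = 0 ↔ p = e (src p)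

theorem val_finRotate {n : ℕ} (i : Fin (n + 1)) :
    (finRotate (n + 1) i : ℕ) = if (i : ℕ) = n then 0 else (i : ℕ) + 1 := by
  rw [coe_finRotate]
  simp [Fin.ext_iff]

theorem val_finRotate_symm {n : ℕ} (i : Fin (n + 1)) :
    ((finRotate (n + 1)).symm i : ℕ) = if (i : ℕ) = 0 then n else (i : ℕ) - 1 := by
  obtain ⟨j, rfl⟩ := (finRotate (n + 1)).surjective i
  rw [Equiv.symm_apply_apply, val_finRotate]
  have := j.2
  by_cases h : (j : ℕ) = n
  · rw [if_pos h, if_pos rfl, h]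
  · rw [if_neg h, if_neg (by omega), Nat.add_sub_cancel]

namespace PathSys

variable {V : Type*} (D : PathSys V)

/-- The tuple with the entries `i` and `i + 1` replaced by the single entry `c`. -/
def merge {n : ℕ} (i : Fin (n + 1)) (c : D.B) (x : Fin (n + 2) → D.B) : Fin (n + 1) → D.B :=
  Fin.contractNth i.castSucc (fun _ _ => c) x

theorem merge_apply {n : ℕ} (i : Fin (n + 1)) (c : D.B) (x : Fin (n + 2) → D.B) (m : Fin (n + 1)) :
    D.merge i c x m =
      if (m : ℕ) < i then x m.castSucc else if (m : ℕ) = i then c else x m.succ := rfl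

/-- The partially defined product of the entries `i` and `i + 1` of a tuple. -/
def fc {n : ℕ} (i : Fin (n + 1)) (x : Fin (n + 2) → D.B) : Option (Fin (n + 1) → D.B) :=
  (D.mul (x i.castSucc) (x i.succ)).map fun c => D.merge i c x

/-- The rotation of a tuple. -/
def rt {n : ℕ} (x : Fin (n + 1) → D.B) : Fin (n + 1) → D.B :=
  fun j => x ((finRotate (n + 1)).symm j)

/-- The tuples of nonzero paths. -/
abbrev tuples : PCyc where
  X n := Fin (n + 1) → D.B
  f _ := D.fc
  r _ := D.rt

variable {D}

theorem fc_some {n : ℕ} {i : Fin (n + 1)} {x : Fin (n + 2) → D.B} {y : Fin (n + 1) → D.B} :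
    D.fc i x = some y ↔ ∃ c, D.mul (x i.castSucc) (x i.succ) = some c ∧ D.merge i c x = y := by
  simp [fc]

theorem fc_none {n : ℕ} {i : Fin (n + 1)} {x : Fin (n + 2) → D.B} :
    D.fc i x = none ↔ D.mul (x i.castSucc) (x i.succ) = none := by
  simp [fc]

theorem mul_eq_none {p q : D.B} (h : D.tgt p ≠ D.src q) : D.mul p q = none := by
  cases hc : D.mul p q with
  | none => rfl
  | some c => exact absurd (D.mul_some p q c hc).1 h

/-- The entries `i` and `i + 1` (cyclically) of the tuple are not composable. -/
def Brk {n : ℕ} (x : Fin (n + 1) → D.B) (i : Fin (n + 1)) : Prop :=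
  D.tgt (x i) ≠ D.src (x (finRotate (n + 1) i))

/-- A product keeps the source of its left factor, so the source that gets lost is the one at `i +
1`. In `tgt_merge` the target that gets lost is the one at `i`; hence the two different omitted
indices. -/
theorem src_merge {n : ℕ} {i : Fin (n + 1)} {c : D.B} {x : Fin (n + 2) → D.B}
    (hc : D.mul (x i.castSucc) (x i.succ) = some c) (m : Fin (n + 1)) :
    D.src (D.merge i c x m) = D.src (x (i.succ.succAbove m)) := by
  rw [merge_apply]
  split_ifs with h1 h2
  · rw [Fin.succAbove_of_castSucc_lt _ _ (Fin.lt_def.2 (by simp only [Fin.val_castSucc, Fin.val_succ]; omega))]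
  · rw [(D.mul_some _ _ _ hc).2.1, Fin.succAbove_of_castSucc_lt _ _ (Fin.lt_def.2 (by simp only [Fin.val_castSucc, Fin.val_succ]; omega)),
      Fin.ext h2]
  · rw [Fin.succAbove_of_le_castSucc _ _ (Fin.le_def.2 (by simp only [Fin.val_castSucc, Fin.val_succ]; omega))]

theorem tgt_merge {n : ℕ} {i : Fin (n + 1)} {c : D.B} {x : Fin (n + 2) → D.B}
    (hc : D.mul (x i.castSucc) (x i.succ) = some c) (m : Fin (n + 1)) :
    D.tgt (D.merge i c x m) = D.tgt (x (i.castSucc.succAbove m)) := by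
  rw [merge_apply]
  split_ifs with h1 h2
  · rw [Fin.succAbove_of_castSucc_lt _ _ (Fin.lt_def.2 (by simp only [Fin.val_castSucc]; omega))]
  · rw [(D.mul_some _ _ _ hc).2.2.1, Fin.succAbove_of_le_castSucc _ _ (Fin.le_def.2 (by simp only [Fin.val_castSucc]; omega)),
      Fin.ext h2]
  · rw [Fin.succAbove_of_le_castSucc _ _ (Fin.le_def.2 (by simp only [Fin.val_castSucc]; omega))]

theorem val_succAbove {n : ℕ} (p : Fin (n + 1)) (i : Fin n) :
    (p.succAbove i : ℕ) = if (i : ℕ) < p then (i : ℕ) else (i : ℕ) + 1 := by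
  simp only [Fin.succAbove, Fin.lt_def, Fin.val_castSucc]
  split_ifs <;> rfl

theorem finRotate_succAbove {n : ℕ} (i m : Fin (n + 1)) :
    finRotate (n + 2) (i.castSucc.succAbove m) = i.succ.succAbove (finRotate (n + 1) m) := by
  apply Fin.ext
  simp only [val_finRotate, val_succAbove, Fin.val_castSucc, Fin.val_succ]
  have := m.2
  have := i.2
  split_ifs <;> omega

/-- Merging deletes exactly one cyclic gap, the one between the merged entries, and leaves the
others as they were. -/
theorem brk_merge {n : ℕ} {i : Fin (n + 1)} {c : D.B} {x : Fin (n + 2) → D.B}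
    (hc : D.mul (x i.castSucc) (x i.succ) = some c) (m : Fin (n + 1)) :
    Brk (D.merge i c x) m ↔ Brk x (i.castSucc.succAbove m) := by
  rw [Brk, Brk, src_merge hc, tgt_merge hc, finRotate_succAbove]

theorem finRotate_castSucc {n : ℕ} (i : Fin n) : finRotate (n + 1) i.castSucc = i.succ := by
  apply Fin.ext
  have := i.2
  rw [val_finRotate, if_neg (by simp; omega)]
  rfl

theorem not_brk_of_mul {n : ℕ} {i : Fin (n + 1)} {c : D.B} {x : Fin (n + 2) → D.B}
    (hc : D.mul (x i.castSucc) (x i.succ) = some c) : ¬ Brk x i.castSucc := by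
  rw [Brk, finRotate_castSucc, not_not]
  exact (D.mul_some _ _ _ hc).1

theorem brk_rot {n : ℕ} (x : Fin (n + 1) → D.B) (i : Fin (n + 1)) :
    Brk (D.rt x) i ↔ Brk x ((finRotate (n + 1)).symm i) := by
  simp [Brk, rt]

variable (D)

/-- Cyclically composable tuples. -/
def Comp (n : ℕ) (x : Fin (n + 1) → D.B) : Prop := ∀ i, ¬ Brk (D := D) x i

/-- Tuples of trivial paths. -/
def Triv (n : ℕ) (x : Fin (n + 1) → D.B) : Prop := ∀ i, D.len (x i) = 0

variable {D}

/-- The gap that a defined face deletes is composable, so no break is created or lost. -/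
theorem comp_face {n : ℕ} {i : Fin (n + 1)} {x : Fin (n + 2) → D.B} {y : Fin (n + 1) → D.B}
    (h : D.fc i x = some y) : D.Comp n y ↔ D.Comp (n + 1) x := by
  obtain ⟨c, hc, rfl⟩ := fc_some.1 h
  simp only [Comp, brk_merge hc]
  refine ⟨fun h m => ?_, fun h m => h _⟩
  by_cases hm : m = i.castSucc
  · rw [hm]; exact not_brk_of_mul hc
  · obtain ⟨m, rfl⟩ := Fin.exists_succAbove_eq hm
    exact h m

theorem comp_rot {n : ℕ} (x : Fin (n + 1) → D.B) : D.Comp n (D.rt x) ↔ D.Comp n x := by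
  simp only [Comp]
  refine ⟨fun h m => ?_, fun h m => ?_⟩
  · have := h (finRotate (n + 1) m)
    rwa [brk_rot, Equiv.symm_apply_apply] at this
  · rw [brk_rot]; exact h _

/-- Lengths add up, so a product is trivial exactly when both factors are. -/
theorem triv_face {n : ℕ} {i : Fin (n + 1)} {x : Fin (n + 2) → D.B} {y : Fin (n + 1) → D.B}
    (h : D.fc i x = some y) : D.Triv n y ↔ D.Triv (n + 1) x := by
  obtain ⟨c, hc, rfl⟩ := fc_some.1 h
  have hl := (D.mul_some _ _ _ hc).2.2.2
  have hi : D.merge i c x i = c := by simp [merge_apply]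
  have ho : ∀ m, m ≠ i → D.merge i c x m = x (i.castSucc.succAbove m) := fun m hm => by
    have : (m : ℕ) ≠ i := fun h => hm (Fin.ext h)
    rw [merge_apply]
    split_ifs
    · rw [Fin.succAbove_of_castSucc_lt _ _ (Fin.lt_def.2 (by simp only [Fin.val_castSucc]; omega))]
    · rw [Fin.succAbove_of_le_castSucc _ _ (Fin.le_def.2 (by simp only [Fin.val_castSucc]; omega))]
  constructor
  · intro h m
    have h0 := h i
    rw [hi] at h0
    by_cases hm : m = i.castSucc
    · rw [hm]; omega
    · obtain ⟨m, rfl⟩ := Fin.exists_succAbove_eq hm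
      by_cases hm' : m = i
      · subst hm'
        rw [Fin.succAbove_of_le_castSucc _ _ le_rfl]; omega
      · rw [← ho m hm']; exact h m
  · intro h m
    by_cases hm : m = i
    · rw [hm, hi, hl, h, h]
    · rw [ho m hm]; exact h _

theorem triv_rot {n : ℕ} (x : Fin (n + 1) → D.B) : D.Triv n (D.rt x) ↔ D.Triv n x := by
  simp only [Triv]
  refine ⟨fun h m => ?_, fun h m => h _⟩
  have := h (finRotate (n + 1) m)
  simpa [rt] using this

/-- A condition on tuples that faces and rotations preserve and reflect. -/
structure BiStable (P : ∀ n, D.tuples.X n → Prop) : Prop where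
  f : ∀ {n} {i : Fin (n + 1)} {x y}, D.fc i x = some y → (P n y ↔ P (n + 1) x)
  r : ∀ {n} x, P n (D.rt x) ↔ P n x

theorem BiStable.stable {P : ∀ n, D.tuples.X n → Prop} (h : BiStable P) : D.tuples.Stable P :=
  ⟨fun _ _ _ _ hx hxy => (h.f hxy).2 hx, fun _ _ hx => (h.r _).2 hx⟩

theorem BiStable.and {P P' : ∀ n, D.tuples.X n → Prop} (h : BiStable P) (h' : BiStable P') :
    BiStable fun n x => P n x ∧ P' n x :=
  ⟨fun hxy => and_congr (h.f hxy) (h'.f hxy), fun x => and_congr (h.r x) (h'.r x)⟩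

theorem BiStable.not {P : ∀ n, D.tuples.X n → Prop} (h : BiStable P) :
    BiStable fun n x => ¬ P n x :=
  ⟨fun hxy => not_congr (h.f hxy), fun x => not_congr (h.r x)⟩

theorem biStable_comp : BiStable D.Comp := ⟨comp_face, comp_rot⟩

theorem biStable_triv : BiStable D.Triv := ⟨triv_face, triv_rot⟩

section CyclicIdentities

/-- Stated for partial maps: one side is undefined exactly when the other is. Face `0` after a
rotation is excluded, since it is the wrap-around face of the original tuple. -/
theorem f_succ_rot {n : ℕ} (i : Fin n) (x : Fin (n + 2) → D.B) :
    D.fc i.succ (D.rt x) =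
      (D.fc i.castSucc x).map D.rt := by
  have hr : ∀ (j : Fin (n + 2)) (j' : Fin (n + 2)), (j : ℕ) = j' + 1 →
      D.rt x j = x j' := fun j j' h => by
    refine congrArg x (Fin.ext ?_)
    rw [val_finRotate_symm, if_neg (by omega)]; omega
  simp only [fc, Option.map_map]
  have h1 := hr i.succ.castSucc i.castSucc.castSucc rfl
  have h2 := hr i.succ.succ i.castSucc.succ rfl
  rw [h1, h2]
  congr 1
  funext c m
  simp only [Function.comp_apply, rt, merge_apply, val_finRotate_symm, Fin.val_succ,
    Fin.val_castSucc]
  obtain ⟨m, hm⟩ := m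
  have := i.2
  cases m with
  | zero =>
    rw [if_pos (by simp), if_pos rfl, if_neg (by omega), if_neg (by omega)]
    exact congrArg x (Fin.ext (by
        simp only [val_finRotate_symm, Fin.val_succ, Fin.val_castSucc]; simp))
  | succ m =>
    simp only [Nat.add_lt_add_iff_right, Nat.add_right_cancel_iff, Nat.add_eq_zero_iff,
      one_ne_zero, and_false, if_false, Nat.add_sub_cancel]
    split_ifs
    · exact congrArg x (Fin.ext (by
        simp only [val_finRotate_symm, Fin.val_castSucc]; simp))
    · rfl
    · exact congrArg x (Fin.ext (by
        simp only [val_finRotate_symm, Fin.val_succ]; simp))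

theorem rot_iterate (n j : ℕ) (x : Fin (n + 1) → D.B) (m : Fin (n + 1)) :
    D.rt^[j] x m = x (((finRotate (n + 1)).symm)^[j] m) := by
  induction j generalizing m with
  | zero => rfl
  | succ j ih =>
    rw [Function.iterate_succ_apply', Function.iterate_succ_apply]
    exact ih _

theorem rot_iterate_self (n : ℕ) (x : Fin (n + 1) → D.B) : D.rt^[n + 1] x = x := by
  funext m
  rw [rot_iterate]
  congr 1
  -- Inverse rotation is subtraction of `1` in `Fin (n + 1)`, so `n + 1` iterations subtract `0`.
  have : ∀ j, ((finRotate (n + 1)).symm)^[j] m = m - (Fin.ofNat (n + 1) j) := fun j => by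
    induction j with
    | zero => simp
    | succ j ih =>
      rw [Function.iterate_succ_apply', ih, finRotate_symm_apply, sub_sub]
      congr 1
      ext
      simp [Fin.val_add]
  rw [this]
  simp

end CyclicIdentities

end PathSys

/-! ### Contracting homotopies that insert trivial paths -/

namespace PathSys

variable {V : Type*} {D : PathSys V}

section Bar

variable (D)

/-- Insertion of a trivial path in front of a tuple. -/
def pre {n : ℕ} (x : Fin (n + 1) → D.B) : Fin (n + 2) → D.B := Fin.cons (D.e (D.src (x 0))) x

variable {D}

theorem fc_zero_pre {n : ℕ} (x : Fin (n + 1) → D.B) : D.fc 0 (D.pre x) = some x := by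
  refine fc_some.2 ⟨x 0, D.e_mul _, funext fun m => ?_⟩
  rw [merge_apply]
  split_ifs with h1 h2
  · exact absurd h1 (by simp)
  · exact congrArg x (Fin.ext h2.symm)
  · rfl

/-- The inserted vertex is the source of the first entry, and no face of `x` changes that source.
With `fc_zero_pre` this makes `pre` an extra degeneracy for $b'$. -/
theorem fc_succ_pre {n : ℕ} (i : Fin (n + 1)) (x : Fin (n + 2) → D.B) :
    D.fc i.succ (D.pre x) = (D.fc i x).map D.pre := by
  have h1 : D.pre x i.succ.castSucc = x i.castSucc := rfl
  have h2 : D.pre x i.succ.succ = x i.succ := rfl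
  rw [fc, fc, h1, h2, Option.map_map]
  cases hc : D.mul (x i.castSucc) (x i.succ) with
  | none => rfl
  | some c =>
    refine congrArg some (funext fun m => ?_)
    change D.merge i.succ c (D.pre x) m = D.pre (D.merge i c x) m
    rw [merge_apply]
    refine Fin.cases ?_ (fun m => ?_) m
    · rw [if_pos (by simp)]
      change D.e (D.src (x 0)) = D.e (D.src (D.merge i c x 0))
      rw [src_merge hc, Fin.succAbove_of_castSucc_lt _ _ (by simp [Fin.lt_def])]
      rfl
    · change _ = D.merge i c x m
      rw [merge_apply]
      simp only [Fin.val_succ, Nat.add_lt_add_iff_right, Nat.add_right_cancel_iff]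
      split_ifs <;> rfl

/-- The bar complex of a family of tuples stable under faces is acyclic. -/
theorem barOp_isAcyclic (k : Type*) [Field k] {P : ∀ n, D.tuples.X n → Prop} (hP : BiStable P) :
    (D.tuples.sub P hP.stable).BarAcyclic k := by
  let S := D.tuples.sub P hP.stable
  -- The extended tuple stays in the family because the family reflects faces, and face `0` gives
  -- back the tuple.
  let s : ∀ n, S.X n → S.X (n + 1) := fun n x =>
    ⟨D.pre x.1, (hP.f (n := n) (i := 0) (fc_zero_pre x.1)).1 x.2⟩
  have hs0 : ∀ n (x : S.X n), S.f n 0 (s n x) = some x := fun n x =>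
    PCyc.sub_f_eq_some (fc_zero_pre x.1)
  have hs : ∀ n (i : Fin (n + 1)) (x : S.X (n + 1)), S.f (n + 1) i.succ (s (n + 1) x) =
      (S.f n i x).map (s n) := fun n i x => by
    cases hc : D.fc i x.1 with
    | none =>
      rw [PCyc.sub_f_eq_none (x := x) hc]
      exact PCyc.sub_f_eq_none ((fc_succ_pre i x.1).trans (by rw [hc]; rfl))
    | some y =>
      rw [PCyc.sub_f_eq_some (x := x) (y := ⟨y, (hP.f hc).2 x.2⟩) hc]
      exact PCyc.sub_f_eq_some ((fc_succ_pre i x.1).trans (by rw [hc]; rfl))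
  have h0 : ∀ n, S.linF k n 0 ∘ₗ Finsupp.lmapDomain k k (s n) = LinearMap.id := fun n => by
    refine Finsupp.lhom_ext' fun x => LinearMap.ext_ring ?_
    simp [PCyc.linF_single, hs0, PCyc.optSingle]
  have h1 : ∀ n i, S.linF k (n + 1) i.succ ∘ₗ Finsupp.lmapDomain k k (s (n + 1)) =
      Finsupp.lmapDomain k k (s n) ∘ₗ S.linF k n i := fun n i => by
    refine Finsupp.lhom_ext' fun x => LinearMap.ext_ring ?_
    simp [PCyc.linF_single, hs, PCyc.mapDomain_optSingle]
  refine IsAcyclic.of_homotopy (fun n => Finsupp.lmapDomain k k (s n)) (fun x => ?_) fun n x => ?_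
  · simpa [barOp] using LinearMap.congr_fun (h0 0) x
  · have h1' : ∀ i, S.linF k (n + 1) i.succ (Finsupp.lmapDomain k k (s (n + 1)) x) =
      Finsupp.lmapDomain k k (s n) (S.linF k n i x) := fun i => LinearMap.congr_fun (h1 n i) x
    have h0' : S.linF k (n + 1) 0 (Finsupp.lmapDomain k k (s (n + 1)) x) = x :=
      LinearMap.congr_fun (h0 (n + 1)) x
    rw [barOp, barOp, LinearMap.sum_apply, LinearMap.sum_apply, Fin.sum_univ_succ, map_sum]
    simp only [LinearMap.smul_apply, map_smul, Fin.val_zero, pow_zero, one_smul, Fin.val_succ]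
    erw [h0']
    rw [add_assoc, ← Finset.sum_add_distrib, Finset.sum_eq_zero, add_zero]
    intro i _
    erw [h1' i]
    rw [pow_succ, mul_neg_one, neg_smul, neg_add_cancel]

end Bar

section Break

/-- The first break of a tuple. -/
def IsFirst {n : ℕ} (x : Fin (n + 1) → D.B) (i : Fin (n + 1)) : Prop :=
  Brk x i ∧ ∀ m < i, ¬ Brk x m

theorem IsFirst.unique {n : ℕ} {x : Fin (n + 1) → D.B} {i j : Fin (n + 1)} (h : IsFirst x i)
    (h' : IsFirst x j) : i = j := by
  rcases lt_trichotomy i j with hij | hij | hij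
  · exact absurd h.1 (h'.2 i hij)
  · exact hij
  · exact absurd h'.1 (h.2 j hij)

theorem exists_isFirst {n : ℕ} {x : Fin (n + 1) → D.B} (h : ¬ D.Comp n x) : ∃ i, IsFirst x i := by
  have h' : ∃ i, Brk x i := by
    by_contra h0
    exact h fun i hi => h0 ⟨i, hi⟩
  obtain ⟨i, hi, hmin⟩ := WellFounded.has_min (wellFounded_lt (α := Fin (n + 1))) {i | Brk x i} h'
  exact ⟨i, hi, fun m hm h => hmin m h hm⟩

variable (D)

/-- Insertion of a trivial path after the entry `i` of a tuple. -/
def ins {n : ℕ} (i : Fin (n + 1)) (x : Fin (n + 1) → D.B) : Fin (n + 2) → D.B := fun m =>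
  if h : (m : ℕ) ≤ i then x ⟨m, by omega⟩
  else if (m : ℕ) = i + 1 then D.e (D.tgt (x i)) else x ⟨m - 1, by omega⟩

variable {D}

theorem ins_of_le {n : ℕ} {i : Fin (n + 1)} (x : Fin (n + 1) → D.B) {m : Fin (n + 2)}
    (j : Fin (n + 1)) (h : (m : ℕ) ≤ i) (hj : (j : ℕ) = m) : D.ins i x m = x j := by
  rw [ins, dif_pos h]
  exact congrArg x (Fin.ext hj.symm)

theorem ins_of_eq {n : ℕ} {i : Fin (n + 1)} (x : Fin (n + 1) → D.B) {m : Fin (n + 2)}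
    (h : (m : ℕ) = i + 1) : D.ins i x m = D.e (D.tgt (x i)) := by
  rw [ins, dif_neg (by omega), if_pos h]

theorem ins_of_gt {n : ℕ} {i : Fin (n + 1)} (x : Fin (n + 1) → D.B) {m : Fin (n + 2)}
    (j : Fin (n + 1)) (h : (i : ℕ) + 1 < m) (hj : (j : ℕ) + 1 = m) : D.ins i x m = x j := by
  rw [ins, dif_neg (by omega), if_neg (by omega)]
  exact congrArg x (Fin.ext (show (m : ℕ) - 1 = j by omega))

theorem fc_ins_self {n : ℕ} (i : Fin (n + 1)) (x : Fin (n + 1) → D.B) :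
    D.fc i (D.ins i x) = some x := by
  have h1 : D.ins i x i.castSucc = x i := ins_of_le x i (by simp) (by simp)
  have h2 : D.ins i x i.succ = D.e (D.tgt (x i)) := ins_of_eq x (by simp)
  refine fc_some.2 ⟨x i, by rw [h1, h2, D.mul_e], funext fun m => ?_⟩
  rw [merge_apply]
  split_ifs with h h'
  · exact ins_of_le x m (by simp; omega) (by simp)
  · exact congrArg x (Fin.ext h'.symm)
  · exact ins_of_gt x m (by simp; omega) (by simp)

/-- A break cannot be the deleted gap, and the renumbering of the remaining gaps is increasing, so
the first break stays first. -/
theorem isFirst_merge {n : ℕ} {i : Fin (n + 2)} {x : Fin (n + 2) → D.B} (hi : IsFirst x i)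
    {j : Fin (n + 1)} {c : D.B} (hc : D.mul (x j.castSucc) (x j.succ) = some c) :
    ∃ i', j.castSucc.succAbove i' = i ∧ IsFirst (D.merge j c x) i' := by
  have hij : i ≠ j.castSucc := fun h => not_brk_of_mul hc (h ▸ hi.1)
  obtain ⟨i', rfl⟩ := Fin.exists_succAbove_eq hij
  refine ⟨i', rfl, (brk_merge hc i').2 hi.1, fun m hm => ?_⟩
  rw [brk_merge hc]
  exact hi.2 _ (Fin.strictMono_succAbove _ hm)

/-- The faces of the enlarged tuple other than face `i` are indexed by `i.succAbove j`. Each defined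
face of `x` commutes with the insertion; `hi'` excludes `j` at the break itself. -/
theorem fc_ins_some {n : ℕ} {i : Fin (n + 2)} {x : Fin (n + 2) → D.B} {j i' : Fin (n + 1)} {c : D.B}
    (hi' : j.castSucc.succAbove i' = i) (hc : D.mul (x j.castSucc) (x j.succ) = some c) :
    D.fc (i.succAbove j) (D.ins i x) = some (D.ins i' (D.merge j c x)) := by
  have ht : D.tgt (D.merge j c x i') = D.tgt (x i) := by rw [tgt_merge hc, hi']
  have hv := congrArg Fin.val hi'
  have hw := val_succAbove i j
  rw [val_succAbove] at hv
  simp only [Fin.val_castSucc] at hv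
  refine fc_some.2 ⟨c, ?_, ?_⟩
  · rw [← hc]
    by_cases h : (j : ℕ) < i
    · rw [if_pos h] at hw
      rw [ins_of_le x j.castSucc (by simp; omega) (by simp [hw]),
        ins_of_le x j.succ (by simp; omega) (by simp [hw])]
    · rw [if_neg h] at hw
      have : (j : ℕ) ≠ i := by split_ifs at hv <;> omega
      rw [ins_of_gt x j.castSucc (by simp; omega) (by simp [hw]),
        ins_of_gt x j.succ (by simp; omega) (by simp [hw])]
  · funext m
    have := m.2
    have := i.2
    rw [merge_apply, hw, ins, ins, ins, ht]
    simp only [merge_apply, Fin.val_castSucc, Fin.val_succ]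
    split_ifs at hv ⊢ <;> first
      | rfl
      | (exfalso; omega)
      | (refine congrArg x (Fin.ext ?_); simp; done)
      | (refine congrArg x (Fin.ext ?_); simp; omega)

/-- The delicate case is `j` at the break. There the face of the enlarged tuple would multiply the
inserted trivial path by the next entry, and the break makes this product undefined too. -/
theorem fc_ins_none {n : ℕ} {i : Fin (n + 2)} {x : Fin (n + 2) → D.B} (hi : Brk x i)
    {j : Fin (n + 1)} (hc : D.mul (x j.castSucc) (x j.succ) = none) :
    D.fc (i.succAbove j) (D.ins i x) = none := by
  have hw := val_succAbove i j
  rw [fc_none]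
  by_cases h : (j : ℕ) < i
  · rw [if_pos h] at hw
    rw [ins_of_le x j.castSucc (by simp; omega) (by simp [hw]),
      ins_of_le x j.succ (by simp; omega) (by simp [hw]), hc]
  · rw [if_neg h] at hw
    by_cases h' : (j : ℕ) = i
    · rw [ins_of_eq x (by simp [hw, h']), ins_of_gt x j.succ (by simp; omega) (by simp [hw])]
      refine mul_eq_none ?_
      have hij : i = j.castSucc := Fin.ext h'.symm
      rw [D.tgt_e]
      have := hi
      rwa [Brk, hij, finRotate_castSucc, ← hij] at this
    · rw [ins_of_gt x j.castSucc (by simp; omega) (by simp [hw]),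
        ins_of_gt x j.succ (by simp; omega) (by simp [hw]), hc]

theorem rt_zero {n : ℕ} (x : Fin (n + 1) → D.B) : D.rt x 0 = x (Fin.last n) := by
  refine congrArg x (Fin.ext ?_)
  simp only [val_finRotate_symm, Fin.val_zero, if_true, Fin.val_last]

theorem rt_succ {n : ℕ} (x : Fin (n + 2) → D.B) (j : Fin (n + 1)) :
    D.rt x j.succ = x j.castSucc := by
  refine congrArg x (Fin.ext ?_)
  simp only [val_finRotate_symm, Fin.val_succ, Fin.val_castSucc]
  rfl

theorem fc_rt_ins_last {n : ℕ} {x : Fin (n + 1) → D.B} (hi : Brk x (Fin.last n)) :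
    D.fc 0 (D.rt (D.ins (Fin.last n) x)) = none := by
  rw [fc_none, Fin.castSucc_zero, rt_zero, rt_succ, ins_of_eq x (by simp),
    ins_of_le x 0 (by simp) (by simp)]
  refine mul_eq_none ?_
  rw [D.tgt_e]
  have := hi
  rwa [Brk, finRotate_last] at this

theorem fc_rt_last {n : ℕ} {x : Fin (n + 2) → D.B} (hi : Brk x (Fin.last (n + 1))) :
    D.fc 0 (D.rt x) = none := by
  rw [fc_none, Fin.castSucc_zero, rt_zero, rt_succ]
  refine mul_eq_none ?_
  have := hi
  rwa [Brk, finRotate_last] at this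

/-- The wrap-around face removes the last entry and multiplies it into the entry at `0`. A break
before the last position therefore keeps its index. -/
theorem fc_rt_ins {n : ℕ} (i : Fin (n + 1)) (x : Fin (n + 2) → D.B) :
    D.fc 0 (D.rt (D.ins i.castSucc x)) = (D.fc 0 (D.rt x)).map (D.ins i) := by
  have hi := i.2
  have h1 : D.ins i.castSucc x (Fin.last (n + 2)) = x (Fin.last (n + 1)) :=
    ins_of_gt x _ (by simp; omega) (by simp)
  have h2 : D.ins i.castSucc x 0 = x 0 := ins_of_le x 0 (by simp) (by simp)
  rw [fc, fc, Fin.castSucc_zero, rt_zero, rt_succ, Fin.castSucc_zero, h1, Fin.castSucc_zero, h2,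
    rt_zero, rt_succ, Option.map_map, Fin.castSucc_zero]
  cases hc : D.mul (x (Fin.last (n + 1))) (x 0) with
  | none => rfl
  | some c =>
    refine congrArg some (funext fun m => ?_)
    change D.merge 0 c (D.rt (D.ins i.castSucc x)) m = D.ins i (D.merge 0 c (D.rt x)) m
    have ht : D.tgt (D.merge 0 c (D.rt x) i) = D.tgt (x i.castSucc) := by
      rw [tgt_merge (by rw [Fin.castSucc_zero, rt_zero, rt_succ, Fin.castSucc_zero, hc]),
        Fin.castSucc_zero, Fin.succAbove_zero, rt_succ]
    refine Fin.cases ?_ (fun m => ?_) m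
    · rw [ins_of_le _ 0 (by simp) (by simp)]
      rfl
    · have hm : ∀ m : Fin (n + 1), m ≠ 0 → D.merge 0 c (D.rt x) m = x m.castSucc := fun m hm => by
        rw [merge_apply, if_neg (by simp), if_neg (by simpa using hm), rt_succ]
      have hm' : D.merge 0 c (D.rt (D.ins i.castSucc x)) m.succ =
          D.ins i.castSucc x m.succ.castSucc := by
        rw [merge_apply, if_neg (by simp), if_neg (by simp), rt_succ]
      rw [hm']
      have := m.2
      rcases lt_trichotomy ((m : ℕ) + 1) (i + 1) with h | h | h
      · rw [ins_of_le x m.succ (by simp; omega) (by simp),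
          ins_of_le _ (⟨m + 1, by omega⟩ : Fin (n + 1)) (by simp; omega) (by simp),
          hm _ (Fin.ne_of_val_ne (by simp))]
        rfl
      · rw [ins_of_eq x (by simp; omega), ins_of_eq _ (by simp; omega), ht]
      · rw [ins_of_gt x m.castSucc (by simp; omega) (by simp),
          ins_of_gt _ m (by simp; omega) (by simp), hm]
        rintro rfl
        simp at h

section Homotopy

variable (k : Type*) [Field k] {P : ∀ n, D.tuples.X n → Prop} (hP : BiStable P)
  (hPc : ∀ n x, P n x → ¬ D.Comp n x)

/-- Insertion of a trivial path, in a family of tuples. -/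
def insSub {n : ℕ} (i : Fin (n + 1)) (x : (D.tuples.sub P hP.stable).X n) :
    (D.tuples.sub P hP.stable).X (n + 1) :=
  ⟨D.ins i x.1, (hP.f (fc_ins_self i x.1)).1 x.2⟩

/-- The homotopy that inserts a trivial path at the first break. -/
noncomputable def insLin (n : ℕ) :
    ((D.tuples.sub P hP.stable).X n →₀ k) →ₗ[k] ((D.tuples.sub P hP.stable).X (n + 1) →₀ k) :=
  Finsupp.linearCombination k fun x =>
    (-1 : k) ^ ((exists_isFirst (hPc n x.1 x.2)).choose : ℕ) •
      Finsupp.single (insSub hP (exists_isFirst (hPc n x.1 x.2)).choose x) 1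

theorem insLin_single {n : ℕ} (x : (D.tuples.sub P hP.stable).X n) {i : Fin (n + 1)}
    (hi : IsFirst x.1 i) : insLin k hP hPc n (Finsupp.single x 1) =
      (-1 : k) ^ (i : ℕ) • Finsupp.single (insSub hP i x) 1 := by
  rw [insLin, Finsupp.linearCombination_single, one_smul,
    (exists_isFirst (hPc n x.1 x.2)).choose_spec.unique hi]

theorem linF_insSub_self {n : ℕ} (x : (D.tuples.sub P hP.stable).X n) (i : Fin (n + 1)) :
    (D.tuples.sub P hP.stable).linF k n i (Finsupp.single (insSub hP i x) 1) =
      Finsupp.single x 1 := by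
  rw [PCyc.linF_single, PCyc.sub_f_eq_some (x := insSub hP i x) (y := x) (fc_ins_self i x.1)]
  rfl

/-- Every face but the `i`-th cancels in $bh+hb$: insertion and face commute, and the signs are
opposite. -/
theorem linF_insSub {n : ℕ} (x : (D.tuples.sub P hP.stable).X (n + 1)) {i : Fin (n + 2)}
    (hi : IsFirst x.1 i) (j : Fin (n + 1)) :
    (-1 : k) ^ (i : ℕ) • (-1 : k) ^ (i.succAbove j : ℕ) •
        (D.tuples.sub P hP.stable).linF k (n + 1) (i.succAbove j)
          (Finsupp.single (insSub hP i x) 1) +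
      (-1 : k) ^ (j : ℕ) • insLin k hP hPc n
        ((D.tuples.sub P hP.stable).linF k n j (Finsupp.single x 1)) = 0 := by
  rw [PCyc.linF_single, PCyc.linF_single]
  cases hc : D.mul (x.1 j.castSucc) (x.1 j.succ) with
  | none =>
    rw [PCyc.sub_f_eq_none (x := x) (fc_none.2 hc), PCyc.sub_f_eq_none (x := insSub hP i x)
      (fc_ins_none hi.1 hc)]
    simp [PCyc.optSingle]
  | some c =>
    obtain ⟨i', hi', hf⟩ := isFirst_merge hi hc
    have hxy : D.fc j x.1 = some (D.merge j c x.1) := fc_some.2 ⟨c, hc, rfl⟩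
    have hins := fc_ins_some hi' hc
    obtain ⟨y, hy⟩ : ∃ y : (D.tuples.sub P hP.stable).X n, y.1 = D.merge j c x.1 :=
      ⟨⟨_, (hP.f hxy).2 x.2⟩, rfl⟩
    rw [← hy] at hf hxy hins
    rw [PCyc.sub_f_eq_some (x := x) (y := y) hxy,
      PCyc.sub_f_eq_some (x := insSub hP i x) (y := insSub hP i' y) hins]
    simp only [PCyc.optSingle, Option.elim]
    rw [insLin_single k hP hPc y hf, smul_smul, smul_smul, ← add_smul, ← pow_add, ← pow_add]
    have hv := congrArg Fin.val hi'
    rw [val_succAbove, Fin.val_castSucc] at hv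
    -- A face before the break lowers the index of the break by one; a face after it has its own
    -- index raised by one through the insertion. Either way the parity changes once.
    have : (i : ℕ) + (i.succAbove j : ℕ) = j + i' + 1 := by
      rw [val_succAbove]
      split_ifs at hv ⊢ <;> omega
    rw [this, pow_succ, mul_neg_one, neg_add_cancel, zero_smul]

/-- If the break is at the last position, both wrap-around faces vanish. Otherwise the break keeps
its index, and the signs differ because the insertion raises the degree by one. -/
theorem linF_linR_insSub {n : ℕ} (x : (D.tuples.sub P hP.stable).X (n + 1)) {i : Fin (n + 2)}
    (hi : IsFirst x.1 i) :
    (-1 : k) ^ (i : ℕ) • (-1 : k) ^ (n + 2) •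
        (D.tuples.sub P hP.stable).linF k (n + 1) 0 ((D.tuples.sub P hP.stable).linR k (n + 2)
          (Finsupp.single (insSub hP i x) 1)) +
      (-1 : k) ^ (n + 1) • insLin k hP hPc n ((D.tuples.sub P hP.stable).linF k n 0
        ((D.tuples.sub P hP.stable).linR k (n + 1) (Finsupp.single x 1))) = 0 := by
  rw [PCyc.linR_single, PCyc.linR_single, PCyc.linF_single, PCyc.linF_single]
  refine Fin.lastCases (fun hi => ?_) (fun i hi => ?_) i hi
  · rw [PCyc.sub_f_eq_none (x := (D.tuples.sub P hP.stable).r _ x) (fc_rt_last hi.1),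
      PCyc.sub_f_eq_none (x := (D.tuples.sub P hP.stable).r _ (insSub hP _ x))
        (fc_rt_ins_last hi.1)]
    simp [PCyc.optSingle]
  · have h := fc_rt_ins i x.1
    cases hc : D.fc 0 (D.rt x.1) with
    | none =>
      rw [hc] at h
      rw [PCyc.sub_f_eq_none (x := (D.tuples.sub P hP.stable).r _ x) hc,
        PCyc.sub_f_eq_none (x := (D.tuples.sub P hP.stable).r _ (insSub hP _ x)) h]
      simp [PCyc.optSingle]
    | some y =>
      rw [hc] at h
      have hbrk : ∀ m, Brk y m ↔ Brk x.1 m.castSucc := fun m => by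
        obtain ⟨c, hc', rfl⟩ := fc_some.1 hc
        refine (brk_merge hc' m).trans ((brk_rot x.1 _).trans ?_)
        rw [Fin.castSucc_zero, Fin.succAbove_zero,
          (Equiv.symm_apply_eq _).2 (finRotate_castSucc m).symm]
      have hf : IsFirst y i := ⟨(hbrk i).2 hi.1, fun m hm h => hi.2 _ hm ((hbrk m).1 h)⟩
      obtain ⟨y, rfl⟩ : ∃ y' : (D.tuples.sub P hP.stable).X n, y'.1 = y :=
        ⟨⟨y, (hP.f hc).2 ((hP.r _).2 x.2)⟩, rfl⟩
      rw [PCyc.sub_f_eq_some (x := (D.tuples.sub P hP.stable).r _ x) (y := y) hc,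
        PCyc.sub_f_eq_some (x := (D.tuples.sub P hP.stable).r _ (insSub hP _ x))
          (y := insSub hP i y) h]
      simp only [PCyc.optSingle, Option.elim]
      rw [insLin_single k hP hPc y hf, smul_smul, smul_smul, ← add_smul, Fin.val_castSucc, pow_succ]
      simp [mul_comm]

include hPc in
-- Insertion at the first break, with sign $(-1)^i$, satisfies $bh+hb=1$: face `i` of the enlarged
-- tuple returns the tuple, and all other terms cancel in pairs or vanish.
theorem hochOp_isAcyclic : (D.tuples.sub P hP.stable).HochAcyclic k := by
  refine IsAcyclic.of_homotopy (insLin k hP hPc) (fun z => ?_) fun n z => ?_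
  · induction z using Finsupp.induction_linear with
    | zero => simp
    | add a b ha hb => rw [map_add, map_add, ha, hb]
    | single x c =>
      -- In degree `0` the tuple is one path that is not closed. Appending its end vertex gives a
      -- pair whose face `0` is the path and whose wrap-around face is undefined.
      obtain ⟨i, hi⟩ := exists_isFirst (hPc 0 x.1 x.2)
      have hi0 := Fin.fin_one_eq_zero i
      subst hi0
      rw [← mul_one c, ← smul_eq_mul, ← Finsupp.smul_single, map_smul, map_smul,
        insLin_single k hP hPc x hi, hochOp, barOp]
      simp only [LinearMap.add_apply, LinearMap.smul_apply, LinearMap.comp_apply, map_smul,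
        LinearMap.sum_apply]
      rw [PCyc.linR_single, PCyc.linF_single,
        PCyc.sub_f_eq_none (i := 0) (x := (D.tuples.sub P hP.stable).r (0 + 1) (insSub hP 0 x))
          (fc_rt_ins_last (n := 0) hi.1)]
      have h := linF_insSub_self k hP x 0
      simp [PCyc.optSingle, h]
  · induction z using Finsupp.induction_linear with
    | zero => simp
    | add a b ha hb =>
      simp only [map_add] at ha hb ⊢
      rw [add_add_add_comm, ha, hb]
    | single x c =>
      obtain ⟨i, hi⟩ := exists_isFirst (hPc _ x.1 x.2)
      rw [← mul_one c, ← smul_eq_mul, ← Finsupp.smul_single]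
      simp only [map_smul]
      rw [← smul_add]
      congr 1
      rw [insLin_single k hP hPc x hi, hochOp, hochOp, barOp, barOp]
      simp only [LinearMap.add_apply, LinearMap.smul_apply, LinearMap.comp_apply, map_smul,
        LinearMap.sum_apply, map_add, map_sum]
      -- Face `i` is separated from the sum; its sign is $(-1)^{i+i}=1$.
      rw [Fin.sum_univ_succAbove _ i, linF_insSub_self, smul_add, smul_add, smul_smul, ← pow_add,
        Even.neg_one_pow ⟨_, rfl⟩, one_smul, Finset.smul_sum]
      have h1 := Finset.sum_eq_zero (s := Finset.univ) fun j _ => linF_insSub k hP hPc x hi j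
      have h2 := linF_linR_insSub k hP hPc x hi
      rw [Finset.sum_add_distrib] at h1
      have key : ∀ a A B C E : (D.tuples.sub P hP.stable).X (n + 1) →₀ k,
          A + C = 0 → B + E = 0 → a + A + B + (C + E) = a := fun a A B C E h1 h2 => by
        rw [add_add_add_comm, h2, add_zero, add_assoc, h1, add_zero]
      exact key _ _ _ _ _ h1 h2

end Homotopy

end Break

end PathSys

/-! ### Splitting the homology of all tuples -/

theorem nonempty_equiv_of_prod {k M N P : Type*} [Field k] [AddCommGroup M] [Module k M]
    [AddCommGroup N] [Module k N] [AddCommGroup P] [Module k P] [Subsingleton N]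
    (e : M ≃ₗ[k] N × P) : Nonempty (M ≃ₗ[k] P) :=
  haveI := uniqueOfSubsingleton (0 : N)
  ⟨e.trans LinearEquiv.uniqueProd⟩

namespace PCyc

/-- The relations between faces and rotations in a cyclic object. -/
structure Cyclic (T : PCyc) : Prop where
  f_r : ∀ n (i : Fin n) (x : T.X (n + 1)),
    T.f n i.succ (T.r (n + 1) x) = (T.f n i.castSucc x).map (T.r n)
  r_pow : ∀ n (x : T.X n), (T.r n)^[n + 1] x = x

theorem Cyclic.of_emb {S T : PCyc} (h : T.Cyclic) (g : Emb S T) : S.Cyclic where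
  f_r n i x := by
    apply Option.map_injective (g.inj n)
    rw [← g.f_g, ← g.r_g, h.f_r, g.f_g, Option.map_map, Option.map_map]
    congr 1
    funext y
    exact g.r_g n y
  r_pow n x := by
    have : ∀ j x, (T.r n)^[j] (g.g n x) = g.g n ((S.r n)^[j] x) := fun j => by
      induction j with
      | zero => exact fun _ => rfl
      | succ j ih =>
        intro x
        rw [Function.iterate_succ_apply, g.r_g, ih, ← Function.iterate_succ_apply (S.r n)]
    exact g.inj n (by rw [← this, h.r_pow])

/-- The columns of the bicomplex are the $b$-complex and the $b'$-complex up to sign, so their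
acyclicity suffices once the cyclic identities hold. -/
theorem Cyclic.subsingleton_HC {T : PCyc} (h : T.Cyclic) (k : Type*) [Field k]
    (hb : T.HochAcyclic k) (hb' : T.BarAcyclic k) (n : ℕ) : Subsingleton (T.HC k n) := by
  refine (totOp_isAcyclic (M := fun n => T.X n →₀ k) ?_ ?_ hb hb').subsingleton n
  · intro n i x
    have : T.linF k n i.succ ∘ₗ T.linR k (n + 1) = T.linR k n ∘ₗ T.linF k n i.castSucc := by
      refine Finsupp.lhom_ext' fun x => LinearMap.ext_ring ?_
      simp only [LinearMap.comp_apply, Finsupp.lsingle_apply, linR_single, linF_single, h.f_r]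
      exact (mapDomain_optSingle k _ _).symm
    exact LinearMap.congr_fun this x
  · intro n x
    have h1 : ∀ j, T.linR k n ^ j = Finsupp.lmapDomain k k (T.r n)^[j] := fun j => by
      induction j with
      | zero => exact (Finsupp.lmapDomain_id k k).symm
      | succ j ih =>
        rw [pow_succ, ih, Function.iterate_succ]
        exact (Finsupp.lmapDomain_comp k k _ _).symm
    rw [h1, show (T.r n)^[n + 1] = id from funext (h.r_pow n), Finsupp.lmapDomain_id]
    rfl

end PCyc

namespace PathSys

variable {V : Type*} (D : PathSys V)

theorem cyclic_tuples : D.tuples.Cyclic := ⟨fun _ => f_succ_rot, rot_iterate_self⟩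

theorem biStable_pos : BiStable fun n x => D.Comp n x ∧ ¬ D.Triv n x :=
  biStable_comp.and biStable_triv.not

/-- The cyclically composable tuples of nonzero paths which are not all trivial. -/
def pos : PCyc := D.tuples.sub _ D.biStable_pos.stable

/-- The tuples of nonzero paths which are not all trivial. -/
def nontriv : PCyc := D.tuples.sub _ (biStable_triv (D := D)).not.stable

/-- The trivial paths. -/
abbrev Vert : Type _ := {p : D.B // D.len p = 0}

/-- The trivial paths are in bijection with the vertices. -/
def vertEquiv : D.Vert ≃ V where
  toFun p := D.src p.1
  invFun v := ⟨D.e v, (D.len_eq_zero _).2 (by rw [D.src_e])⟩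
  left_inv p := Subtype.ext ((D.len_eq_zero _).1 p.2).symm
  right_inv v := D.src_e v

theorem mul_vert (p : D.Vert) : D.mul p.1 p.1 = some p.1 := by
  have h := D.e_mul p.1
  rwa [← (D.len_eq_zero p.1).1 p.2] at h

/-- The constant tuples of trivial paths. -/
def vertEmb : PCyc.Emb (PCyc.const D.Vert) D.tuples where
  g _ p _ := p.1
  inj _ _ _ h := Subtype.ext (congrFun h 0)
  f_g n i p := by
    refine (fc_some (D := D) (x := fun _ => p.1)).2 ⟨p.1, D.mul_vert p, funext fun m => ?_⟩
    rw [merge_apply]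
    split_ifs <;> rfl
  r_g _ _ := rfl

variable {D}

/-- A trivial path starts and ends at its vertex, so composability forces neighbouring entries to be
equal. -/
theorem comp_triv_iff {n : ℕ} (x : Fin (n + 1) → D.B) :
    (D.Comp n x ∧ D.Triv n x) ↔ ∃ p, D.vertEmb.g n p = x := by
  constructor
  · rintro ⟨hc, ht⟩
    refine ⟨⟨x 0, ht 0⟩, funext fun i => ?_⟩
    change x 0 = x i
    have hx : ∀ i, x i = D.e (D.src (x i)) := fun i => (D.len_eq_zero _).1 (ht i)
    have hst : ∀ i, D.tgt (x i) = D.src (x i) := fun i => by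
      have := D.tgt_e (D.src (x i))
      rwa [← hx i] at this
    -- The equality is propagated along the gaps from `m` to `m + 1`; the wrap-around gap is not
    -- needed.
    have key : ∀ m (h : m < n + 1), x ⟨m, h⟩ = x 0 := fun m => by
      induction m with
      | zero => exact fun _ => rfl
      | succ m ih =>
        intro h
        have h1 := not_not.1 (hc ⟨m, by omega⟩)
        have h2 : finRotate (n + 1) ⟨m, by omega⟩ = ⟨m + 1, h⟩ := by
          apply Fin.ext
          rw [val_finRotate, if_neg (by simp; omega)]
        rw [hst, h2, ih] at h1
        rw [hx, ← h1, ← hx]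
    exact (key i i.2).symm
  · rintro ⟨p, rfl⟩
    refine ⟨fun i => ?_, fun i => p.2⟩
    change ¬ (D.tgt p.1 ≠ D.src p.1)
    rw [not_not]
    have := D.tgt_e (D.src p.1)
    rwa [← (D.len_eq_zero p.1).1 p.2] at this

section Homology

variable (D) (k : Type*) [Field k]

/-- The inclusion of families of tuples. -/
def inclEmb {P P' : ∀ n, D.tuples.X n → Prop} (hP : BiStable P) (hP' : BiStable P')
    (h : ∀ n x, P n x → P' n x) :
    PCyc.Emb (D.tuples.sub P hP.stable) (D.tuples.sub P' hP'.stable) :=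
  (D.tuples.subEmb P hP.stable).codRestrict P' hP'.stable fun n x => h n x.1 x.2

theorem exists_inclEmb {P P' : ∀ n, D.tuples.X n → Prop} (hP : BiStable P) (hP' : BiStable P')
    (h : ∀ n x, P n x → P' n x) (n : ℕ) (x : (D.tuples.sub P' hP'.stable).X n) :
    (∃ y, (D.inclEmb hP hP' h).g n y = x) ↔ P n x.1 :=
  ⟨fun ⟨y, hy⟩ => hy ▸ y.2, fun hx => ⟨⟨x.1, hx⟩, rfl⟩⟩

theorem subsingleton_HH_of_not_comp {P : ∀ n, D.tuples.X n → Prop} (hP : BiStable P)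
    (hPc : ∀ n x, P n x → ¬ D.Comp n x) (n : ℕ) :
    Subsingleton ((D.tuples.sub P hP.stable).HH k n) :=
  (hochOp_isAcyclic k hP hPc).subsingleton n

theorem subsingleton_HC_of_not_comp {P : ∀ n, D.tuples.X n → Prop} (hP : BiStable P)
    (hPc : ∀ n x, P n x → ¬ D.Comp n x) (n : ℕ) :
    Subsingleton ((D.tuples.sub P hP.stable).HC k n) :=
  (D.cyclic_tuples.of_emb (D.tuples.subEmb P hP.stable)).subsingleton_HC k
    (hochOp_isAcyclic k hP hPc) (barOp_isAcyclic k hP) n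

/-- The constant tuples among the cyclically composable ones. -/
def vertCompEmb : PCyc.Emb (PCyc.const D.Vert) (D.tuples.sub _ (biStable_comp (D := D)).stable) :=
  D.vertEmb.codRestrict _ _ fun _ p => ((comp_triv_iff _).2 ⟨p, rfl⟩).1

theorem vertComp_compl (n : ℕ) (x : (D.tuples.sub _ (biStable_comp (D := D)).stable).X n) :
    (∃ y, D.vertCompEmb.g n y = x) ↔
      ¬ ∃ y, (D.inclEmb D.biStable_pos biStable_comp fun _ _ h => h.1).g n y = x := by
  have hx : D.Comp n x.1 := x.2
  have h2 := D.exists_inclEmb D.biStable_pos biStable_comp (fun _ _ h => h.1) n x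
  refine Iff.trans ?_ (not_congr h2).symm
  rw [not_and, not_not]
  constructor
  · rintro ⟨p, rfl⟩ -
    exact ((comp_triv_iff _).2 ⟨p, rfl⟩).2
  · intro h
    obtain ⟨p, hp⟩ := (comp_triv_iff x.1).1 ⟨hx, h hx⟩
    exact ⟨p, Subtype.ext hp⟩

theorem comp_compl (n : ℕ) (x : D.tuples.X n) :
    (∃ y, (D.tuples.subEmb _ (biStable_comp (D := D)).not.stable).g n y = x) ↔
      ¬ ∃ y, (D.tuples.subEmb _ (biStable_comp (D := D)).stable).g n y = x := by
  constructor
  · rintro ⟨y, rfl⟩ ⟨z, hz⟩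
    exact y.2 ((show z.1 = y.1 from hz) ▸ z.2)
  · intro h
    exact ⟨⟨x, fun hx => h ⟨⟨x, hx⟩, rfl⟩⟩, rfl⟩

theorem nontriv_compl (n : ℕ) (x : D.nontriv.X n) :
    (∃ y, (D.inclEmb (biStable_comp.not.and biStable_triv.not) biStable_triv.not
      fun _ _ h => h.2).g n y = x) ↔
      ¬ ∃ y, (D.inclEmb D.biStable_pos biStable_triv.not fun _ _ h => h.2).g n y = x := by
  have hx : ¬ D.Triv n x.1 := x.2
  have h1 := D.exists_inclEmb (biStable_comp.not.and biStable_triv.not) biStable_triv.not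
    (fun _ _ h => h.2) n x
  have h2 := D.exists_inclEmb D.biStable_pos biStable_triv.not (fun _ _ h => h.2) n x
  refine h1.trans (Iff.trans ?_ (not_congr h2).symm)
  tauto

/-- The tuples that are not composable are removed as an acyclic summand, and the composable ones
split into the constant tuples and `pos`. -/
theorem HH_tuples (n : ℕ) :
    Nonempty (D.tuples.HH k n ≃ₗ[k] (PCyc.const D.Vert).HH k n × D.pos.HH k n) := by
  obtain ⟨e₁⟩ := PCyc.HH_prod k _ _ D.comp_compl n
  obtain ⟨e₂⟩ := PCyc.HH_prod k _ _ D.vertComp_compl n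
  have := D.subsingleton_HH_of_not_comp k biStable_comp.not (fun _ _ h => h) n
  obtain ⟨e₃⟩ := nonempty_equiv_of_prod e₁
  exact ⟨e₃.trans e₂⟩

theorem HC_tuples (n : ℕ) :
    Nonempty (D.tuples.HC k n ≃ₗ[k] (PCyc.const D.Vert).HC k n × D.pos.HC k n) := by
  obtain ⟨e₁⟩ := PCyc.HC_prod k _ _ D.comp_compl n
  obtain ⟨e₂⟩ := PCyc.HC_prod k _ _ D.vertComp_compl n
  have := D.subsingleton_HC_of_not_comp k biStable_comp.not (fun _ _ h => h) n
  obtain ⟨e₃⟩ := nonempty_equiv_of_prod e₁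
  exact ⟨e₃.trans e₂⟩

/-- Used for the relative groups: what `nontriv` contains beyond `pos` is not composable, hence
acyclic. -/
theorem HH_nontriv (n : ℕ) : Nonempty (D.nontriv.HH k n ≃ₗ[k] D.pos.HH k n) := by
  obtain ⟨e⟩ := PCyc.HH_prod k _ _ D.nontriv_compl n
  have := D.subsingleton_HH_of_not_comp k (biStable_comp.not.and biStable_triv.not)
    (fun _ _ h => h.1) n
  exact nonempty_equiv_of_prod e

theorem HC_nontriv (n : ℕ) : Nonempty (D.nontriv.HC k n ≃ₗ[k] D.pos.HC k n) := by
  obtain ⟨e⟩ := PCyc.HC_prod k _ _ D.nontriv_compl n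
  have := D.subsingleton_HC_of_not_comp k (biStable_comp.not.and biStable_triv.not)
    (fun _ _ h => h.1) n
  exact nonempty_equiv_of_prod e

/-- Functions on the finite vertex set as chains on the trivial paths. -/
noncomputable def vertLinearEquiv [Finite V] : (D.Vert →₀ k) ≃ₗ[k] (V → k) :=
  (Finsupp.domLCongr D.vertEquiv).trans (Finsupp.linearEquivFunOnFinite k k V)

theorem HH_tuples_zero [Finite V] :
    Nonempty (D.tuples.HH k 0 ≃ₗ[k] (V → k) × D.pos.HH k 0) := by
  obtain ⟨e⟩ := D.HH_tuples k 0
  obtain ⟨e'⟩ := hoch_const_zero (k := k) (W := D.Vert →₀ k) (PCyc.const_linF k D.Vert)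
    (PCyc.const_linR k D.Vert)
  exact ⟨e.trans (LinearEquiv.prodCongr (e'.trans (D.vertLinearEquiv k)) (LinearEquiv.refl k _))⟩

theorem HH_tuples_succ (n : ℕ) : Nonempty (D.tuples.HH k (n + 1) ≃ₗ[k] D.pos.HH k (n + 1)) := by
  obtain ⟨e⟩ := D.HH_tuples k (n + 1)
  have : Subsingleton ((PCyc.const D.Vert).HH k (n + 1)) :=
    hoch_const_succ (k := k) (W := D.Vert →₀ k) (PCyc.const_linF k D.Vert)
      (PCyc.const_linR k D.Vert) n
  exact nonempty_equiv_of_prod e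

theorem HC_tuples_even [Finite V] {n : ℕ} (hn : Even n) :
    Nonempty (D.tuples.HC k n ≃ₗ[k] (V → k) × D.pos.HC k n) := by
  obtain ⟨e⟩ := D.HC_tuples k n
  obtain ⟨e'⟩ := tot_const_even (k := k) (W := D.Vert →₀ k) (PCyc.const_linF k D.Vert)
    (PCyc.const_linR k D.Vert) hn
  exact ⟨e.trans (LinearEquiv.prodCongr (e'.trans (D.vertLinearEquiv k)) (LinearEquiv.refl k _))⟩

theorem HC_tuples_odd {n : ℕ} (hn : Odd n) :
    Nonempty (D.tuples.HC k n ≃ₗ[k] D.pos.HC k n) := by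
  obtain ⟨e⟩ := D.HC_tuples k n
  have : Subsingleton ((PCyc.const D.Vert).HC k n) :=
    tot_const_odd (k := k) (W := D.Vert →₀ k) (PCyc.const_linF k D.Vert)
      (PCyc.const_linR k D.Vert) hn
  exact nonempty_equiv_of_prod e

end Homology

end PathSys

/-! ### Hochschild chains in a multiplicative basis, absolute and relative -/

namespace PathSys

variable {V : Type*} {D : PathSys V} {k : Type*} [Field k] {A : Type*} [Ring A] [Algebra k A]
  (β : Module.Basis D.B k A)

/-- The basis of the chains given by the tuples of basis elements. -/
noncomputable def chainEquiv (n : ℕ) : Chain k A n ≃ₗ[k] (D.tuples.X n →₀ k) :=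
  (Basis.piTensorProduct fun _ : Fin (n + 1) => β).repr

theorem chainEquiv_tprod (n : ℕ) (x : Fin (n + 1) → D.B) :
    chainEquiv β n (PiTensorProduct.tprod k fun i => β (x i)) = Finsupp.single x 1 := by
  rw [← Basis.piTensorProduct_apply (fun _ : Fin (n + 1) => β) x]
  exact Module.Basis.repr_self _ _

theorem chain_ext {n : ℕ} {M : Type*} [AddCommGroup M] [Module k M] {f g : Chain k A n →ₗ[k] M}
    (h : ∀ x : Fin (n + 1) → D.B, f (PiTensorProduct.tprod k fun i => β (x i)) =
      g (PiTensorProduct.tprod k fun i => β (x i))) : f = g :=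
  (Basis.piTensorProduct fun _ : Fin (n + 1) => β).ext fun x => by
    rw [Basis.piTensorProduct_apply]
    exact h x

section Mul

variable (hβ : ∀ p q, β p * β q = (D.mul p q).elim 0 β)
include hβ

theorem chainEquiv_face (n : ℕ) (i : Fin (n + 1)) (z : Chain k A (n + 1)) :
    chainEquiv β n (face k A n i z) = D.tuples.linF k n i (chainEquiv β (n + 1) z) := by
  have : (chainEquiv β n).toLinearMap ∘ₗ face k A n i =
      D.tuples.linF k n i ∘ₗ (chainEquiv β (n + 1)).toLinearMap := by
    refine chain_ext β fun x => ?_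
    rw [LinearMap.comp_apply, LinearMap.comp_apply, LinearEquiv.coe_coe, LinearEquiv.coe_coe,
      chainEquiv_tprod, face_tprod, PCyc.linF_single]
    have hm := hβ (x i.castSucc) (x i.succ)
    cases hc : D.mul (x i.castSucc) (x i.succ) with
    | none =>
      rw [hc] at hm
      have h0 : D.tuples.f n i x = none := fc_none.2 hc
      rw [h0]
      -- When the product vanishes, the contracted tensor has a zero factor.
      have : Fin.contractNth i.castSucc (· * ·) (fun j => β (x j)) i = 0 := by
        simp only [Fin.contractNth, Fin.val_castSucc, lt_irrefl, if_false, if_true]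
        exact hm
      rw [MultilinearMap.map_coord_zero _ i this, map_zero]
      rfl
    | some c =>
      rw [hc] at hm
      have h0 : D.tuples.f n i x = some (D.merge i c x) := fc_some.2 ⟨c, hc, rfl⟩
      rw [h0]
      have : Fin.contractNth i.castSucc (· * ·) (fun j => β (x j)) =
          fun j => β (D.merge i c x j) := by
        funext j
        simp only [Fin.contractNth, merge_apply, Fin.val_castSucc]
        split_ifs with h1 h2
        · rfl
        · rw [Fin.ext h2]; exact hm
        · rfl
      rw [this, chainEquiv_tprod]
      rfl
  exact LinearMap.congr_fun this z

omit hβ in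
theorem chainEquiv_rot (n : ℕ) (z : Chain k A n) :
    chainEquiv β n (rot k A n z) = D.tuples.linR k n (chainEquiv β n z) := by
  have : (chainEquiv β n).toLinearMap ∘ₗ rot k A n =
      D.tuples.linR k n ∘ₗ (chainEquiv β n).toLinearMap := by
    refine chain_ext β fun x => ?_
    rw [LinearMap.comp_apply, LinearMap.comp_apply, LinearEquiv.coe_coe,
      chainEquiv_tprod, rot_tprod, PCyc.linR_single]
    exact chainEquiv_tprod β n (D.rt x)
  exact LinearMap.congr_fun this z

theorem HH_equiv_tuples (n : ℕ) : Nonempty (MonomialHH.HH k A n ≃ₗ[k] D.tuples.HH k n) :=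
  homology_nonempty_equiv (chainEquiv β)
    (hochOp_natural (F := face k A) (R := rot k A) (fun n => (chainEquiv β n).toLinearMap)
      (chainEquiv_face β hβ) (chainEquiv_rot β)) n

theorem HC_equiv_tuples (n : ℕ) : Nonempty (MonomialHH.HC k A n ≃ₗ[k] D.tuples.HC k n) := by
  have h := totOp_natural (F := face k A) (R := rot k A) (fun n => (chainEquiv β n).toLinearMap)
      (chainEquiv_face β hβ) (chainEquiv_rot β)
  rw [← totDiff_eq] at h
  exact homology_nonempty_equiv (C := fun n => Tot k A n)
    (C' := fun n => ∀ q : Fin (n + 1), D.tuples.X q →₀ k)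
    (fun n => LinearEquiv.piCongrRight fun q : Fin (n + 1) => chainEquiv β q) h n

end Mul

section Relative

variable (I : Ideal A) [I.IsTwoSided] (hI : ∀ x, x ∈ I ↔ ∀ p, D.len p = 0 → β.repr x p = 0)

open Classical in
/-- The projection onto the span of the trivial paths. -/
noncomputable def trivProj : A →ₗ[k] A := β.constr k fun p => if D.len p = 0 then β p else 0

open Classical in
theorem trivProj_basis (p : D.B) : trivProj β (β p) = if D.len p = 0 then β p else 0 := by
  rw [trivProj, Module.Basis.constr_basis]

open Classical in
theorem map_trivProj_tprod (n : ℕ) (x : Fin (n + 1) → D.B) :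
    PiTensorProduct.map (fun _ : Fin (n + 1) => trivProj β)
      (PiTensorProduct.tprod k fun i => β (x i)) =
      if D.Triv n x then PiTensorProduct.tprod k fun i => β (x i) else 0 := by
  rw [PiTensorProduct.map_tprod]
  split_ifs with h
  · congr 1
    funext i
    rw [trivProj_basis, if_pos (h i)]
  · obtain ⟨i, hi⟩ := not_forall.1 h
    exact MultilinearMap.map_coord_zero _ i (by rw [trivProj_basis, if_neg hi])

theorem chainEquiv_map_trivProj (n : ℕ) (z : Chain k A n) (x : Fin (n + 1) → D.B)
    (hx : D.Triv n x) :
    chainEquiv β n (PiTensorProduct.map (fun _ : Fin (n + 1) => trivProj β) z) x =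
      chainEquiv β n z x := by
  have : (Finsupp.lapply (R := k) (M := k) (α := D.tuples.X n) x) ∘ₗ
      (chainEquiv β n).toLinearMap ∘ₗ
      PiTensorProduct.map (fun _ : Fin (n + 1) => trivProj β) =
      (Finsupp.lapply (R := k) (M := k) (α := D.tuples.X n) x) ∘ₗ
        (chainEquiv β n).toLinearMap := by
    classical
    refine chain_ext β fun y => ?_
    simp only [LinearMap.comp_apply, map_trivProj_tprod]
    split_ifs with h
    · rfl
    · have hne : y ≠ x := fun h' => h (h' ▸ hx)
      rw [map_zero, map_zero, LinearEquiv.coe_coe, chainEquiv_tprod]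
      exact (Finsupp.single_eq_of_ne (Ne.symm hne)).symm
  exact LinearMap.congr_fun this z

omit [I.IsTwoSided] in
include hI in
theorem trivProj_eq_zero_of_mem {x : A} (hx : x ∈ I) : trivProj β x = 0 := by
  have h := (hI x).1 hx
  rw [← β.linearCombination_repr x, Finsupp.linearCombination_apply, Finsupp.sum, map_sum]
  refine Finset.sum_eq_zero fun p _ => ?_
  rw [map_smul, trivProj_basis]
  split_ifs with hp
  · rw [h p hp, zero_smul]
  · rw [smul_zero]

/-- The inclusion of the chains on the tuples which are not all trivial. -/
noncomputable def nontrivChain (n : ℕ) : (D.nontriv.X n →₀ k) →ₗ[k] Chain k A n :=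
  (chainEquiv β n).symm.toLinearMap ∘ₗ
    (D.tuples.subEmb _ (biStable_triv (D := D)).not.stable).lin k n

theorem nontrivChain_apply (n : ℕ) (z : D.nontriv.X n →₀ k) : nontrivChain β n z =
    (chainEquiv β n).symm ((D.tuples.subEmb _ (biStable_triv (D := D)).not.stable).lin k n z) := rfl

theorem nontrivChain_injective (n : ℕ) : Function.Injective (nontrivChain (k := k) β n) :=
  (chainEquiv β n).symm.injective.comp (PCyc.Emb.lin_injective k _ n)

include hI in
-- By `hI` the ideal is spanned by the basis elements of positive length, so a tensor with such a
-- factor dies in the quotient. Conversely, `trivProj` factors through the quotient, so its tensor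
-- power kills the kernel; as it leaves coefficients at trivial tuples unchanged, these coefficients
-- are zero on the kernel.
theorem range_nontrivChain (n : ℕ) :
    LinearMap.range (nontrivChain (k := k) β n) = relChain k A I n := by
  apply le_antisymm
  · rw [relChain, LinearMap.range_le_ker_iff]
    refine Finsupp.lhom_ext' fun x => LinearMap.ext_ring ?_
    obtain ⟨x, hx⟩ := x
    obtain ⟨i, hi⟩ := not_forall.1 hx
    have h1 : nontrivChain (k := k) β n (Finsupp.single ⟨x, hx⟩ 1) =
        PiTensorProduct.tprod k fun i => β (x i) := by
      rw [nontrivChain_apply, LinearEquiv.symm_apply_eq, chainEquiv_tprod]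
      exact Finsupp.mapDomain_single
    simp only [LinearMap.comp_apply, LinearMap.zero_apply]
    erw [h1]
    rw [PiTensorProduct.map_tprod]
    refine MultilinearMap.map_coord_zero _ i ?_
    refine Ideal.Quotient.eq_zero_iff_mem.2 ((hI _).2 fun p hp => ?_)
    have : x i ≠ p := fun h => hi (by rw [h]; exact hp)
    simp [this]
  · intro z hz
    -- A linear section, which exists over a field, exhibits the factorization of `trivProj` through
    -- `A ⧸ I`.
    obtain ⟨s, hs⟩ := LinearMap.exists_rightInverse_of_surjective
      (Ideal.Quotient.mkₐ k I).toLinearMap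
      (LinearMap.range_eq_top.2 (Ideal.Quotient.mkₐ_surjective k I))
    have hσ : (trivProj β ∘ₗ s) ∘ₗ (Ideal.Quotient.mkₐ k I).toLinearMap = trivProj β := by
      refine LinearMap.ext fun x => ?_
      rw [LinearMap.comp_apply, LinearMap.comp_apply, ← sub_eq_zero, ← map_sub]
      refine trivProj_eq_zero_of_mem β I hI ?_
      rw [← Ideal.Quotient.eq_zero_iff_mem, map_sub, sub_eq_zero]
      exact LinearMap.congr_fun hs ((Ideal.Quotient.mkₐ k I) x)
    have hz0 : PiTensorProduct.map (fun _ : Fin (n + 1) => trivProj β) z = 0 := by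
      rw [← hσ, PiTensorProduct.map_comp, LinearMap.comp_apply]
      have hz' : PiTensorProduct.map (fun _ : Fin (n + 1) =>
        (Ideal.Quotient.mkₐ k I).toLinearMap) z = 0 := hz
      rw [hz', map_zero]
    have hx : ∀ x, D.Triv n x → chainEquiv β n z x = 0 := fun x hx => by
      rw [← chainEquiv_map_trivProj β n z x hx, hz0, map_zero]
      rfl
    let g := D.tuples.subEmb _ (biStable_triv (D := D)).not.stable
    refine ⟨g.proj k n (chainEquiv β n z), ?_⟩
    refine (LinearEquiv.symm_apply_eq _).2 ?_
    refine Finsupp.mapDomain_comapDomain _ (g.inj n) _ fun x hx' => ?_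
    refine ⟨⟨x, fun h => ?_⟩, rfl⟩
    exact (Finsupp.mem_support_iff.1 hx') (hx x h)

variable (hβ : ∀ p q, β p * β q = (D.mul p q).elim 0 β)
include hβ

theorem nontrivChain_linF (n : ℕ) (i : Fin (n + 1)) (z : D.nontriv.X (n + 1) →₀ k) :
    nontrivChain β n (D.nontriv.linF k n i z) = face k A n i (nontrivChain β (n + 1) z) := by
  refine (LinearEquiv.symm_apply_eq _).2 ?_
  rw [chainEquiv_face β hβ, nontrivChain_apply, LinearEquiv.apply_symm_apply]
  exact PCyc.Emb.lin_linF k _ n i z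

omit hβ in
theorem nontrivChain_linR (n : ℕ) (z : D.nontriv.X n →₀ k) :
    nontrivChain β n (D.nontriv.linR k n z) = rot k A n (nontrivChain β n z) := by
  refine (LinearEquiv.symm_apply_eq _).2 ?_
  rw [chainEquiv_rot β, nontrivChain_apply, LinearEquiv.apply_symm_apply]
  exact PCyc.Emb.lin_linR k _ n z

include hI

theorem RelHH_equiv_nontriv (n : ℕ) : Nonempty (RelHH k A I n ≃ₗ[k] D.nontriv.HH k n) :=
  subHomology_nonempty_equiv _ _ _ (nontrivChain β)
    (hochOp_natural _ (nontrivChain_linF β hβ) (nontrivChain_linR β))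
    (nontrivChain_injective β) (range_nontrivChain β I hI) n

omit hβ in
theorem range_totMap_nontrivChain (n : ℕ) :
    LinearMap.range (PCyc.totMap k (nontrivChain (k := k) β) n) =
      Submodule.pi Set.univ fun q : Fin (n + 1) => relChain k A I q := by
  ext z
  simp only [LinearMap.mem_range, Submodule.mem_pi, Set.mem_univ, forall_true_left,
    ← range_nontrivChain β I hI]
  constructor
  · rintro ⟨y, rfl⟩ q
    exact ⟨y q, rfl⟩
  · intro hz
    choose y hy using hz
    exact ⟨y, funext hy⟩

theorem RelHC_equiv_nontriv (n : ℕ) : Nonempty (RelHC k A I n ≃ₗ[k] D.nontriv.HC k n) := by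
  have h : ∀ n (x : ∀ q : Fin (n + 1 + 1), D.nontriv.X q →₀ k),
      PCyc.totMap k (nontrivChain (k := k) β) n
        (totOp (M := fun n => D.nontriv.X n →₀ k) (D.nontriv.linF k) (D.nontriv.linR k) n x) =
      totDiff k A n (PCyc.totMap k (nontrivChain (k := k) β) (n + 1) x) := by
    rw [totDiff_eq]
    exact totOp_natural (M := fun n => D.nontriv.X n →₀ k) (M' := Chain k A) (nontrivChain β)
      (nontrivChain_linF β hβ) (nontrivChain_linR β)
  exact subHomology_nonempty_equiv (C := Tot k A)
    (C' := fun n => ∀ q : Fin (n + 1), D.nontriv.X q →₀ k) (totDiff k A) _ _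
    (PCyc.totMap k (nontrivChain (k := k) β)) h
    (fun n x y hxy => funext fun q => nontrivChain_injective β q (congrFun hxy q))
    (range_totMap_nontrivChain β I hI) n

end Relative

end PathSys

/-! ### Ideals spanned by paths and the pulled back relations -/

section PathAlgebraLemmas

variable {k : Type*} [Field k] {V E : Type*} {Q : Quiv V E}

/-- The coefficient of a path. -/
noncomputable def coef (p : QPath Q) : PathAlg k Q →ₗ[k] k :=
  Finsupp.lapply (M := k) (R := k) p

theorem coef_ofPath_self (p : QPath Q) : coef p (ofPath k p) = 1 := Finsupp.single_eq_same

theorem coef_ofPath_of_ne {p q : QPath Q} (h : q ≠ p) : coef p (ofPath k q) = 0 :=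
  Finsupp.single_eq_of_ne (Ne.symm h)

theorem pathAlg_induction {P : PathAlg k Q → Prop} (h0 : P 0) (hadd : ∀ x y, P x → P y → P (x + y))
    (h : ∀ (c : k) (p : QPath Q), P (c • ofPath k p)) (x : PathAlg k Q) : P x :=
  Finsupp.induction_linear (M := k) (motive := P) x h0 hadd fun p c => by
    have h1 : c • ofPath k p = (Finsupp.single p c : QPath Q →₀ k) :=
      (Finsupp.smul_single c p (1 : k)).trans (by rw [smul_eq_mul, mul_one])
    exact h1 ▸ h c p

theorem ofPath_mul_ofPath_of_eq {p q : QPath Q} (h : p.tgt = q.src) :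
    ofPath k p * ofPath k q = ofPath k (p.comp q h) := by
  rw [ofPath_mul_ofPath, pathMul, dif_pos h]

theorem ofPath_mul_ofPath_of_ne {p q : QPath Q} (h : p.tgt ≠ q.src) :
    ofPath k p * ofPath k q = 0 := by
  rw [ofPath_mul_ofPath, pathMul, dif_neg h]

theorem length_comp (p q : QPath Q) (h : p.tgt = q.src) :
    (p.comp q h).length = p.length + q.length := List.length_append

theorem QPath.eq_triv {p : QPath Q} (h : p.length = 0) : p = QPath.triv p.src := by
  obtain ⟨s, t, l, hw⟩ := p
  obtain rfl : l = [] := List.eq_nil_of_length_eq_zero h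
  cases hw
  rfl

variable [Fintype V]

theorem smul_mem_twoSided (I : TwoSidedIdeal (PathAlg k Q)) (c : k) {x : PathAlg k Q} (hx : x ∈ I) :
    c • x ∈ I := by
  rw [← one_mul x, ← smul_mul_assoc]
  exact I.mul_mem_left _ _ hx

/-- The subspace spanned by a set of paths. -/
noncomputable def pathSpan (k : Type*) [Field k] (T : Set (QPath Q)) : Submodule k (PathAlg k Q) :=
  Submodule.span k (ofPath k '' T)

theorem mem_pathSpan {T : Set (QPath Q)} {x : PathAlg k Q} :
    x ∈ pathSpan k T ↔ ∀ p, coef p x ≠ 0 → p ∈ T := by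
  have h : pathSpan k T = Finsupp.supported k k T := (Finsupp.supported_eq_span_single k T).symm
  rw [h]
  refine (Finsupp.mem_supported k x).trans ⟨fun h p hp => h (Finsupp.mem_support_iff.2 hp),
    fun h p hp => h p (Finsupp.mem_support_iff.1 hp)⟩

theorem mul_mem_pathSpan {T T' T'' : Set (QPath Q)}
    (h : ∀ p ∈ T, ∀ q ∈ T', ∀ hpq : p.tgt = q.src, p.comp q hpq ∈ T'') {x y : PathAlg k Q}
    (hx : x ∈ pathSpan k T) (hy : y ∈ pathSpan k T') : x * y ∈ pathSpan k T'' := by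
  have h1 : pathSpan k T * pathSpan k T' ≤ pathSpan k T'' := by
    rw [pathSpan, pathSpan, Submodule.span_mul_span, Submodule.span_le]
    rintro _ ⟨_, ⟨p, hp, rfl⟩, _, ⟨q, hq, rfl⟩, rfl⟩
    by_cases hpq : p.tgt = q.src
    · change ofPath k p * ofPath k q ∈ pathSpan k T''
      rw [ofPath_mul_ofPath_of_eq hpq]
      exact Submodule.subset_span ⟨_, h p hp q hq hpq, rfl⟩
    · change ofPath k p * ofPath k q ∈ pathSpan k T''
      rw [ofPath_mul_ofPath_of_ne hpq]
      exact Submodule.zero_mem _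
  exact h1 (Submodule.mul_mem_mul hx hy)

/-- An ideal generated by a set of paths which absorbs composition is the span of these paths. -/
theorem mem_span_ofPath {T : Set (QPath Q)}
    (hl : ∀ (p q : QPath Q) (h : p.tgt = q.src), q ∈ T → p.comp q h ∈ T)
    (hr : ∀ (p q : QPath Q) (h : p.tgt = q.src), p ∈ T → p.comp q h ∈ T) {x : PathAlg k Q} :
    x ∈ TwoSidedIdeal.span (ofPath k '' T) ↔ ∀ p, coef p x ≠ 0 → p ∈ T := by
  rw [← mem_pathSpan]
  have htop : ∀ y : PathAlg k Q, y ∈ pathSpan k (Set.univ : Set (QPath Q)) := fun y =>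
    mem_pathSpan.2 fun _ _ => trivial
  constructor
  · let J : TwoSidedIdeal (PathAlg k Q) := TwoSidedIdeal.mk' (pathSpan k T : Set (PathAlg k Q))
      (Submodule.zero_mem _) (Submodule.add_mem _) (Submodule.neg_mem _)
      (fun {x y} hy => mul_mem_pathSpan (fun p _ q hq h => hl p q h hq) (htop x) hy)
      (fun {x y} hx => mul_mem_pathSpan (fun p hp q _ h => hr p q h hp) hx (htop y))
    have hJ : TwoSidedIdeal.span (ofPath k '' T) ≤ J := by
      rw [TwoSidedIdeal.span_le]
      intro y hy
      exact (TwoSidedIdeal.mem_mk' _ _ _ _ _ _ _).2 (Submodule.subset_span hy)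
    exact fun hx => (TwoSidedIdeal.mem_mk' _ _ _ _ _ _ _).1 (hJ hx)
  · intro hx
    refine Submodule.span_induction (p := fun x _ => x ∈ TwoSidedIdeal.span (ofPath k '' T))
      (fun y hy => TwoSidedIdeal.subset_span hy) (TwoSidedIdeal.zero_mem _)
      (fun y z _ _ hy hz => TwoSidedIdeal.add_mem _ hy hz)
      (fun c y _ hy => smul_mem_twoSided _ c hy) hx

/-- The properties of an admissible monomial ideal, expressed through the paths it contains. -/
structure IsPathIdeal (I : TwoSidedIdeal (PathAlg k Q)) : Prop where
  of_coef : ∀ x ∈ I, ∀ p, coef p x ≠ 0 → ofPath k p ∈ I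
  two_le : ∀ p, ofPath k p ∈ I → 2 ≤ p.length
  exists_length : ∃ N, ∀ p : QPath Q, N ≤ p.length → ofPath k p ∈ I

theorem comp_mem_left (I : TwoSidedIdeal (PathAlg k Q)) (p q : QPath Q) (h : p.tgt = q.src)
    (hq : ofPath k q ∈ I) : ofPath k (p.comp q h) ∈ I := by
  rw [← ofPath_mul_ofPath_of_eq h]
  exact I.mul_mem_left _ _ hq

theorem comp_mem_right (I : TwoSidedIdeal (PathAlg k Q)) (p q : QPath Q) (h : p.tgt = q.src)
    (hp : ofPath k p ∈ I) : ofPath k (p.comp q h) ∈ I := by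
  rw [← ofPath_mul_ofPath_of_eq h]
  exact I.mul_mem_right _ _ hp

/-- Admissibility gives the two bounds on lengths, and monomiality makes `I` a span of paths. Only
these consequences are used afterwards, and they pass to cycle algebras. -/
theorem isPathIdeal_of_monomial {I : TwoSidedIdeal (PathAlg k Q)} (hadm : IsAdmissible I)
    (hmon : IsMonomial I) : IsPathIdeal I where
  of_coef := by
    obtain ⟨S, -, hS⟩ := hmon
    -- The generators are enlarged to all paths in `I`, a set that absorbs composition; the ideal is
    -- then simply the linear span of that set.
    have hI : I = TwoSidedIdeal.span (ofPath k '' {p : QPath Q | ofPath k p ∈ I}) := by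
      apply le_antisymm
      · nth_rewrite 1 [hS]
        refine TwoSidedIdeal.span_mono (Set.image_mono fun p hp => ?_)
        change ofPath k p ∈ I
        rw [hS]
        exact TwoSidedIdeal.subset_span ⟨p, hp, rfl⟩
      · rw [TwoSidedIdeal.span_le]
        rintro _ ⟨p, hp, rfl⟩
        exact hp
    intro x hx
    rw [hI] at hx
    exact (mem_span_ofPath (comp_mem_left I) (comp_mem_right I)).1 hx
  two_le p hp := by
    have h := hadm.2 hp
    rw [pathIdeal, mem_span_ofPath] at h
    · exact h p (by rw [coef_ofPath_self]; exact one_ne_zero)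
    · intro p q h hq
      have : 2 ≤ q.length := hq
      change 2 ≤ (p.comp q h).length
      rw [length_comp]; omega
    · intro p q h hp
      have : 2 ≤ p.length := hp
      change 2 ≤ (p.comp q h).length
      rw [length_comp]; omega
  exists_length := by
    obtain ⟨N, -, hN⟩ := hadm.1
    exact ⟨N, fun p hp => hN (TwoSidedIdeal.subset_span ⟨p, hp, rfl⟩)⟩

omit [Fintype V] in
theorem mapPath_comp (Y : QCycle Q) (p q : QPath (basicCycle Y.len)) (h : p.tgt = q.src) :
    Y.mapPath (p.comp q h) = (Y.mapPath p).comp (Y.mapPath q)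
      (congrArg (fun i => Q.s (Y.arr i)) h) :=
  QPath.ext rfl rfl (List.map_append ..)

omit [Fintype V] in
theorem length_mapPath (Y : QCycle Q) (p : QPath (basicCycle Y.len)) :
    (Y.mapPath p).length = p.length := List.length_map _

/-- The paths with image in `I` already absorb composition, because `mapPath` is multiplicative. No
further paths appear in the ideal they generate. -/
theorem mem_cycleIdeal_iff (I : TwoSidedIdeal (PathAlg k Q)) (Y : QCycle Q)
    (x : PathAlg k (basicCycle Y.len)) :
    x ∈ cycleIdeal I Y ↔ ∀ p, coef p x ≠ 0 → ofPath k (Y.mapPath p) ∈ I := by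
  refine mem_span_ofPath (fun p q h hq => ?_) (fun p q h hp => ?_)
  · change ofPath k (Y.mapPath (p.comp q h)) ∈ I
    rw [mapPath_comp]
    exact comp_mem_left I _ _ _ hq
  · change ofPath k (Y.mapPath (p.comp q h)) ∈ I
    rw [mapPath_comp]
    exact comp_mem_right I _ _ _ hp

theorem ofPath_mem_cycleIdeal (I : TwoSidedIdeal (PathAlg k Q)) (Y : QCycle Q)
    (p : QPath (basicCycle Y.len)) :
    ofPath k p ∈ cycleIdeal I Y ↔ ofPath k (Y.mapPath p) ∈ I := by
  rw [mem_cycleIdeal_iff]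
  constructor
  · intro h
    exact h p (by rw [coef_ofPath_self]; exact one_ne_zero)
  · intro h q hq
    by_cases hpq : p = q
    · exact hpq ▸ h
    · exact absurd (coef_ofPath_of_ne hpq) hq

/-- The map to `Q` preserves lengths, so both bounds are inherited and every result on $kQ/I$ also
holds for $Z$. -/
theorem IsPathIdeal.cycleIdeal {I : TwoSidedIdeal (PathAlg k Q)} (h : IsPathIdeal I)
    (Y : QCycle Q) : IsPathIdeal (cycleIdeal I Y) where
  of_coef x hx p hp := (ofPath_mem_cycleIdeal I Y p).2 ((mem_cycleIdeal_iff I Y x).1 hx p hp)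
  two_le p hp := by
    rw [← length_mapPath Y]
    exact h.two_le _ ((ofPath_mem_cycleIdeal I Y p).1 hp)
  exists_length := by
    obtain ⟨N, hN⟩ := h.exists_length
    refine ⟨N, fun p hp => (ofPath_mem_cycleIdeal I Y p).2 (hN _ ?_)⟩
    rwa [length_mapPath]

end PathAlgebraLemmas

/-! ### The basis of paths outside the ideal and the Jacobson radical -/

section PathBasis

variable {k : Type*} [Field k] {V E : Type*} {Q : Quiv V E} [Fintype V]
  {I : TwoSidedIdeal (PathAlg k Q)} (hI : IsPathIdeal I)

open Classical in
/-- The paths of `Q` outside `I`. -/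
noncomputable def pathSys : PathSys V where
  B := {p : QPath Q // ofPath k p ∉ I}
  src p := p.1.src
  tgt p := p.1.tgt
  len p := p.1.length
  mul p q := if h : ∃ h : p.1.tgt = q.1.src, ofPath k (p.1.comp q.1 h) ∉ I then
    some ⟨p.1.comp q.1 h.choose, h.choose_spec⟩ else none
  e v := ⟨QPath.triv v, fun h => absurd (hI.two_le _ h) (by simp [QPath.triv, QPath.length])⟩
  mul_some p q c h := by
    split_ifs at h with h'
    obtain rfl := Option.some.inj h
    exact ⟨h'.choose, rfl, rfl, length_comp _ _ h'.choose⟩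
  src_e _ := rfl
  tgt_e _ := rfl
  e_mul p := by
    have h : (QPath.triv p.1.src).comp p.1 rfl = p.1 := rfl
    rw [dif_pos ⟨rfl, by rw [h]; exact p.2⟩]
    rfl
  mul_e p := by
    have h : p.1.comp (QPath.triv p.1.tgt) rfl = p.1 :=
      QPath.ext rfl rfl (List.append_nil _)
    rw [dif_pos ⟨rfl, by rw [h]; exact p.2⟩]
    exact congrArg some (Subtype.ext h)
  len_eq_zero p := by
    constructor
    · intro h
      exact Subtype.ext (QPath.eq_triv h)
    · intro h
      rw [h]
      rfl

theorem pathSys_mul_some {p q c : (pathSys hI).B} :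
    (pathSys hI).mul p q = some c ↔ ∃ h : p.1.tgt = q.1.src, p.1.comp q.1 h = c.1 := by
  classical
  change (if h : ∃ h : p.1.tgt = q.1.src, ofPath k (p.1.comp q.1 h) ∉ I then
    some (⟨p.1.comp q.1 h.choose, h.choose_spec⟩ : {p : QPath Q // ofPath k p ∉ I}) else none) =
      some c ↔ _
  constructor
  · intro h
    split_ifs at h with h'
    obtain rfl := Option.some.inj h
    exact ⟨h'.choose, rfl⟩
  · rintro ⟨h, hc⟩
    rw [dif_pos ⟨h, hc ▸ c.2⟩]
    exact congrArg some (Subtype.ext hc)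

theorem pathSys_mul_none {p q : (pathSys hI).B} (h : (pathSys hI).mul p q = none) :
    ofPath k p.1 * ofPath k q.1 ∈ I := by
  by_cases hpq : p.1.tgt = q.1.src
  · rw [ofPath_mul_ofPath_of_eq hpq]
    by_contra hc
    have := (pathSys_mul_some hI (c := ⟨p.1.comp q.1 hpq, hc⟩)).2 ⟨hpq, rfl⟩
    rw [h] at this
    exact absurd this (by simp)
  · rw [ofPath_mul_ofPath_of_ne hpq]
    exact I.zero_mem

variable (I) in
/-- The projection of the path algebra onto its quotient. -/
noncomputable def quotMk : PathAlg k Q →ₐ[k] QuotAlg I := RingCon.mkₐ k I.ringCon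

theorem quotMk_surjective : Function.Surjective (quotMk I) := fun x =>
  Quotient.inductionOn' x fun y => ⟨y, rfl⟩

theorem quotMk_eq_zero {x : PathAlg k Q} : quotMk I x = 0 ↔ x ∈ I := by
  rw [TwoSidedIdeal.mem_iff, ← RingCon.eq]
  exact Iff.rfl

/-- The basis of `kQ/I` given by the paths outside `I`. -/
noncomputable def quotBasis : Module.Basis (pathSys hI).B k (QuotAlg I) :=
  Module.Basis.mk (v := fun p : (pathSys hI).B => quotMk I (ofPath k p.1))
    (by
      rw [linearIndependent_iff']
      intro s g hg p hp
      -- A vanishing combination in the quotient lies in `I`, which would then contain every path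
      -- with nonzero coefficient, although the chosen paths lie outside it.
      have h1 : ∑ q ∈ s, g q • ofPath k q.1 ∈ I := by
        rw [← quotMk_eq_zero, map_sum]
        simpa only [map_smul] using hg
      by_contra hne
      refine p.2 (hI.of_coef _ h1 p.1 ?_)
      rw [map_sum, Finset.sum_eq_single p]
      · rw [map_smul, coef_ofPath_self, smul_eq_mul, mul_one]
        exact hne
      · intro q _ hq
        rw [map_smul, coef_ofPath_of_ne (fun h => hq (Subtype.ext h)), smul_zero]
      · exact fun h => absurd hp h)
    (by
      rintro x -
      obtain ⟨x, rfl⟩ := quotMk_surjective x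
      induction x using pathAlg_induction with
      | h0 => rw [map_zero]; exact Submodule.zero_mem _
      | hadd x y hx hy => rw [map_add]; exact Submodule.add_mem _ hx hy
      | h c p =>
        rw [map_smul]
        refine Submodule.smul_mem _ c ?_
        by_cases hp : ofPath k p ∈ I
        · rw [quotMk_eq_zero.2 hp]; exact Submodule.zero_mem _
        · exact Submodule.subset_span ⟨⟨p, hp⟩, rfl⟩)

theorem quotBasis_apply (p : (pathSys hI).B) : quotBasis hI p = quotMk I (ofPath k p.1) :=
  Module.Basis.mk_apply _ _ p

theorem quotBasis_mul (p q : (pathSys hI).B) : quotBasis hI p * quotBasis hI q =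
    ((pathSys hI).mul p q).elim 0 (quotBasis hI) := by
  rw [quotBasis_apply, quotBasis_apply, ← map_mul]
  cases hc : (pathSys hI).mul p q with
  | none => exact quotMk_eq_zero.2 (pathSys_mul_none hI hc)
  | some c =>
    obtain ⟨h, h'⟩ := (pathSys_mul_some hI).1 hc
    rw [ofPath_mul_ofPath_of_eq h, h']
    exact (quotBasis_apply hI c).symm

theorem quotBasis_repr (x : PathAlg k Q) (p : (pathSys hI).B) :
    (quotBasis hI).repr (quotMk I x) p = coef p.1 x := by
  have : Finsupp.lapply p ∘ₗ (quotBasis hI).repr.toLinearMap ∘ₗ (quotMk I).toLinearMap =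
      coef p.1 := by
    refine hom_ext k fun q => ?_
    simp only [LinearMap.comp_apply, AlgHom.toLinearMap_apply, LinearEquiv.coe_coe,
      Finsupp.lapply_apply]
    by_cases hq : ofPath k q ∈ I
    · rw [quotMk_eq_zero.2 hq, map_zero, coef_ofPath_of_ne (fun h : q = p.1 => p.2 (by rw [← h]; exact hq))]
      rfl
    · let q' : (pathSys hI).B := ⟨q, hq⟩
      refine (congrArg (fun z => (quotBasis hI).repr z p) (quotBasis_apply hI q').symm).trans ?_
      rw [Module.Basis.repr_self]
      by_cases h : q = p.1
      · subst h
        rw [coef_ofPath_self]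
        exact Finsupp.single_eq_same
      · rw [coef_ofPath_of_ne h]
        exact Finsupp.single_eq_of_ne fun h' => h (congrArg Subtype.val h').symm
  exact LinearMap.congr_fun this x

section Radical

/-- The coefficient of a trivial path, as a ring homomorphism. -/
noncomputable def vertHom (v : V) : PathAlg k Q →+* k where
  toFun := coef (QPath.triv v)
  map_zero' := map_zero _
  map_add' := map_add _
  map_one' := by
    rw [one_def, map_sum, Finset.sum_eq_single v]
    · exact coef_ofPath_self _
    · intro u _ hu
      exact coef_ofPath_of_ne fun h => hu (congrArg QPath.src h)
    · exact fun h => absurd (Finset.mem_univ v) h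
  map_mul' x y := by
    -- A composite of paths is trivial only if both factors are.
    have key : ∀ p q : QPath Q, coef (QPath.triv v) (ofPath k p * ofPath k q) =
        coef (QPath.triv v) (ofPath k p) * coef (QPath.triv v) (ofPath k q) := by
      intro p q
      by_cases hp : p = QPath.triv v
      · subst hp
        rw [coef_ofPath_self, one_mul]
        by_cases hq : (QPath.triv v : QPath Q).tgt = q.src
        · rw [ofPath_mul_ofPath_of_eq hq]
          congr 2
          exact QPath.ext hq rfl rfl
        · rw [ofPath_mul_ofPath_of_ne hq, map_zero, coef_ofPath_of_ne]
          rintro rfl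
          exact hq rfl
      · rw [coef_ofPath_of_ne hp, zero_mul]
        by_cases hq : p.tgt = q.src
        · rw [ofPath_mul_ofPath_of_eq hq, coef_ofPath_of_ne]
          intro h
          apply hp
          have hl : p.length + q.length = 0 := by
            rw [← length_comp p q hq, h]; rfl
          rw [QPath.eq_triv (p := p) (by omega)]
          exact congrArg QPath.triv (congrArg QPath.src h)
        · rw [ofPath_mul_ofPath_of_ne hq, map_zero]
    induction x using pathAlg_induction with
    | h0 => simp
    | hadd x x' hx hx' => rw [add_mul, map_add, map_add, hx, hx', add_mul]
    | h c p =>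
      induction y using pathAlg_induction with
      | h0 => simp
      | hadd y y' hy hy' => rw [mul_add, map_add, map_add, hy, hy', mul_add]
      | h c' q =>
        rw [smul_mul_smul_comm, map_smul, map_smul, map_smul, key]
        simp only [smul_eq_mul]
        ring

include hI in
theorem vertHom_eq_zero (v : V) {x : PathAlg k Q} (hx : x ∈ I) : vertHom v x = 0 := by
  by_contra h
  exact absurd (hI.two_le _ (hI.of_coef x hx _ h)) (by simp [QPath.triv, QPath.length])

/-- The coefficient of a trivial path, as a ring homomorphism on the quotient. -/
noncomputable def quotVertHom (v : V) : QuotAlg I →+* k :=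
  RingCon.lift I.ringCon (vertHom v) (by
    intro x y hxy
    have := vertHom_eq_zero hI v ((TwoSidedIdeal.rel_iff I x y).1 hxy)
    rw [map_sub, sub_eq_zero] at this
    exact this)

theorem quotVertHom_mk (v : V) (x : PathAlg k Q) :
    quotVertHom hI v (quotMk I x) = coef (QPath.triv v) x := rfl

include hI in
-- Without trivial paths in its support, the power $x^m$ is supported on paths of length at least
-- $m$, and long paths lie in `I`.
theorem isNilpotent_of_coef (x : PathAlg k Q) (hx : ∀ v, coef (QPath.triv v) x = 0) :
    IsNilpotent (quotMk I x) := by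
  obtain ⟨N, hN⟩ := hI.exists_length
  have h1 : ∀ n, x ^ (n + 1) ∈ pathSpan k {p : QPath Q | n + 1 ≤ p.length} := fun n => by
    induction n with
    | zero =>
      rw [zero_add, pow_one, mem_pathSpan]
      intro p hp
      by_contra h
      refine hp ?_
      rw [QPath.eq_triv (p := p) (by simp at h; omega)]
      exact hx _
    | succ n ih =>
      rw [pow_succ]
      refine mul_mem_pathSpan (T' := {p : QPath Q | 1 ≤ p.length}) ?_ ih ?_
      · intro p hp q hq h
        have hp' : n + 1 ≤ p.length := hp
        have hq' : 1 ≤ q.length := hq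
        change n + 1 + 1 ≤ (p.comp q h).length
        rw [length_comp]; omega
      · rw [mem_pathSpan]
        intro p hp
        by_contra h
        refine hp ?_
        rw [QPath.eq_triv (p := p) (by simp at h; omega)]
        exact hx _
  refine ⟨N + 1, ?_⟩
  rw [← map_pow, quotMk_eq_zero]
  refine Submodule.span_induction (p := fun x _ => x ∈ I) ?_ I.zero_mem
    (fun y z _ _ hy hz => I.add_mem hy hz) (fun c y _ hy => smul_mem_twoSided _ c hy) (h1 N)
  rintro _ ⟨p, hp, rfl⟩
  have hp' : N + 1 ≤ p.length := hp
  exact hN p (by omega)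

/-- Each vertex gives a homomorphism onto the field `k`, whose kernel is maximal and so contains the
radical. Conversely, if all vertex coefficients of `x` vanish, then each `y * x` is nilpotent, so `1
+ y * x` is a unit. -/
theorem mem_jacobson_quotAlg (x : QuotAlg I) :
    x ∈ Ring.jacobson (QuotAlg I) ↔ ∀ p, (pathSys hI).len p = 0 → (quotBasis hI).repr x p = 0 := by
  have hcoef : (∀ p, (pathSys hI).len p = 0 → (quotBasis hI).repr x p = 0) ↔
      ∀ v, quotVertHom hI v x = 0 := by
    obtain ⟨x, rfl⟩ := quotMk_surjective x
    simp only [quotBasis_repr, quotVertHom_mk]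
    constructor
    · intro h v
      exact h ((pathSys hI).e v) rfl
    · intro h p hp
      have := QPath.eq_triv (p := p.1) hp
      rw [this]
      exact h _
  rw [hcoef]
  constructor
  · intro hx v
    have hmax : (RingHom.ker (quotVertHom hI v)).IsMaximal := by
      refine RingHom.ker_isMaximal_of_surjective _ fun c => ⟨quotMk I (c • ofPath k (QPath.triv v)), ?_⟩
      rw [quotVertHom_mk, map_smul, coef_ofPath_self, smul_eq_mul, mul_one]
    rw [← Ideal.jacobson_bot, Ideal.jacobson, Ideal.mem_sInf] at hx
    exact hx ⟨bot_le, hmax⟩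
  · intro hx
    rw [← Ideal.jacobson_bot, Ideal.mem_jacobson_iff]
    intro y
    have hn : IsNilpotent (y * x) := by
      obtain ⟨z, hz⟩ := quotMk_surjective (y * x)
      rw [← hz]
      refine isNilpotent_of_coef hI z fun v => ?_
      rw [← quotVertHom_mk hI, hz, map_mul, hx, mul_zero]
    obtain ⟨u, hu⟩ := hn.isUnit_one_add
    refine ⟨(u⁻¹ : (QuotAlg I)ˣ), ?_⟩
    have h1 : ((u⁻¹ : (QuotAlg I)ˣ) : QuotAlg I) * (1 + y * x) = 1 := by
      rw [← hu]; exact u.inv_mul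
    rw [mul_add, mul_one] at h1
    rw [Ideal.mem_bot, mul_assoc, ← h1]
    abel

end Radical

end PathBasis

/-! ### Walks on a basic cycle -/

section CyclicIndex

/-- The class of an integer modulo `n`, as an element of `Fin n`. -/
def cycIdx {n : ℕ} (hn : 0 < n) (m : ℤ) : Fin n :=
  ⟨(m % n).toNat, by
    have h1 := Int.emod_nonneg m (b := n) (by omega)
    have h2 := Int.emod_lt_of_pos m (b := n) (by omega)
    omega⟩

theorem val_cycIdx {n : ℕ} (hn : 0 < n) (m : ℤ) : ((cycIdx hn m : ℕ) : ℤ) = m % n := by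
  have h1 := Int.emod_nonneg m (b := n) (by omega)
  simp only [cycIdx]
  omega

theorem cycIdx_eq_iff {n : ℕ} (hn : 0 < n) {m m' : ℤ} :
    cycIdx hn m = cycIdx hn m' ↔ (n : ℤ) ∣ m - m' := by
  rw [Fin.ext_iff, ← Int.ofNat_inj, val_cycIdx, val_cycIdx, Int.emod_eq_emod_iff_emod_sub_eq_zero,
    Int.dvd_iff_emod_eq_zero]

theorem cycIdx_val {n : ℕ} (hn : 0 < n) (i : Fin n) : cycIdx hn (i : ℕ) = i := by
  rw [Fin.ext_iff, ← Int.ofNat_inj, val_cycIdx]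
  exact Int.emod_eq_of_lt (by omega) (by have := i.2; omega)

theorem finRotate_cycIdx {n : ℕ} (hn : 0 < n) (m : ℤ) :
    finRotate n (cycIdx hn m) = cycIdx hn (m + 1) := by
  obtain ⟨n, rfl⟩ : ∃ l, n = l + 1 := ⟨n - 1, by omega⟩
  rw [← cycIdx_val hn (finRotate (n + 1) _), cycIdx_eq_iff, val_finRotate]
  have h := val_cycIdx hn m
  have h2 := Int.mul_ediv_add_emod m ((n + 1 : ℕ) : ℤ)
  rw [← h] at h2
  refine ⟨if (cycIdx hn m : ℕ) = n then -(m / (n + 1 : ℕ)) - 1 else -(m / (n + 1 : ℕ)), ?_⟩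
  split_ifs with h3
  · rw [h3] at h2
    push_cast at h2 ⊢
    linarith
  · push_cast at h2 ⊢
    linarith

theorem isWalk_basicCycle {n : ℕ} (hn : 0 < n) (a : ℤ) (l : ℕ) :
    IsWalk (basicCycle n) (cycIdx hn a) ((List.range l).map fun t : ℕ => cycIdx hn (a + t))
      (cycIdx hn (a + l)) := by
  induction l generalizing a with
  | zero => simp [IsWalk]
  | succ l ih =>
    rw [List.range_succ_eq_map, List.map_cons, List.map_map]
    refine ⟨?_, ?_⟩
    · simp [basicCycle]
    · have h := ih (a + 1)
      change IsWalk _ (finRotate n _) _ _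
      rw [finRotate_cycIdx]
      convert h using 2
      · simp
      · funext t
        simp only [Function.comp_apply]
        congr 1
        push_cast
        ring
      · push_cast
        ring

/-- Each vertex of a basic cycle has a single outgoing arrow, so a walk is determined by its start
and its length. -/
theorem IsWalk.eq_basicCycle {n : ℕ} (hn : 0 < n) {i j : Fin n} {l : List (Fin n)}
    (h : IsWalk (basicCycle n) i l j) :
    l = (List.range l.length).map (fun t : ℕ => cycIdx hn ((i : ℕ) + t)) ∧
      j = cycIdx hn ((i : ℕ) + l.length) := by
  have key : ∀ (a : ℤ) (j : Fin n) (l : List (Fin n)), IsWalk (basicCycle n) (cycIdx hn a) l j →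
      l = (List.range l.length).map (fun t : ℕ => cycIdx hn (a + t)) ∧
        j = cycIdx hn (a + l.length) := by
    intro a j l h
    induction l generalizing a with
    | nil =>
      refine ⟨rfl, ?_⟩
      have h : cycIdx hn a = j := h
      simp [h]
    | cons b l ih =>
      obtain ⟨h1, h2⟩ := h
      have h1 : b = cycIdx hn a := h1
      subst h1
      have h2 : IsWalk (basicCycle n) (finRotate n (cycIdx hn a)) l j := h2
      rw [finRotate_cycIdx] at h2
      obtain ⟨h3, h4⟩ := ih _ h2
      constructor
      · rw [List.length_cons, List.range_succ_eq_map, List.map_cons, List.map_map]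
        congr 1
        · simp
        · refine h3.trans (List.map_congr_left fun t _ => ?_)
          simp only [Function.comp_apply]
          congr 1
          push_cast
          ring
      · rw [h4, List.length_cons]
        congr 1
        push_cast
        ring
  exact key _ j l (by rwa [cycIdx_val])

end CyclicIndex

/-! ### Walks, powers of words and closed walks as powers of proper cycles -/

section Walks

variable {V E : Type*} {Q : Quiv V E}

theorem IsWalk.tgt_unique {u w w' : V} {l : List E} (h : IsWalk Q u l w) (h' : IsWalk Q u l w') :
    w = w' := by
  induction l generalizing u with
  | nil => exact h.symm.trans h'
  | cons a l ih => exact ih h.2 h'.2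

theorem IsWalk.split {u w : V} {l l' : List E} (h : IsWalk Q u (l ++ l') w) :
    ∃ v, IsWalk Q u l v ∧ IsWalk Q v l' w := by
  induction l generalizing u with
  | nil => exact ⟨u, rfl, h⟩
  | cons a l ih =>
    obtain ⟨v, h1, h2⟩ := ih h.2
    exact ⟨v, ⟨h.1, h1⟩, h2⟩

theorem IsWalk.e_getElem {u w : V} {l : List E} (h : IsWalk Q u l w) (i : ℕ) (hi : i < l.length) :
    Q.e l[i] = if h' : i + 1 < l.length then Q.s l[i + 1] else w := by
  induction l generalizing u i with
  | nil => simp at hi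
  | cons a l ih =>
    cases i with
    | zero =>
      cases l with
      | nil => exact h.2
      | cons b l => simpa using h.2.1.symm
    | succ i =>
      have := ih h.2 i (by simpa using hi)
      simpa using this

theorem flatten_replicate_flatten_replicate {α : Type*} (m m' : ℕ) (w : List α) :
    (List.replicate m (List.replicate m' w).flatten).flatten =
      (List.replicate (m * m') w).flatten := by
  induction m with
  | zero => simp
  | succ m ih =>
    rw [List.replicate_succ, List.flatten_cons, ih, Nat.succ_mul, Nat.add_comm (m * m'),
      List.replicate_add, List.flatten_append]

theorem ofFn_eq_flatten_replicate {α : Type*} {P : ℤ → α} {g : ℕ} (hP : Function.Periodic P g)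
    (m : ℕ) : List.ofFn (fun i : Fin (m * g) => P (i : ℕ)) =
      (List.replicate m (List.ofFn fun i : Fin g => P (i : ℕ))).flatten := by
  rw [List.ofFn_mul, ← List.ofFn_const]
  congr 1
  refine congrArg List.ofFn (funext fun i => ?_)
  refine congrArg List.ofFn (funext fun j => ?_)
  have := (hP.nat_mul (i : ℕ)) (j : ℕ)
  rw [← this]
  congr 1
  push_cast
  ring

end Walks

section PeriodicSequences

variable {V E : Type*} {Q : Quiv V E}

/-- The periodic sequence of arrows of a cycle. -/
def QCycle.seq (Y : QCycle Q) (m : ℤ) : E := Y.arr (cycIdx Y.pos m)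

theorem QCycle.seq_val (Y : QCycle Q) (i : Fin Y.len) : Y.seq (i : ℕ) = Y.arr i := by
  rw [seq, cycIdx_val]

theorem QCycle.seq_periodic (Y : QCycle Q) {c : ℤ} (hc : (Y.len : ℤ) ∣ c) :
    Function.Periodic Y.seq c := fun m => by
  rw [seq, seq]
  congr 1
  rw [cycIdx_eq_iff]
  simpa using hc

theorem QCycle.e_seq (Y : QCycle Q) (m : ℤ) : Q.e (Y.seq m) = Q.s (Y.seq (m + 1)) := by
  rw [seq, seq, Y.closed, finRotate_cycIdx]

theorem QCycle.word_eq (Y : QCycle Q) : Y.word = List.ofFn fun i : Fin Y.len => Y.seq (i : ℕ) := by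
  simp only [seq_val]
  rfl

/-- The cycle defined by a periodic sequence of consecutive arrows. -/
def QCycle.ofSeq (P : ℤ → E) (hP : ∀ m, Q.e (P m) = Q.s (P (m + 1))) (g : ℕ) (hg : 0 < g)
    (hper : Function.Periodic P g) : QCycle Q where
  len := g
  pos := hg
  arr i := P (i : ℕ)
  closed i := by
    rw [hP]
    congr 1
    rw [← cycIdx_val hg i, finRotate_cycIdx, cycIdx_val]
    have h := val_cycIdx hg ((i : ℕ) + 1)
    rw [h]
    have h2 := Int.mul_ediv_add_emod ((i : ℕ) + 1 : ℤ) g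
    have h3 := (hper.int_mul (((i : ℕ) + 1 : ℤ) / g)) (((i : ℕ) + 1 : ℤ) % g)
    rw [← h3]
    congr 1
    push_cast
    linarith

/-- By Bézout the gcd of a period and the length is again a period, so the word is a power of its
prefix of that length. Properness forces the exponent to be `1`. -/
theorem QCycle.IsProper.dvd {Y : QCycle Q} (hY : Y.IsProper) {c : ℤ}
    (hc : Function.Periodic Y.seq c) : (Y.len : ℤ) ∣ c := by
  set g := Int.gcd c Y.len with hg
  have hgd : (g : ℤ) ∣ Y.len := Int.gcd_dvd_right ..
  have hgp : 0 < g := Int.gcd_pos_of_ne_zero_right _ (by have := Y.pos; omega)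
  have hper : Function.Periodic Y.seq g := by
    have h1 := (hc.int_mul (Int.gcdA c Y.len)).add_period
      ((Y.seq_periodic dvd_rfl).int_mul (Int.gcdB c Y.len))
    have h2 : (g : ℤ) = Int.gcdA c Y.len * c + Int.gcdB c Y.len * Y.len := by
      rw [hg, Int.gcd_eq_gcd_ab]
      ring
    rw [h2]
    exact h1
  obtain ⟨m, hm⟩ := Int.natCast_dvd_natCast.1 hgd
  have hw : Y.word = (List.replicate m (QCycle.ofSeq Y.seq Y.e_seq g hgp hper).word).flatten := by
    rw [Y.word_eq, QCycle.word, QCycle.ofSeq, ← ofFn_eq_flatten_replicate hper]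
    exact List.ofFn_congr (hm.trans (Nat.mul_comm _ _)) _
  have hm1 : m = 1 := by
    by_contra h
    refine hY ⟨_, m, ?_, hw⟩
    have := Y.pos
    rcases m with _ | _ | m
    · omega
    · omega
    · omega
  rw [hm, hm1, mul_one, hg]
  exact Int.gcd_dvd_left ..

theorem QCycle.isRotated_of_seq {Y Y' : QCycle Q} (hlen : Y.len = Y'.len) (c : ℤ)
    (h : ∀ m, Y'.seq m = Y.seq (m + c)) : Y.word ~r Y'.word := by
  refine ⟨(cycIdx Y.pos c : ℕ), List.ext_getElem ?_ fun i h1 h2 => ?_⟩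
  · simp [QCycle.word, hlen]
  · rw [List.getElem_rotate]
    simp only [QCycle.word, List.getElem_ofFn, List.length_ofFn]
    have h2' : i < Y'.len := by simpa [QCycle.word] using h2
    refine Eq.trans ?_ (((h i).symm.trans (Y'.seq_val ⟨i, h2'⟩)))
    refine congrArg Y.arr ?_
    rw [← cycIdx_val Y.pos ⟨_, _⟩, cycIdx_eq_iff]
    push_cast
    rw [val_cycIdx]
    apply Int.ModEq.dvd
    refine Int.ModEq.symm ((Int.mod_modEq _ _).trans ?_)
    exact Int.ModEq.add_left _ (Int.mod_modEq _ _)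

theorem QCycle.seq_of_isRotated {Y Y' : QCycle Q} (h : Y.word ~r Y'.word) :
    Y.len = Y'.len ∧ ∃ c : ℤ, ∀ m, Y'.seq m = Y.seq (m + c) := by
  obtain ⟨c, hc⟩ := h
  have hlen : Y.len = Y'.len := by
    have := congrArg List.length hc
    simpa [QCycle.word] using this
  refine ⟨hlen, c, fun m => ?_⟩
  have h1 : Y'.seq m = Y'.word[(cycIdx Y'.pos m : ℕ)]'(by simp [QCycle.word]) := by
    simp [QCycle.word, QCycle.seq]
  rw [h1]
  simp only [← hc]
  rw [List.getElem_rotate]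
  simp only [QCycle.word, List.getElem_ofFn, List.length_ofFn]
  refine congrArg Y.arr ?_
  rw [← cycIdx_val Y.pos ⟨_, _⟩, cycIdx_eq_iff]
  push_cast
  rw [val_cycIdx, ← hlen]
  apply Int.ModEq.dvd
  refine Int.ModEq.symm ((Int.mod_modEq _ _).trans ?_)
  exact Int.ModEq.add_right _ (Int.mod_modEq _ _)

/-- Every cycle is a power of a proper cycle. -/
theorem QCycle.exists_proper (Z : QCycle Q) :
    ∃ X : QCycle Q, X.IsProper ∧ X.len ∣ Z.len ∧ ∀ i : Fin Z.len, Z.arr i = X.seq (i : ℕ) := by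
  -- Among all cycles of which `Z` is a power, one of least length is chosen. If it were itself a
  -- proper power, its root would be shorter and still have `Z` as a power.
  have h0 : ∃ n, ∃ (X : QCycle Q) (m : ℕ), X.len = n ∧
      Z.word = (List.replicate m X.word).flatten := ⟨Z.len, Z, 1, rfl, by simp⟩
  classical
  obtain ⟨X, m, hX, hm⟩ := Nat.find_spec h0
  have hmin := fun n => Nat.find_min (m := n) h0
  rw [← hX] at hmin
  have hm' := hm
  rw [X.word_eq, ← ofFn_eq_flatten_replicate (X.seq_periodic dvd_rfl)] at hm'
  have hlen : Z.len = m * X.len := by simpa [QCycle.word] using congrArg List.length hm'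
  refine ⟨X, ?_, ⟨m, hlen.trans (Nat.mul_comm _ _)⟩, fun i => ?_⟩
  · rintro ⟨X', m', h2, hm2⟩
    have hl := congrArg List.length hm2
    simp only [QCycle.word, List.length_ofFn, List.length_flatten, List.map_replicate,
      List.sum_replicate, smul_eq_mul] at hl
    refine hmin X'.len ?_ ⟨X', m * m', rfl, ?_⟩
    · have := X'.pos
      rw [hl]
      nlinarith
    · rw [hm, hm2, flatten_replicate_flatten_replicate]
  · have h3 : Z.word[(i : ℕ)]'(by simp [QCycle.word]) = Z.arr i := by simp [QCycle.word]
    rw [← h3]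
    simp only [hm']
    simp

/-- Closed walks on the basic cycles of two proper cycles with the same image in `Q`. -/
theorem eq_of_map_eq {Y Y' : QCycle Q} (hY : Y.IsProper) (hY' : Y'.IsProper) {a : Fin Y.len}
    {a' : Fin Y'.len} {l : List (Fin Y.len)} {l' : List (Fin Y'.len)}
    (hl : IsWalk (basicCycle Y.len) a l a) (hl' : IsWalk (basicCycle Y'.len) a' l' a')
    (h : l.map Y.arr = l'.map Y'.arr) (hne : l ≠ []) :
    Y.len = Y'.len ∧ ∀ m, Y'.seq m = Y.seq (m + ((a : ℕ) - (a' : ℕ))) := by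
  obtain ⟨h1, h2⟩ := hl.eq_basicCycle Y.pos
  obtain ⟨h1', h2'⟩ := hl'.eq_basicCycle Y'.pos
  have hlen : l.length = l'.length := by simpa using congrArg List.length h
  have hpos : 0 < l.length := List.length_pos_of_ne_nil hne
  -- A closed walk on a basic cycle winds around it a whole number of times.
  have hd : (Y.len : ℤ) ∣ l.length := by
    have h2 := h2.symm
    nth_rewrite 2 [← cycIdx_val Y.pos a] at h2
    rw [cycIdx_eq_iff] at h2
    simpa using h2
  have hd' : (Y'.len : ℤ) ∣ l.length := by
    have h2' := h2'.symm
    nth_rewrite 2 [← cycIdx_val Y'.pos a'] at h2'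
    rw [cycIdx_eq_iff, ← hlen] at h2'
    simpa using h2'
  have key1 : ∀ t : ℕ, t < l.length → Y.seq ((a : ℕ) + t) = Y'.seq ((a' : ℕ) + t) := by
    intro t ht
    rw [h1, h1', ← hlen, List.map_map, List.map_map] at h
    have := congrArg (fun z => z[t]?) h
    simpa [QCycle.seq, List.getElem?_map, List.getElem?_range ht] using this
  -- The length of the walk is a period of both sequences, so agreement along one walk extends to
  -- all integers.
  have key2 : ∀ m : ℤ, Y.seq ((a : ℕ) + m) = Y'.seq ((a' : ℕ) + m) := by
    intro m
    have hm0 := Int.emod_nonneg m (b := l.length) (by omega)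
    have hm1 := Int.emod_lt_of_pos m (b := l.length) (by omega)
    have hm2 := Int.mul_ediv_add_emod m l.length
    obtain ⟨t, ht⟩ := Int.eq_ofNat_of_zero_le hm0
    have e1 := Y.seq_periodic (Dvd.dvd.mul_right hd (m / l.length)) ((a : ℕ) + t)
    have e2 := Y'.seq_periodic (Dvd.dvd.mul_right hd' (m / l.length)) ((a' : ℕ) + t)
    rw [ht] at hm2
    rw [add_assoc, add_comm (t : ℤ), hm2] at e1 e2
    rw [e1, e2]
    exact key1 t (by omega)
  have key3 : ∀ m, Y'.seq m = Y.seq (m + ((a : ℕ) - (a' : ℕ))) := by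
    intro m
    have := key2 (m - (a' : ℕ))
    rw [show ((a' : ℕ) : ℤ) + (m - (a' : ℕ)) = m by ring] at this
    rw [← this]
    congr 1
    ring
  refine ⟨?_, key3⟩
  -- The sequences are shifts of each other and share their periods; by properness each length
  -- divides the other.
  have hp : (Y.len : ℤ) ∣ Y'.len := hY.dvd fun m => by
    have := Y'.seq_periodic dvd_rfl (m - ((a : ℕ) - (a' : ℕ)))
    rw [key3, key3] at this
    convert this using 2 <;> ring
  have hp' : (Y'.len : ℤ) ∣ Y.len := hY'.dvd fun m => by
    rw [key3, key3, ← Y.seq_periodic dvd_rfl (m + ((a : ℕ) - (a' : ℕ)))]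
    congr 1
    ring
  exact Nat.dvd_antisymm (Int.natCast_dvd_natCast.1 hp) (Int.natCast_dvd_natCast.1 hp')

variable {rep : ProperOrbit Q → ProperCycle Q} (hrep : ∀ o, ⟦rep o⟧ = o)

include hrep in
theorem orbit_eq_of_map_eq {o o' : ProperOrbit Q} {a : Fin (rep o).1.len}
    {a' : Fin (rep o').1.len} {l : List (Fin (rep o).1.len)} {l' : List (Fin (rep o').1.len)}
    (hl : IsWalk (basicCycle _) a l a) (hl' : IsWalk (basicCycle _) a' l' a')
    (h : l.map (rep o).1.arr = l'.map (rep o').1.arr) (hne : l ≠ []) : o = o' := by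
  obtain ⟨h1, h2⟩ := eq_of_map_eq (rep o).2 (rep o').2 hl hl' h hne
  rw [← hrep o, ← hrep o']
  exact Quotient.sound (QCycle.isRotated_of_seq h1 _ h2)

/-- The difference of the two starting vertices is a period of the cycle, hence by properness a
multiple of its length. -/
theorem vertex_eq_of_map_eq {Y : QCycle Q} (hY : Y.IsProper) {a a' : Fin Y.len}
    {l l' : List (Fin Y.len)} (hl : IsWalk (basicCycle Y.len) a l a)
    (hl' : IsWalk (basicCycle Y.len) a' l' a') (h : l.map Y.arr = l'.map Y.arr) (hne : l ≠ []) :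
    a = a' := by
  have h2 := (eq_of_map_eq hY hY hl hl' h hne).2
  have := hY.dvd fun m => (h2 m).symm
  rw [← cycIdx_eq_iff Y.pos, cycIdx_val, cycIdx_val] at this
  exact this

include hrep in
-- The walk is a cycle, hence a power of a proper cycle `X`. The representative of the orbit of `X`
-- is a rotation of `X`, so the walk can be read along it from a shifted starting point.
theorem exists_closed_walk {v : V} {l : List E} (hl : IsWalk Q v l v) (hne : l ≠ []) :
    ∃ (o : ProperOrbit Q) (a : Fin (rep o).1.len) (l' : List (Fin (rep o).1.len)),
      IsWalk (basicCycle _) a l' a ∧ l'.map (rep o).1.arr = l := by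
  have hpos : 0 < l.length := List.length_pos_of_ne_nil hne
  have hcl : ∀ i : Fin l.length, Q.e (l.get i) = Q.s (l.get (finRotate l.length i)) := by
    obtain ⟨a, l, rfl⟩ := List.exists_cons_of_ne_nil hne
    intro i
    have h1 := hl.e_getElem i i.2
    have h2 := val_finRotate (n := l.length) i
    rw [List.get_eq_getElem, List.get_eq_getElem, h1]
    split_ifs with h
    · have h3 : ((finRotate (l.length + 1) i : Fin (l.length + 1)) : ℕ) = i + 1 := by
        rw [h2, if_neg]
        have h4 : (i : ℕ) + 1 < l.length + 1 := h
        omega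
      congr 2
      exact h3.symm
    · have h3 : ((finRotate (l.length + 1) i : Fin (l.length + 1)) : ℕ) = 0 := by
        rw [h2, if_pos]
        have h4 : ¬ (i : ℕ) + 1 < l.length + 1 := h
        have h5 : (i : ℕ) < l.length + 1 := i.2
        omega
      refine hl.1.symm.trans ?_
      congr 1
      have : ∀ j : ℕ, ∀ hj : j < (a :: l).length, j = 0 → a = (a :: l)[j] := by
        rintro _ _ rfl; rfl
      exact this _ _ h3
  obtain ⟨X, hX, hd, hXs⟩ := QCycle.exists_proper (⟨l.length, hpos, l.get, hcl⟩ : QCycle Q)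
  obtain ⟨hlen, c, hc⟩ := QCycle.seq_of_isRotated (Quotient.exact (hrep ⟦⟨X, hX⟩⟧))
  -- The offset `c` between `X` and the representative is the starting vertex. The walk closes up
  -- because the length of `X` divides that of `l`.
  have hw := isWalk_basicCycle (rep ⟦⟨X, hX⟩⟧).1.pos c l.length
  have hend : cycIdx (rep ⟦⟨X, hX⟩⟧).1.pos (c + l.length) = cycIdx (rep ⟦⟨X, hX⟩⟧).1.pos c := by
    rw [cycIdx_eq_iff, add_sub_cancel_left, hlen]
    exact Int.natCast_dvd_natCast.2 hd
  rw [hend] at hw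
  refine ⟨_, _, _, hw, List.ext_getElem (by simp) fun i h1 h2 => ?_⟩
  have h3 := hXs ⟨i, h2⟩
  rw [hc, add_comm] at h3
  simpa [QCycle.seq] using h3.symm

end PeriodicSequences

/-! ### Lifting tuples of paths to a basic cycle -/

section LinkedTuples

variable {V E : Type*} {Q : Quiv V E}

/-- The paths of the tuple `x` lead from one vertex of the tuple `v` to the next. -/
def Linked {m : ℕ} (x : Fin m → QPath Q) (v : Fin (m + 1) → V) : Prop :=
  ∀ i, (x i).src = v i.castSucc ∧ (x i).tgt = v i.succ

/-- The concatenation of the arrows of a tuple of paths. -/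
def concat {m : ℕ} (x : Fin m → QPath Q) : List E := (List.ofFn fun i => (x i).arrows).flatten

theorem concat_succ {m : ℕ} (x : Fin (m + 1) → QPath Q) :
    concat x = (x 0).arrows ++ concat fun i => x i.succ := by
  simp [concat, List.ofFn_succ]

theorem Linked.isWalk {m : ℕ} {x : Fin m → QPath Q} {v : Fin (m + 1) → V} (h : Linked x v) :
    IsWalk Q (v 0) (concat x) (v (Fin.last m)) := by
  induction m with
  | zero => rfl
  | succ m ih =>
    rw [concat_succ]
    have h1 := (x 0).isWalk
    rw [(h 0).1, (h 0).2] at h1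
    exact h1.append (ih (x := fun i => x i.succ) (v := fun i => v i.succ) fun i => h i.succ)

theorem exists_linked {n : ℕ} {x : Fin (n + 1) → QPath Q}
    (h : ∀ i, (x i).tgt = (x (finRotate (n + 1) i)).src) :
    ∃ v : Fin (n + 2) → V, Linked x v ∧ v 0 = (x 0).src ∧ v (Fin.last _) = (x 0).src := by
  refine ⟨Fin.snoc (α := fun _ => V) (fun i => (x i).src) (x 0).src, fun i => ⟨?_, ?_⟩, ?_, ?_⟩
  · rw [Fin.snoc_castSucc]
  · rw [h]
    refine Fin.lastCases ?_ (fun i => ?_) i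
    · rw [Fin.succ_last, Fin.snoc_last, finRotate_last]
    · rw [Fin.succ_castSucc, Fin.snoc_castSucc, PathSys.finRotate_castSucc]
  · exact Fin.snoc_castSucc (α := fun _ => V) (x 0).src (fun i => (x i).src) 0
  · rw [Fin.snoc_last]

theorem Linked.tgt_eq {n : ℕ} {x : Fin (n + 1) → QPath Q} {v : Fin (n + 2) → V} (h : Linked x v)
    (hv : v 0 = v (Fin.last _)) (i : Fin (n + 1)) :
    (x i).tgt = (x (finRotate (n + 1) i)).src := by
  rw [(h i).2, (h _).1]
  refine Fin.lastCases ?_ (fun i => ?_) i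
  · rw [Fin.succ_last, finRotate_last]
    exact hv.symm
  · rw [Fin.succ_castSucc, PathSys.finRotate_castSucc]

theorem concat_mapPath {m : ℕ} (Y : QCycle Q) (y : Fin m → QPath (basicCycle Y.len)) :
    concat (fun i => Y.mapPath (y i)) = (concat y).map Y.arr := by
  induction m with
  | zero => rfl
  | succ m ih =>
    rw [concat_succ, concat_succ, List.map_append]
    exact congrArg _ (ih fun i => y i.succ)

/-- A linked tuple of paths lifts along with its concatenation. -/
theorem Linked.lift {m : ℕ} {x : Fin m → QPath Q} {v : Fin (m + 1) → V} (h : Linked x v)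
    (Y : QCycle Q) {a b : Fin Y.len} {l : List (Fin Y.len)} (hl : IsWalk (basicCycle Y.len) a l b)
    (hx : l.map Y.arr = concat x) (ha : Q.s (Y.arr a) = v 0) :
    ∃ (y : Fin m → QPath (basicCycle Y.len)) (c : Fin (m + 1) → Fin Y.len), Linked y c ∧
      c 0 = a ∧ c (Fin.last _) = b ∧ ∀ i, Y.mapPath (y i) = x i := by
  induction m generalizing a l with
  | zero =>
    have hl0 : l = [] := List.map_eq_nil_iff.1 (hx.trans rfl)
    subst hl0
    exact ⟨Fin.elim0, fun _ => a, fun i => i.elim0, rfl, hl, fun i => i.elim0⟩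
  | succ m ih =>
    rw [concat_succ] at hx
    -- The lifted walk is cut where the first path ends; its first piece lifts that path and the
    -- rest is treated by induction.
    obtain ⟨l₁, l₂, rfl, h1, h2⟩ := List.map_eq_append_iff.1 hx
    obtain ⟨c, hc1, hc2⟩ := hl.split
    have hm : Y.mapPath ⟨a, c, l₁, hc1⟩ = x 0 := by
      refine QPath.ext (ha.trans (h 0).1.symm) ?_ h1
      refine (hc1.map_cycle Y).tgt_unique ?_
      rw [h1, ha, ← Fin.castSucc_zero, ← (h 0).1]
      exact (x 0).isWalk
    have hcv : Q.s (Y.arr c) = v (Fin.succ 0) := by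
      rw [← (h 0).2, ← hm]
      rfl
    obtain ⟨y, d, hy, hd0, hd1, hyx⟩ := ih (x := fun i => x i.succ) (v := fun i => v i.succ)
      (fun i => h i.succ) hc2 h2 hcv
    refine ⟨Fin.cons ⟨a, c, l₁, hc1⟩ y, Fin.cons a d, fun i => ?_, rfl, ?_, fun i => ?_⟩
    · refine Fin.cases ⟨rfl, hd0.symm⟩ (fun i => ?_) i
      exact ⟨(hy i).1, (hy i).2⟩
    · rw [← Fin.succ_last, Fin.cons_succ, hd1]
    · exact Fin.cases hm hyx i

/-- The source has to be given: a cycle may repeat vertices and arrows of `Q`. Once it is known, the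
length determines the path. -/
theorem mapPath_injective (Y : QCycle Q) {p q : QPath (basicCycle Y.len)}
    (h : Y.mapPath p = Y.mapPath q) (hs : p.src = q.src) : p = q := by
  obtain ⟨h1, h2⟩ := p.isWalk.eq_basicCycle Y.pos
  obtain ⟨h1', h2'⟩ := q.isWalk.eq_basicCycle Y.pos
  have hl : p.arrows.length = q.arrows.length := by
    exact (length_mapPath Y p).symm.trans ((congrArg QPath.length h).trans (length_mapPath Y q))
  refine QPath.ext hs ?_ ?_
  · rw [h2, h2', hl, hs]
  · rw [h1, h1', hl, hs]

/-- Only the first vertex has to agree, since each lifted path fixes the source of the next. -/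
theorem Linked.eq_of_mapPath_eq {m : ℕ} (Y : QCycle Q) {y y' : Fin m → QPath (basicCycle Y.len)}
    {c c' : Fin (m + 1) → Fin Y.len} (h : Linked y c) (h' : Linked y' c') (h0 : c 0 = c' 0)
    (hy : ∀ i, Y.mapPath (y i) = Y.mapPath (y' i)) : y = y' := by
  induction m with
  | zero => exact Subsingleton.elim _ _
  | succ m ih =>
    have e0 : y 0 = y' 0 := mapPath_injective Y (hy 0) (by
      rw [(h 0).1, (h' 0).1]; exact h0)
    have e1 := ih (y := fun i => y i.succ) (y' := fun i => y' i.succ) (c := fun i => c i.succ)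
      (c' := fun i => c' i.succ) (fun i => h i.succ) (fun i => h' i.succ)
      (by
        rw [← (h 0).2, ← (h' 0).2, e0]) fun i => hy i.succ
    exact funext (Fin.cases e0 fun i => congrFun e1 i)

end LinkedTuples

/-! ### Decomposition of the composable tuples over orbits of proper cycles -/

section CycleDecomposition

variable {k : Type*} [Field k] {V E : Type*} {Q : Quiv V E} [Fintype V]
  {I : TwoSidedIdeal (PathAlg k Q)} (hI : IsPathIdeal I)

/-- The image in `Q` of a nonzero path of a cycle algebra. -/
def liftMap (Y : QCycle Q) (p : (pathSys (hI.cycleIdeal Y)).B) : (pathSys hI).B :=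
  ⟨Y.mapPath p.1, fun h => p.2 ((ofPath_mem_cycleIdeal I Y p.1).2 h)⟩

/-- Relations are pulled back, so a composite on the basic cycle is nonzero exactly when its image
is. Composability upstairs must be assumed: images may compose in `Q` even where the paths do not,
which is why only composable tuples are compared. -/
theorem mul_liftMap (Y : QCycle Q) {p q : (pathSys (hI.cycleIdeal Y)).B} (h : p.1.tgt = q.1.src) :
    (pathSys hI).mul (liftMap hI Y p) (liftMap hI Y q) =
      ((pathSys (hI.cycleIdeal Y)).mul p q).map (liftMap hI Y) := by
  cases hc : (pathSys (hI.cycleIdeal Y)).mul p q with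
  | some c =>
    obtain ⟨h1, h2⟩ := (pathSys_mul_some _).1 hc
    refine (pathSys_mul_some hI).2 ⟨congrArg (fun i => Q.s (Y.arr i)) h, ?_⟩
    refine (mapPath_comp Y p.1 q.1 h).symm.trans ?_
    exact congrArg Y.mapPath h2
  | none =>
    have h1 := pathSys_mul_none _ hc
    rw [ofPath_mul_ofPath_of_eq h, ofPath_mem_cycleIdeal, mapPath_comp Y _ _ h] at h1
    cases hd : (pathSys hI).mul (liftMap hI Y p) (liftMap hI Y q) with
    | none => rfl
    | some d =>
      obtain ⟨h2, h3⟩ := (pathSys_mul_some hI).1 hd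
      exact absurd (h3 ▸ h1) d.2

theorem exists_linked_of_comp {n : ℕ} {x : Fin (n + 1) → (pathSys hI).B}
    (h : (pathSys hI).Comp n x) : ∃ v : Fin (n + 2) → V, Linked (fun i => (x i).1) v ∧
      v 0 = (x 0).1.src ∧ v (Fin.last _) = (x 0).1.src :=
  exists_linked fun i => not_not.1 (h i)

theorem concat_ne_nil {n : ℕ} {x : Fin (n + 1) → (pathSys hI).B}
    (h : ¬ (pathSys hI).Triv n x) : concat (fun i => (x i).1) ≠ [] := by
  intro h1
  refine h fun i => ?_
  rw [concat, List.flatten_eq_nil_iff] at h1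
  exact List.length_eq_zero_iff.2 (h1 _ (List.mem_ofFn.2 ⟨i, rfl⟩))

/-- The tuples of composable paths of a cycle algebra map injectively to those of `A`. -/
def cycleTuple (Y : QCycle Q) (n : ℕ) (y : (pathSys (hI.cycleIdeal Y)).pos.X n) :
    (pathSys hI).pos.X n :=
  ⟨fun i => liftMap hI Y (y.1 i), fun i => not_not.2
    (congrArg (fun j => Q.s (Y.arr j)) (not_not.1 (y.2.1 i))),
    fun h => y.2.2 fun i => (length_mapPath Y _).symm.trans (h i)⟩

variable {rep : ProperOrbit Q → ProperCycle Q} (hrep : ∀ o, ⟦rep o⟧ = o)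

include hrep in
-- The concatenations of both tuples are nonempty closed walks with the same image, and such an
-- image determines the orbit.
theorem cycleTuple_orbit_eq {n : ℕ} {o o' : ProperOrbit Q}
    {y : (pathSys (hI.cycleIdeal (rep o).1)).pos.X n}
    {y' : (pathSys (hI.cycleIdeal (rep o').1)).pos.X n}
    (h : cycleTuple hI (rep o).1 n y = cycleTuple hI (rep o').1 n y') : o = o' := by
  obtain ⟨v, hv, hv0, hv1⟩ := exists_linked_of_comp _ y.2.1
  obtain ⟨v', hv', hv0', hv1'⟩ := exists_linked_of_comp _ y'.2.1
  have hw := hv.isWalk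
  have hw' := hv'.isWalk
  rw [hv0, hv1] at hw
  rw [hv0', hv1'] at hw'
  refine orbit_eq_of_map_eq hrep hw hw' ?_ (concat_ne_nil _ y.2.2)
  rw [← concat_mapPath, ← concat_mapPath]
  exact congrArg (fun x : (pathSys hI).pos.X n => concat fun i => (x.1 i).1) h

/-- The common image of the concatenations determines the starting vertex by properness, and the
starting vertex determines the lifted tuple. -/
theorem cycleTuple_injective {Y : QCycle Q} (hY : Y.IsProper) (n : ℕ) :
    Function.Injective (cycleTuple hI Y n) := by
  intro y y' h
  obtain ⟨v, hv, hv0, hv1⟩ := exists_linked_of_comp _ y.2.1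
  obtain ⟨v', hv', hv0', hv1'⟩ := exists_linked_of_comp _ y'.2.1
  have hw := hv.isWalk
  have hw' := hv'.isWalk
  rw [hv1, ← hv0] at hw
  rw [hv1', ← hv0'] at hw'
  have h0 : v 0 = v' 0 := by
    refine vertex_eq_of_map_eq hY hw hw' ?_ (concat_ne_nil _ y.2.2)
    rw [← concat_mapPath, ← concat_mapPath]
    exact congrArg (fun x : (pathSys hI).pos.X n => concat fun i => (x.1 i).1) h
  have h1 := hv.eq_of_mapPath_eq Y hv' h0 fun i =>
    congrArg (fun x : (pathSys hI).pos.X n => (x.1 i).1) h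
  exact Subtype.ext (funext fun i => Subtype.ext (congrFun h1 i))

include hrep in
theorem exists_cycleTuple_eq {n : ℕ} (x : (pathSys hI).pos.X n) :
    ∃ o y, cycleTuple hI (rep o).1 n y = x := by
  obtain ⟨v, hv, hv0, hv1⟩ := exists_linked_of_comp _ x.2.1
  have hw := hv.isWalk
  rw [hv1, ← hv0] at hw
  have hne := concat_ne_nil _ x.2.2
  obtain ⟨o, a, l, hl, hlx⟩ := exists_closed_walk hrep hw hne
  -- Both vertices are the source of the first arrow of the concatenation, which exists because the
  -- tuple is not all trivial.
  have ha : Q.s ((rep o).1.arr a) = v 0 := by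
    have h1 := hl.map_cycle (rep o).1
    rw [hlx] at h1
    obtain ⟨b, l', hb⟩ := List.exists_cons_of_ne_nil hne
    rw [hb] at h1 hw
    exact h1.1.symm.trans hw.1
  obtain ⟨y, c, hy, hc0, hc1, hyx⟩ := hv.lift (rep o).1 hl hlx ha
  refine ⟨o, ⟨fun i => ⟨y i, fun h => (x.1 i).2 ?_⟩, fun i => not_not.2 ?_, fun h => x.2.2 fun i => ?_⟩,
    Subtype.ext (funext fun i => Subtype.ext (hyx i))⟩
  · rw [← hyx i]
    exact (ofPath_mem_cycleIdeal I _ _).1 h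
  · exact hy.tgt_eq (hc0.trans hc1.symm) i
  · change (x.1 i).1.length = 0
    rw [← hyx i, length_mapPath]
    exact h i

/-- The embedding of the composable tuples of a cycle algebra. -/
def cycleEmb {Y : QCycle Q} (hY : Y.IsProper) :
    PCyc.Emb (pathSys (hI.cycleIdeal Y)).pos (pathSys hI).pos where
  g := cycleTuple hI Y
  inj := cycleTuple_injective hI hY
  f_g n i x := by
    apply Option.map_injective Subtype.val_injective
    -- The members of `pos` are composable, which provides the hypothesis of `mul_liftMap`.
    have hmul : (pathSys hI).mul (liftMap hI Y (x.1 i.castSucc)) (liftMap hI Y (x.1 i.succ)) = _ :=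
      mul_liftMap hI Y (p := x.1 i.castSucc) (q := x.1 i.succ) (by
      have h := not_not.1 (x.2.1 i.castSucc)
      rw [PathSys.finRotate_castSucc] at h
      exact h)
    have e1 := (((pathSys hI).tuples.subEmb _ (pathSys hI).biStable_pos.stable).f_g n i
      (cycleTuple hI Y (n + 1) x)).symm
    have e2 := (((pathSys (hI.cycleIdeal Y)).tuples.subEmb _
      (pathSys (hI.cycleIdeal Y)).biStable_pos.stable).f_g n i x).symm
    have e3 : ∀ z : Option ((pathSys (hI.cycleIdeal Y)).pos.X n),
        (z.map fun y => y.1).map (fun y j => liftMap hI Y (y j)) =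
          (z.map (cycleTuple hI Y n)).map Subtype.val := fun z => by cases z <;> rfl
    refine e1.trans (Eq.trans ?_ ((congrArg _ e2).symm.trans (e3 _)))
    change Option.map _ ((pathSys hI).mul (liftMap hI Y (x.1 i.castSucc))
      (liftMap hI Y (x.1 i.succ))) = Option.map _ (Option.map _ _)
    rw [hmul, Option.map_map, Option.map_map]
    refine congrArg (fun F => Option.map F _) (funext fun c => funext fun j => ?_)
    change (pathSys hI).merge i (liftMap hI Y c) _ j =
      liftMap hI Y ((pathSys (hI.cycleIdeal Y)).merge i c x.1 j)
    rw [PathSys.merge_apply, PathSys.merge_apply]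
    split_ifs <;> rfl
  r_g n x := rfl

include hrep in
theorem cycleEmb_bijective (n : ℕ) : Function.Bijective
    fun p : Σ o : ProperOrbit Q, (pathSys (hI.cycleIdeal (rep o).1)).pos.X n =>
      (cycleEmb hI (rep p.1).2).g n p.2 := by
  constructor
  · rintro ⟨o, y⟩ ⟨o', y'⟩ h
    obtain rfl := cycleTuple_orbit_eq hI hrep h
    obtain rfl := cycleTuple_injective hI (rep o).2 n h
    rfl
  · intro x
    obtain ⟨o, y, h⟩ := exists_cycleTuple_eq hI hrep x
    exact ⟨⟨o, y⟩, h⟩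

include hrep in
theorem HH_pos_equiv (n : ℕ) : Nonempty ((pathSys hI).pos.HH k n ≃ₗ[k]
    ⨁ o, (pathSys (hI.cycleIdeal (rep o).1)).pos.HH k n) :=
  PCyc.HH_directSum k (fun o => cycleEmb hI (rep o).2) (cycleEmb_bijective hI hrep) n

include hrep in
theorem HC_pos_equiv (n : ℕ) : Nonempty ((pathSys hI).pos.HC k n ≃ₗ[k]
    ⨁ o, (pathSys (hI.cycleIdeal (rep o).1)).pos.HC k n) :=
  PCyc.HC_directSum k (fun o => cycleEmb hI (rep o).2) (cycleEmb_bijective hI hrep) n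

end CycleDecomposition

/-! ### Absolute and relative homology of a quotient in terms of `pos` -/

section QuotientAlgebras

variable {k : Type*} [Field k] {V E : Type*} {Q : Quiv V E} [Fintype V]
  {I : TwoSidedIdeal (PathAlg k Q)} (hI : IsPathIdeal I)

include hI

theorem HH_quotAlg {n : ℕ} (hn : 1 ≤ n) :
    Nonempty (HH k (QuotAlg I) n ≃ₗ[k] (pathSys hI).pos.HH k n) := by
  obtain ⟨n, rfl⟩ : ∃ m, n = m + 1 := ⟨n - 1, by omega⟩
  obtain ⟨e⟩ := PathSys.HH_equiv_tuples (quotBasis hI) (quotBasis_mul hI) (n + 1)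
  obtain ⟨e'⟩ := (pathSys hI).HH_tuples_succ k n
  exact ⟨e.trans e'⟩

theorem HH_quotAlg_zero :
    Nonempty (HH k (QuotAlg I) 0 ≃ₗ[k] (V → k) × (pathSys hI).pos.HH k 0) := by
  obtain ⟨e⟩ := PathSys.HH_equiv_tuples (quotBasis hI) (quotBasis_mul hI) 0
  obtain ⟨e'⟩ := (pathSys hI).HH_tuples_zero k
  exact ⟨e.trans e'⟩

theorem HC_quotAlg_odd {n : ℕ} (hn : Odd n) :
    Nonempty (HC k (QuotAlg I) n ≃ₗ[k] (pathSys hI).pos.HC k n) := by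
  obtain ⟨e⟩ := PathSys.HC_equiv_tuples (quotBasis hI) (quotBasis_mul hI) n
  obtain ⟨e'⟩ := (pathSys hI).HC_tuples_odd k hn
  exact ⟨e.trans e'⟩

theorem HC_quotAlg_even {n : ℕ} (hn : Even n) :
    Nonempty (HC k (QuotAlg I) n ≃ₗ[k] (V → k) × (pathSys hI).pos.HC k n) := by
  obtain ⟨e⟩ := PathSys.HC_equiv_tuples (quotBasis hI) (quotBasis_mul hI) n
  obtain ⟨e'⟩ := (pathSys hI).HC_tuples_even k hn
  exact ⟨e.trans e'⟩

theorem RelHH_quotAlg (n : ℕ) : Nonempty (RelHH k (QuotAlg I) (Ring.jacobson (QuotAlg I)) n ≃ₗ[k]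
    (pathSys hI).pos.HH k n) := by
  obtain ⟨e⟩ := PathSys.RelHH_equiv_nontriv (quotBasis hI) (Ring.jacobson (QuotAlg I))
    (mem_jacobson_quotAlg hI) (quotBasis_mul hI) n
  obtain ⟨e'⟩ := (pathSys hI).HH_nontriv k n
  exact ⟨e.trans e'⟩

theorem RelHC_quotAlg (n : ℕ) : Nonempty (RelHC k (QuotAlg I) (Ring.jacobson (QuotAlg I)) n ≃ₗ[k]
    (pathSys hI).pos.HC k n) := by
  obtain ⟨e⟩ := PathSys.RelHC_equiv_nontriv (quotBasis hI) (Ring.jacobson (QuotAlg I))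
    (mem_jacobson_quotAlg hI) (quotBasis_mul hI) n
  obtain ⟨e'⟩ := (pathSys hI).HC_nontriv k n
  exact ⟨e.trans e'⟩

end QuotientAlgebras

theorem directSum_nonempty_equiv {k ι : Type*} [Field k] {M N : ι → Type*}
    [∀ i, AddCommGroup (M i)] [∀ i, Module k (M i)] [∀ i, AddCommGroup (N i)]
    [∀ i, Module k (N i)] (h : ∀ i, Nonempty (M i ≃ₗ[k] N i)) :
    Nonempty ((⨁ i, M i) ≃ₗ[k] ⨁ i, N i) :=
  ⟨DFinsupp.mapRange.linearEquiv fun i => (h i).some⟩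

end MonomialHH

theorem mainTheorem6 {k V E : Type*} [Field k] [Fintype V] [Finite E]
    (Q : MonomialHH.Quiv V E) (I : TwoSidedIdeal (MonomialHH.PathAlg k Q))
    (hadm : MonomialHH.IsAdmissible I) (hmon : MonomialHH.IsMonomial I)
    (rep : MonomialHH.ProperOrbit Q → MonomialHH.ProperCycle Q) (hrep : ∀ o, ⟦rep o⟧ = o) :
    (∀ n : ℕ, 1 ≤ n →
      Nonempty (MonomialHH.HH k (MonomialHH.QuotAlg I) n ≃ₗ[k]
        ⨁ o, MonomialHH.HH k (MonomialHH.CycleAlg I (rep o).1) n)) ∧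
    Nonempty (MonomialHH.HH k (MonomialHH.QuotAlg I) 0 ≃ₗ[k]
      (V → k) × ⨁ o, MonomialHH.RelHH k (MonomialHH.CycleAlg I (rep o).1)
        (Ring.jacobson (MonomialHH.CycleAlg I (rep o).1)) 0) ∧
    (∀ n : ℕ, Odd n →
      Nonempty (MonomialHH.HC k (MonomialHH.QuotAlg I) n ≃ₗ[k]
        ⨁ o, MonomialHH.HC k (MonomialHH.CycleAlg I (rep o).1) n)) ∧
    (∀ n : ℕ, Even n →
      Nonempty (MonomialHH.HC k (MonomialHH.QuotAlg I) n ≃ₗ[k]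
        (V → k) × ⨁ o, MonomialHH.RelHC k (MonomialHH.CycleAlg I (rep o).1)
          (Ring.jacobson (MonomialHH.CycleAlg I (rep o).1)) n)) := by
  have hI := MonomialHH.isPathIdeal_of_monomial hadm hmon
  refine ⟨fun n hn => ?_, ?_, fun n hn => ?_, fun n hn => ?_⟩
  · obtain ⟨e₁⟩ := MonomialHH.HH_quotAlg hI hn
    obtain ⟨e₂⟩ := MonomialHH.HH_pos_equiv hI hrep n
    obtain ⟨e₃⟩ := MonomialHH.directSum_nonempty_equiv fun o =>
      MonomialHH.HH_quotAlg (hI.cycleIdeal (rep o).1) hn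
    exact ⟨(e₁.trans e₂).trans e₃.symm⟩
  · obtain ⟨e₁⟩ := MonomialHH.HH_quotAlg_zero hI
    obtain ⟨e₂⟩ := MonomialHH.HH_pos_equiv hI hrep 0
    obtain ⟨e₃⟩ := MonomialHH.directSum_nonempty_equiv fun o =>
      MonomialHH.RelHH_quotAlg (hI.cycleIdeal (rep o).1) 0
    exact ⟨e₁.trans ((LinearEquiv.refl k _).prodCongr (e₂.trans e₃.symm))⟩
  · obtain ⟨e₁⟩ := MonomialHH.HC_quotAlg_odd hI hn
    obtain ⟨e₂⟩ := MonomialHH.HC_pos_equiv hI hrep n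
    obtain ⟨e₃⟩ := MonomialHH.directSum_nonempty_equiv fun o =>
      MonomialHH.HC_quotAlg_odd (hI.cycleIdeal (rep o).1) hn
    exact ⟨(e₁.trans e₂).trans e₃.symm⟩
  · obtain ⟨e₁⟩ := MonomialHH.HC_quotAlg_even hI hn
    obtain ⟨e₂⟩ := MonomialHH.HC_pos_equiv hI hrep n
    obtain ⟨e₃⟩ := MonomialHH.directSum_nonempty_equiv fun o =>
      MonomialHH.RelHC_quotAlg (hI.cycleIdeal (rep o).1) n
    exact ⟨e₁.trans ((LinearEquiv.refl k _).prodCongr (e₂.trans e₃.symm))⟩
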